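/- **Setting.** For $n,m\in\mathbb N$, a morphism $f:n\to m$ of $\mathbf{SOP}$ is a formal expression $$f=s\sum_{y_1,\dots,y_k}e^{2i\pi P}\,|O_1,\dots,O_m\rangle\langle I_1,\dots,I_n|$$ with $s\in\mathbb R$, $k\in\mathbb N$, a phase polynomial $P\in\mathbb R[y_1,\dots,y_k]/(1,y_i^2-y_i)$ (that is, real polynomials computed with $y_i^2=y_i$, with coefficients modulo $\mathbb Z$), and $O_j,I_j\in\mathbb F_2[y_1,\dots,y_k]$; expressions are taken up to bijective renaming of the summation variables. For a Boolean polynomial $Q$, $\widehat Q$ is the integer polynomial given by $\widehat 0=0$, $\widehat 1=1$, $\widehat y=y$, $\widehat{pq}=\widehat p\,\widehat q$, $\widehat{p\oplus q}=\widehat p+\widehat q-2\widehat p\,\widehat q$. The relation $\sim_{\mathrm{Clif+}}$ is the equivalence relation on the morphisms $n\to m$ generated by the following rules, where $y_0\neq y_0'$ are summation variables, $[y\leftarrow Q]$ is substitution (of $\widehat Q$ in phase polynomials), and an arbitrary scalar $s$ may stand in front of the left-hand side, and then also multiplies the right-hand side, except in (Z), where it is dropped: * (Elim) $\sum_{\vec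 y}e^{2i\pi P}|\vec O\rangle\langle\vec I|\to 2\sum_{\vec y\setminus\{y_0\}}e^{2i\pi P}|\vec O\rangle\langle\vec I|$ if $y_0$ does not occur in $P,\vec O,\vec I$; * (HH) $\sum_{\vec y}e^{2i\pi(\frac{y_0}{2}(y_0'+\widehat Q)+R)}|\vec O\rangle\langle\vec I|\to 2\sum_{\vec y\setminus\{y_0,y_0'\}}e^{2i\pi R[y_0'\leftarrow\widehat Q]}(|\vec O\rangle\langle\vec I|)[y_0'\leftarrow Q]$ if $y_0$ does not occur in $R,Q,\vec O,\vec I$ and $y_0'$ does not occur in $Q$; * ($\omega$) $\sum_{\vec y}e^{2i\pi(\frac{y_0}{4}+\frac{y_0}{2}\widehat Q+R)}|\vec O\rangle\langle\vec I|\to\sqrt2\sum_{\vec y\setminus\{y_0\}}e^{2i\pi(\frac18-\frac14\widehat Q+R)}|\vec O\rangle\langle\vec I|$ if $y_0$ does not occur in $Q,R,\vec O,\vec I$; * (ket) $\sum_{\vec y}e^{2i\pi P}|\vec O\rangle\langle\vec I|\to\sum_{\vec y}e^{2i\pi P[y_0\leftarrow\widehat{O_i}]}(|\vec O\rangle\langle\vec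 I|)[y_0\leftarrow O_i]$ if $O_i=y_0\oplus O_i'$ with $O_i'\neq0$ and $y_0$ does not occur in $O_1,\dots,O_{i-1},O_i'$; * (bra) $\sum_{\vec y}e^{2i\pi P}|\vec O\rangle\langle\vec I|\to\sum_{\vec y}e^{2i\pi P[y_0\leftarrow\widehat{I_i}]}(|\vec O\rangle\langle\vec I|)[y_0\leftarrow I_i]$ if $I_i=y_0\oplus I_i'$ with $I_i'\neq0$ and $y_0$ does not occur in $\vec O,I_1,\dots,I_{i-1},I_i'$; * (Z) $s\sum_{\vec y}e^{2i\pi(\frac{y_0}{2}+R)}|\vec O\rangle\langle\vec I|\to\sum_{y_0}e^{2i\pi\frac{y_0}{2}}|0,\dots,0\rangle\langle0,\dots,0|$ if $y_0$ does not occur in $R,\vec O,\vec I$ and $R,\vec O,\vec I$ are not all zero. The morphisms of $\mathbf{SOP}_{\mathrm{Clif}}$ are those of the form $$\frac1{\sqrt2^{\,p}}\sum_{y_1,\dots,y_k}e^{2i\pi\left(\frac18P^{(0)}+\frac14P^{(1)}+\frac12P^{(2)}\right)}|\vec O\rangle\langle\vec I|,$$ where $p\in\mathbb Z$, $P^{(i)}$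 is a polynomial with integer coefficients of degree at most $i$, and all $O_j$, $I_j$ have degree at most $1$. Such a morphism is presented by $n$, $m$, $p$, $k$, $P^{(0)}$ and by the lists of the monomials of $P^{(1)}$, $P^{(2)}$, of the $O_j$ and of the $I_j$. **Corollary.** Equality of morphisms in $\mathbf{SOP}_{\mathrm{Clif}}/\!\sim_{\mathrm{Clif+}}$ is decidable in time polynomial in the size of the phase polynomials and the combined size of the ket and bra polynomials. That is, there are one program for a random access machine (integer registers and arrays; addition, subtraction, halving, indirect access and sign tests at unit cost) and one polynomial $q$ such that, for all $n,m$ and all presentations of morphisms $t_1,t_2:n\to m$ of $\mathbf{SOP}_{\mathrm{Clif}}$, the program halts after at most $q(N)$ steps and answers correctly whether $t_1\sim_{\mathrm{Clif+}}t_2$, where $N$ is the total number of monomials in the two presentations, plus one for each $P^{(0)}$ and one for each ket or bra polynomial. -/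

import Mathlib

noncomputable section

/-! ### Phase polynomials and Boolean polynomials -/

/-- Boolean polynomials in the variables `y_0, …, y_{k-1}`. -/
abbrev BoolPoly (k : ℕ) : Type := MvPolynomial (Fin k) (ZMod 2)

/-- The ideal of `ℝ[X_0, …, X_{k-1}]` generated by the polynomials `X_i ^ 2 - X_i`. -/
def squareIdeal (k : ℕ) : Ideal (MvPolynomial (Fin k) ℝ) :=
  Ideal.span (Set.range fun i : Fin k => MvPolynomial.X i ^ 2 - MvPolynomial.X i)

/-- The polynomials that are identified with `0` in a phase: those that become a polynomial with
integer coefficients when computed modulo `X_i ^ 2 = X_i`. -/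
def phaseZero (k : ℕ) : AddSubgroup (MvPolynomial (Fin k) ℝ) :=
  (squareIdeal k).toAddSubgroup ⊔
    (MvPolynomial.map (σ := Fin k) (Int.castRingHom ℝ)).range.toAddSubgroup

/-- Phase polynomials, `ℝ[X_0, …, X_{k-1}] / (1, X_i ^ 2 - X_i)`; "modulo `1`" means that the
coefficients are taken modulo the integers, so this is a quotient of additive groups. -/
abbrev PhasePoly (k : ℕ) : Type := MvPolynomial (Fin k) ℝ ⧸ phaseZero k

/-- The class of a real polynomial. -/
def PhasePoly.mk {k : ℕ} (P : MvPolynomial (Fin k) ℝ) : PhasePoly k := QuotientAddGroup.mk P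

/-- The operation that represents `⊕` on integer polynomials. -/
def hatAdd {k : ℕ} (a b : MvPolynomial (Fin k) ℤ) : MvPolynomial (Fin k) ℤ := a + b - 2 * (a * b)

instance {k : ℕ} : Std.Commutative (hatAdd (k := k)) := ⟨fun a b => by unfold hatAdd; ring⟩

instance {k : ℕ} : Std.Associative (hatAdd (k := k)) := ⟨fun a b c => by unfold hatAdd; ring⟩

/-- The immersion of a Boolean polynomial into the integer polynomials: monomials are kept and
`p ⊕ q` becomes `p + q - 2 p q`. -/
def hatInt {k : ℕ} (Q : BoolPoly k) : MvPolynomial (Fin k) ℤ :=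
  Q.support.fold hatAdd 0 fun d => MvPolynomial.monomial d 1

/-- The immersion of a Boolean polynomial into the real polynomials. -/
def hat {k : ℕ} (Q : BoolPoly k) : MvPolynomial (Fin k) ℝ :=
  MvPolynomial.map (Int.castRingHom ℝ) (hatInt Q)

theorem X_sq_sub_mem {k : ℕ} (i : Fin k) :
    (MvPolynomial.X i ^ 2 - MvPolynomial.X i : MvPolynomial (Fin k) ℝ) ∈ squareIdeal k :=
  Ideal.subset_span ⟨i, rfl⟩

theorem monomial_sq_sub_mem {k : ℕ} (d : Fin k →₀ ℕ) :
    (MvPolynomial.monomial d 1 ^ 2 - MvPolynomial.monomial d 1 : MvPolynomial (Fin k) ℝ) ∈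
      squareIdeal k := by
  rw [← Ideal.Quotient.eq, map_pow]
  have hX : ∀ i : Fin k, Ideal.Quotient.mk (squareIdeal k) (MvPolynomial.X i) ^ 2 =
      Ideal.Quotient.mk (squareIdeal k) (MvPolynomial.X i) := fun i => by
    rw [← map_pow]; exact Ideal.Quotient.eq.2 (X_sq_sub_mem i)
  rw [MvPolynomial.monomial_eq, Finsupp.prod, map_one, one_mul, map_prod, ← Finset.prod_pow]
  refine Finset.prod_congr rfl fun i _ => ?_
  rw [map_pow, ← pow_mul, mul_comm, pow_mul, hX]

theorem hat_sq_sub_mem {k : ℕ} (Q : BoolPoly k) : hat Q ^ 2 - hat Q ∈ squareIdeal k := by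
  unfold hat hatInt
  induction Q.support using Finset.induction_on with
  | empty => simp
  | insert d s hd ih =>
    rw [Finset.fold_insert hd]
    have h1 := monomial_sq_sub_mem d
    rw [← Ideal.Quotient.eq, map_pow] at h1 ih ⊢
    simp only [hatAdd, map_sub, map_add, map_mul, MvPolynomial.map_monomial, map_one, map_ofNat]
      at h1 ih ⊢
    linear_combination
      (1 - 4 * Ideal.Quotient.mk (squareIdeal k) (MvPolynomial.map (Int.castRingHom ℝ)
          (s.fold hatAdd 0 fun d => MvPolynomial.monomial d 1)) +
        4 * Ideal.Quotient.mk (squareIdeal k) (MvPolynomial.map (Int.castRingHom ℝ)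
          (s.fold hatAdd 0 fun d => MvPolynomial.monomial d 1)) ^ 2) * h1 +
      ih

theorem aeval_hat_mem_phaseZero {k l : ℕ} (σ : Fin k → BoolPoly l)
    (P : MvPolynomial (Fin k) ℝ) (hP : P ∈ phaseZero k) :
    MvPolynomial.aeval (fun i => hat (σ i)) P ∈ phaseZero l := by
  obtain ⟨a, ha, b, ⟨c, rfl⟩, rfl⟩ := AddSubgroup.mem_sup.1 hP
  rw [map_add]
  refine add_mem (AddSubgroup.mem_sup_left ?_) (AddSubgroup.mem_sup_right ?_)
  · have hle : squareIdeal k ≤ (squareIdeal l).comap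
        (MvPolynomial.aeval (R := ℝ) fun i => hat (σ i)) := by
      refine Ideal.span_le.2 ?_
      rintro _ ⟨i, rfl⟩
      simpa using hat_sq_sub_mem (σ i)
    exact hle ha
  · clear hP
    refine ⟨MvPolynomial.aeval (fun i => hatInt (σ i)) c, ?_⟩
    induction c using MvPolynomial.induction_on with
    | C z => simp
    | add p q hp hq => rw [map_add, map_add, map_add, map_add, hp, hq]
    | mul_X p i hp =>
      rw [map_mul, map_mul, map_mul, map_mul, hp]
      simp [hat]

/-- The substitution `P[y_i ← σ_i]` of Boolean polynomials in a phase polynomial, through their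
immersions. With `σ i = X (f i)` it is the renaming of variables along `f`. -/
def PhasePoly.subst {k l : ℕ} (σ : Fin k → BoolPoly l) : PhasePoly k →+ PhasePoly l :=
  QuotientAddGroup.map (phaseZero k) (phaseZero l)
    (MvPolynomial.aeval (R := ℝ) fun i => hat (σ i)).toRingHom.toAddMonoidHom
    (fun P hP => aeval_hat_mem_phaseZero σ P hP)

/-- Renaming of variables in a phase polynomial. -/
def PhasePoly.rename {k l : ℕ} (f : Fin k → Fin l) : PhasePoly k →+ PhasePoly l :=
  PhasePoly.subst fun i => MvPolynomial.X (f i)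

/-- The substitution `Q[y_i ← σ_i]` in a Boolean polynomial. -/
def BoolPoly.subst {k l : ℕ} (σ : Fin k → BoolPoly l) (Q : BoolPoly k) : BoolPoly l :=
  MvPolynomial.bind₁ σ Q

/-- Renaming of variables in a Boolean polynomial. -/
def BoolPoly.rename {k l : ℕ} (f : Fin k → Fin l) (Q : BoolPoly k) : BoolPoly l :=
  MvPolynomial.rename f Q

/-! ### Sums over paths -/

/-- A morphism `n → m` of `SOP`: `s ∑_{y_0, …, y_{k-1}} e^{2 i π P} |O_1, …, O_m⟩⟨I_1, …, I_n|`.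
Names of the summation variables matter only up to `SOP.Alpha` below. -/
structure SOP (n m : ℕ) where
  /-- the scalar `s` -/
  scalar : ℝ
  /-- the number `k` of summation variables -/
  numVars : ℕ
  /-- the phase polynomial `P` -/
  phase : PhasePoly numVars
  /-- the ket polynomials -/
  ket : Fin m → BoolPoly numVars
  /-- the bra polynomials -/
  bra : Fin n → BoolPoly numVars

/-- `α`-conversion: renaming the summation variables by a bijection. -/
inductive SOP.Alpha {n m : ℕ} : SOP n m → SOP n m → Prop
  | mk {k : ℕ} (e : Fin k ≃ Fin k) (s : ℝ) (P : PhasePoly k)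
      (O : Fin m → BoolPoly k) (I : Fin n → BoolPoly k) :
      SOP.Alpha ⟨s, k, P, O, I⟩
        ⟨s, k, P.rename e, fun i => (O i).rename e, fun i => (I i).rename e⟩

open MvPolynomial in
/-- The rewrite rules of `Clif+`. Up to `α`-conversion, the variable `y₀` that (Elim), (HH), (ω)
and (Z) single out is the variable of index `0`, and the variable `y₀'` of (HH) is the next one.
That `y₀` does not occur in a polynomial is expressed by its being the image under
`rename Fin.succ` of a polynomial in the other variables. -/
inductive SOP.Rewrite {n m : ℕ} : SOP n m → SOP n m → Prop
  | elim {k : ℕ} (s : ℝ) (P : PhasePoly k) (O : Fin m → BoolPoly k) (I : Fin n → BoolPoly k) :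
      SOP.Rewrite
        ⟨s, k + 1, P.rename Fin.succ, fun i => (O i).rename Fin.succ,
          fun i => (I i).rename Fin.succ⟩
        ⟨2 * s, k, P, O, I⟩
  | hh {k : ℕ} (s : ℝ) (Q : BoolPoly k) (R : PhasePoly (k + 1))
      (O : Fin m → BoolPoly (k + 1)) (I : Fin n → BoolPoly (k + 1)) :
      SOP.Rewrite
        ⟨s, k + 2,
          PhasePoly.mk (C (1 / 2) * X 0 * (X 1 + hat (Q.rename fun j => j.succ.succ))) +
            R.rename Fin.succ,
          fun i => (O i).rename Fin.succ, fun i => (I i).rename Fin.succ⟩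
        ⟨2 * s, k, R.subst (Fin.cons Q X), fun i => (O i).subst (Fin.cons Q X),
          fun i => (I i).subst (Fin.cons Q X)⟩
  | omega {k : ℕ} (s : ℝ) (Q : BoolPoly k) (R : PhasePoly k)
      (O : Fin m → BoolPoly k) (I : Fin n → BoolPoly k) :
      SOP.Rewrite
        ⟨s, k + 1,
          PhasePoly.mk (C (1 / 4) * X 0 + C (1 / 2) * X 0 * hat (Q.rename Fin.succ)) +
            R.rename Fin.succ,
          fun i => (O i).rename Fin.succ, fun i => (I i).rename Fin.succ⟩
        ⟨√2 * s, k, PhasePoly.mk (C (1 / 8) - C (1 / 4) * hat Q) + R, O, I⟩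
  | ket {k : ℕ} (s : ℝ) (P : PhasePoly k) (O : Fin m → BoolPoly k) (I : Fin n → BoolPoly k)
      (i : Fin m) (y₀ : Fin k) (O' : BoolPoly k) (hi : O i = X y₀ + O')
      (hlt : ∀ j, j < i → y₀ ∉ (O j).vars) (hO' : y₀ ∉ O'.vars) (hne : O' ≠ 0) :
      SOP.Rewrite ⟨s, k, P, O, I⟩
        ⟨s, k, P.subst (Function.update X y₀ (O i)),
          fun j => (O j).subst (Function.update X y₀ (O i)),
          fun j => (I j).subst (Function.update X y₀ (O i))⟩
  | bra {k : ℕ} (s : ℝ) (P : PhasePoly k) (O : Fin m → BoolPoly k) (I : Fin n → BoolPoly k)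
      (i : Fin n) (y₀ : Fin k) (I' : BoolPoly k) (hi : I i = X y₀ + I')
      (hO : ∀ j, y₀ ∉ (O j).vars) (hlt : ∀ j, j < i → y₀ ∉ (I j).vars)
      (hI' : y₀ ∉ I'.vars) (hne : I' ≠ 0) :
      SOP.Rewrite ⟨s, k, P, O, I⟩
        ⟨s, k, P.subst (Function.update X y₀ (I i)),
          fun j => (O j).subst (Function.update X y₀ (I i)),
          fun j => (I j).subst (Function.update X y₀ (I i))⟩
  | z {k : ℕ} (s : ℝ) (R : PhasePoly k) (O : Fin m → BoolPoly k) (I : Fin n → BoolPoly k)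
      (hne : R ≠ 0 ∨ O ≠ 0 ∨ I ≠ 0) :
      SOP.Rewrite
        ⟨s, k + 1, PhasePoly.mk (C (1 / 2) * X 0) + R.rename Fin.succ,
          fun i => (O i).rename Fin.succ, fun i => (I i).rename Fin.succ⟩
        ⟨1, 1, PhasePoly.mk (C (1 / 2) * X 0), 0, 0⟩

/-- The equivalence relation `∼_{Clif+}` on the morphisms `n → m` of `SOP`: the one generated by
the unoriented rules, up to `α`-conversion. -/
def SOP.clifPlus (n m : ℕ) : Setoid (SOP n m) :=
  Relation.EqvGen.setoid fun f g => SOP.Alpha f g ∨ SOP.Rewrite f g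

/-! ### The Clifford fragment -/

open MvPolynomial in
/-- The phase `P⁽⁰⁾ / 8 + P⁽¹⁾ / 4 + P⁽²⁾ / 2`. -/
def clifPhase {k : ℕ} (P₀ : ℤ) (P₁ P₂ : MvPolynomial (Fin k) ℤ) : MvPolynomial (Fin k) ℝ :=
  C (1 / 8) * C (P₀ : ℝ) + C (1 / 4) * map (Int.castRingHom ℝ) P₁ +
    C (1 / 2) * map (Int.castRingHom ℝ) P₂

/-- Membership in `SOP_Clif`: the scalar is `1 / √2 ^ p`, the phase is
`P⁽⁰⁾ / 8 + P⁽¹⁾ / 4 + P⁽²⁾ / 2` with `P⁽ⁱ⁾` an integer polynomial of degree at most `i`, and the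
ket and bra polynomials have degree at most one (a constant term is allowed). -/
def SOP.IsClif {n m : ℕ} (f : SOP n m) : Prop :=
  (∃ p : ℤ, f.scalar = (1 / √2) ^ p) ∧
  (∃ (P₀ : ℤ) (P₁ P₂ : MvPolynomial (Fin f.numVars) ℤ),
    P₁.totalDegree ≤ 1 ∧ P₂.totalDegree ≤ 2 ∧ f.phase = PhasePoly.mk (clifPhase P₀ P₁ P₂)) ∧
  (∀ i, (f.ket i).totalDegree ≤ 1) ∧ (∀ i, (f.bra i).totalDegree ≤ 1)

/-- The morphisms `n → m` of `SOP_Clif`. -/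
def SOPClif (n m : ℕ) : Type := {f : SOP n m // f.IsClif}

/-- The morphisms `n → m` of `SOP_Clif / ∼_{Clif+}`. -/
def SOPClifQuot (n m : ℕ) : Type :=
  Quotient ((SOP.clifPlus n m).comap (Subtype.val : SOPClif n m → SOP n m))

/-- The class of a morphism of `SOP_Clif`. -/
def SOPClif.toQuot {n m : ℕ} (f : SOPClif n m) : SOPClifQuot n m := Quotient.mk _ f

/-! ### Clifford morphisms as finite data -/

/-- The factor of a monomial: a variable, or `1` for `none`. -/
def factor {k : ℕ} (R : Type) [CommSemiring R] : Option (Fin k) → MvPolynomial (Fin k) R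
  | none => 1
  | some i => MvPolynomial.X i

/-- A written expression for a morphism `n → m` of `SOP_Clif`; all polynomials are given as lists
of monomials (repetitions allowed), and the polynomial is their sum. -/
structure ClifExpr (n m : ℕ) where
  /-- the exponent `p` of the scalar `1 / √2 ^ p` -/
  p : ℤ
  /-- the number `k` of summation variables -/
  numVars : ℕ
  /-- the integer `P⁽⁰⁾` -/
  P₀ : ℤ
  /-- `P⁽¹⁾`: an item `(c, a)` is the monomial `c a` -/
  P₁ : List (ℤ × Option (Fin numVars))
  /-- `P⁽²⁾`: an item `(c, a, b)` is the monomial `c a b` -/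
  P₂ : List (ℤ × Option (Fin numVars) × Option (Fin numVars))
  /-- the ket polynomials -/
  ket : Fin m → List (Option (Fin numVars))
  /-- the bra polynomials -/
  bra : Fin n → List (Option (Fin numVars))

namespace ClifExpr

variable {n m : ℕ}

/-- The integer polynomial `P⁽¹⁾`. -/
def poly₁ (t : ClifExpr n m) : MvPolynomial (Fin t.numVars) ℤ :=
  (t.P₁.map fun x => MvPolynomial.C x.1 * factor ℤ x.2).sum

/-- The integer polynomial `P⁽²⁾`. -/
def poly₂ (t : ClifExpr n m) : MvPolynomial (Fin t.numVars) ℤ :=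
  (t.P₂.map fun x => MvPolynomial.C x.1 * (factor ℤ x.2.1 * factor ℤ x.2.2)).sum

/-- The Boolean polynomial that a list of variables and ones stands for. -/
def linear {k : ℕ} (l : List (Option (Fin k))) : BoolPoly k := (l.map (factor (ZMod 2))).sum

/-- The morphism of `SOP` that an expression denotes. -/
def toSOP (t : ClifExpr n m) : SOP n m where
  scalar := (1 / √2) ^ t.p
  numVars := t.numVars
  phase := PhasePoly.mk (clifPhase t.P₀ t.poly₁ t.poly₂)
  ket i := linear (t.ket i)
  bra i := linear (t.bra i)

theorem totalDegree_list_sum_le {k : ℕ} {R ι : Type} [CommSemiring R] (d : ℕ) (l : List ι)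
    (f : ι → MvPolynomial (Fin k) R) (h : ∀ x, (f x).totalDegree ≤ d) :
    (l.map f).sum.totalDegree ≤ d := by
  induction l with
  | nil => simp
  | cons x l ih =>
    rw [List.map_cons, List.sum_cons]
    exact (MvPolynomial.totalDegree_add _ _).trans (max_le (h x) ih)

theorem totalDegree_factor_le {k : ℕ} {R : Type} [CommSemiring R] [Nontrivial R]
    (a : Option (Fin k)) : (factor R a).totalDegree ≤ 1 := by
  cases a <;> simp [factor]

theorem totalDegree_C_mul_le {k : ℕ} {R : Type} [CommSemiring R] (c : R)
    (P : MvPolynomial (Fin k) R) : (MvPolynomial.C c * P).totalDegree ≤ P.totalDegree := by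
  simpa using MvPolynomial.totalDegree_mul (MvPolynomial.C c) P

theorem isClif_toSOP (t : ClifExpr n m) : t.toSOP.IsClif := by
  refine ⟨⟨t.p, rfl⟩, ⟨t.P₀, t.poly₁, t.poly₂, ?_, ?_, rfl⟩, fun i => ?_, fun i => ?_⟩
  · exact totalDegree_list_sum_le _ _ _ fun x =>
      (totalDegree_C_mul_le _ _).trans (totalDegree_factor_le _)
  · exact totalDegree_list_sum_le _ _ _ fun x =>
      (totalDegree_C_mul_le _ _).trans ((MvPolynomial.totalDegree_mul _ _).trans
        (Nat.add_le_add (totalDegree_factor_le _) (totalDegree_factor_le _)))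
  · exact totalDegree_list_sum_le _ _ _ totalDegree_factor_le
  · exact totalDegree_list_sum_le _ _ _ totalDegree_factor_le

/-- A monomial of degree at most one is a constant or a variable. -/
theorem exists_factor_one {k : ℕ} (R : Type) [CommSemiring R] (d : Fin k →₀ ℕ)
    (hd : d.degree ≤ 1) : ∃ a, factor R a = MvPolynomial.monomial d 1 := by
  by_cases h0 : d = 0
  · exact ⟨none, by subst h0; rfl⟩
  · obtain ⟨i, hi⟩ := Finsupp.ne_iff.1 h0
    have hle : Finsupp.single i 1 ≤ d := Finsupp.single_le_iff.2 (Nat.one_le_iff_ne_zero.2 hi)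
    have hs : Finsupp.single i 1 + (d - Finsupp.single i 1) = d := add_tsub_cancel_of_le hle
    have hdeg : (d - Finsupp.single i 1).degree = 0 := by
      have := congrArg Finsupp.degree hs
      rw [map_add, Finsupp.degree_single] at this
      omega
    rw [(Finsupp.degree_eq_zero_iff _).1 hdeg, add_zero] at hs
    exact ⟨some i, by rw [← hs]; rfl⟩

theorem exists_factor_two {k : ℕ} (R : Type) [CommSemiring R] (d : Fin k →₀ ℕ)
    (hd : d.degree ≤ 2) : ∃ a b, factor R a * factor R b = MvPolynomial.monomial d 1 := by
  by_cases h0 : d = 0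
  · exact ⟨none, none, by subst h0; simp [factor]⟩
  · obtain ⟨i, hi⟩ := Finsupp.ne_iff.1 h0
    have hle : Finsupp.single i 1 ≤ d := Finsupp.single_le_iff.2 (Nat.one_le_iff_ne_zero.2 hi)
    have hs : Finsupp.single i 1 + (d - Finsupp.single i 1) = d := add_tsub_cancel_of_le hle
    have hdeg : (d - Finsupp.single i 1).degree ≤ 1 := by
      have := congrArg Finsupp.degree hs
      rw [map_add, Finsupp.degree_single] at this
      omega
    obtain ⟨b, hb⟩ := exists_factor_one R _ hdeg
    refine ⟨some i, b, ?_⟩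
    rw [hb, ← hs]
    simp [factor, MvPolynomial.X, MvPolynomial.monomial_mul]

theorem exists_list_sum {k : ℕ} {R ι : Type} [CommSemiring R] (f : R → ι → MvPolynomial (Fin k) R)
    (e : ℕ) (hf : ∀ (d : Fin k →₀ ℕ) (c : R), d.degree ≤ e → ∃ x, f c x = MvPolynomial.monomial d c)
    (P : MvPolynomial (Fin k) R) (hP : P.totalDegree ≤ e) :
    ∃ l : List (R × ι), (l.map fun x => f x.1 x.2).sum = P ∧ ∀ x ∈ l, x.1 ≠ 0 := by
  have key : ∀ s : Finset (Fin k →₀ ℕ), s ⊆ P.support → ∃ l : List (R × ι),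
      (l.map fun x => f x.1 x.2).sum = ∑ d ∈ s, MvPolynomial.monomial d (P.coeff d) ∧
        ∀ x ∈ l, x.1 ≠ 0 := by
    intro s
    induction s using Finset.induction_on with
    | empty => exact fun _ => ⟨[], by simp⟩
    | insert d s hd ih =>
      intro hs
      obtain ⟨l, hl, hl'⟩ := ih ((Finset.subset_insert _ _).trans hs)
      have hdP := hs (Finset.mem_insert_self d s)
      obtain ⟨x, hx⟩ := hf d (P.coeff d) ((MvPolynomial.le_totalDegree hdP).trans hP)
      refine ⟨(P.coeff d, x) :: l, ?_, ?_⟩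
      · rw [List.map_cons, List.sum_cons, hl, hx, Finset.sum_insert hd]
      · simpa using ⟨by simpa using hdP, fun a b h => hl' (a, b) h⟩
  obtain ⟨l, hl, hl'⟩ := key _ subset_rfl
  exact ⟨l, by rw [hl, MvPolynomial.support_sum_monomial_coeff], hl'⟩

/-- Every morphism of `SOP_Clif` is denoted by an expression. -/
theorem exists_toSOP_eq (f : SOP n m) (hf : f.IsClif) :
    ∃ t : ClifExpr n m, t.toSOP = f := by
  obtain ⟨s, k, P, O, I⟩ := f
  obtain ⟨⟨p, rfl⟩, ⟨P₀, P₁, P₂, h₁, h₂, hP⟩, hO, hI⟩ := hf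
  dsimp only at P₁ P₂ h₁ h₂ hP hO hI
  subst hP
  have hlin : ∀ Q : BoolPoly k, Q.totalDegree ≤ 1 → ∃ l, linear l = Q := by
    intro Q hQ
    obtain ⟨l, hl, hne⟩ := exists_list_sum (fun c a => MvPolynomial.C c * factor (ZMod 2) a) 1
      (fun d c hd => by
        obtain ⟨a, ha⟩ := exists_factor_one (ZMod 2) d hd
        exact ⟨a, by rw [ha, MvPolynomial.C_mul_monomial, mul_one]⟩) Q hQ
    refine ⟨l.map Prod.snd, ?_⟩
    rw [← hl, linear, List.map_map]
    refine congrArg List.sum (List.map_congr_left fun x hx => ?_)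
    have h1 : ∀ c : ZMod 2, c ≠ 0 → c = 1 := by decide
    simp [h1 x.1 (hne x hx)]
  obtain ⟨l₁, hl₁, -⟩ := exists_list_sum (fun c a => MvPolynomial.C c * factor ℤ a) 1
      (fun d c hd => by
        obtain ⟨a, ha⟩ := exists_factor_one ℤ d hd
        exact ⟨a, by rw [ha, MvPolynomial.C_mul_monomial, mul_one]⟩) P₁ h₁
  obtain ⟨l₂, hl₂, -⟩ := exists_list_sum
      (fun c (a : Option (Fin k) × Option (Fin k)) =>
        MvPolynomial.C c * (factor ℤ a.1 * factor ℤ a.2)) 2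
      (fun d c hd => by
        obtain ⟨a, b, ha⟩ := exists_factor_two ℤ d hd
        exact ⟨(a, b), by rw [ha, MvPolynomial.C_mul_monomial, mul_one]⟩) P₂ h₂
  choose kt hkt using fun i => hlin (O i) (hO i)
  choose br hbr using fun i => hlin (I i) (hI i)
  refine ⟨⟨p, k, P₀, l₁, l₂, kt, br⟩, ?_⟩
  simp only [toSOP, poly₁, poly₂, hl₁, hl₂, hkt, hbr]

/-- The morphism of `SOP_Clif` that an expression denotes. -/
def toSOPClif (t : ClifExpr n m) : SOPClif n m := ⟨t.toSOP, t.isClif_toSOP⟩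

/-- The size of the phase polynomial: the number of monomials with which it is written (the
integer `P⁽⁰⁾` counts as one). The bit lengths of the coefficients and of the names of the variables
are not counted, which only makes a bound in terms of the size stronger. -/
def phaseSize (t : ClifExpr n m) : ℕ := 1 + t.P₁.length + t.P₂.length

/-- The combined size of the ket and bra polynomials: their numbers of monomials, plus one for
each polynomial. -/
def ketBraSize (t : ClifExpr n m) : ℕ :=
  ∑ i, (1 + (t.ket i).length) + ∑ i, (1 + (t.bra i).length)

/-- A variable is given by its index plus one, the constant `1` by `0`. -/
def factorCode {k : ℕ} : Option (Fin k) → ℤ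
  | none => 0
  | some i => (i : ℤ) + 1

/-- A ket or bra polynomial as a list of integers: its length, then its monomials. -/
def linearCode {k : ℕ} (l : List (Option (Fin k))) : List ℤ := (l.length : ℤ) :: l.map factorCode

/-- An expression as a list of integers. -/
def code (t : ClifExpr n m) : List ℤ :=
  [t.p, (t.numVars : ℤ), t.P₀] ++
  (t.P₁.length : ℤ) :: t.P₁.flatMap (fun x => [x.1, factorCode x.2]) ++
  (t.P₂.length : ℤ) :: t.P₂.flatMap (fun x => [x.1, factorCode x.2.1, factorCode x.2.2]) ++
  (List.ofFn fun i => linearCode (t.ket i)).flatten ++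
  (List.ofFn fun i => linearCode (t.bra i)).flatten

end ClifExpr

/-- An instance of the equality problem: two parallel morphisms of `SOP_Clif`. -/
structure ClifPair where
  /-- the source -/
  n : ℕ
  /-- the target -/
  m : ℕ
  /-- the left morphism -/
  left : ClifExpr n m
  /-- the right morphism -/
  right : ClifExpr n m

namespace ClifPair

/-- The two morphisms are equal in `SOP_Clif / ∼_{Clif+}`. -/
def Equal (x : ClifPair) : Prop := x.left.toSOPClif.toQuot = x.right.toSOPClif.toQuot

/-- The size of the phase polynomials and of the ket and bra polynomials. -/
def size (x : ClifPair) : ℕ :=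
  (x.left.phaseSize + x.right.phaseSize) + (x.left.ketBraSize + x.right.ketBraSize)

/-- An instance as a list of integers. -/
def code (x : ClifPair) : List ℤ := [(x.n : ℤ), (x.m : ℤ)] ++ x.left.code ++ x.right.code

end ClifPair

end

/-! ### Random access machines

Programs for a random access machine with integer registers and integer arrays. The arithmetic
operations are addition, subtraction and halving (rounded down); there is no multiplication, so a
computation of `T` steps lengthens the binary expansions of the numbers at hand by at most `T`
digits, and time at unit cost is polynomially related to time on a Turing machine. -/

namespace RAM

/-- The memory: register `r` holds `reg r`, and cell `i` of array `a` holds `arr a i`. -/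
structure State where
  /-- the registers -/
  reg : ℕ → ℤ
  /-- the arrays -/
  arr : ℕ → ℤ → ℤ

/-- Arithmetic expressions. -/
inductive Expr
  | const (z : ℤ)
  | reg (r : ℕ)
  | get (a : ℕ) (i : Expr)
  | add (e₁ e₂ : Expr)
  | sub (e₁ e₂ : Expr)
  | half (e : Expr)

/-- The value of an expression. -/
def Expr.eval (σ : State) : Expr → ℤ
  | const z => z
  | reg r => σ.reg r
  | get a i => σ.arr a (i.eval σ)
  | add e₁ e₂ => e₁.eval σ + e₂.eval σ
  | sub e₁ e₂ => e₁.eval σ - e₂.eval σ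
  | half e => e.eval σ / 2

/-- The number of steps for evaluating an expression: one for each operation. -/
def Expr.cost : Expr → ℕ
  | const _ => 1
  | reg _ => 1
  | get _ i => i.cost + 1
  | add e₁ e₂ => e₁.cost + e₂.cost + 1
  | sub e₁ e₂ => e₁.cost + e₂.cost + 1
  | half e => e.cost + 1

/-- Programs: assignment of a register, assignment of an array cell, sequencing, and branching and
looping on the condition that the value of an expression is positive. -/
inductive Prog
  | skip
  | assign (r : ℕ) (e : Expr)
  | store (a : ℕ) (i e : Expr)
  | seq (p q : Prog)
  | ite (e : Expr) (p q : Prog)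
  | loop (e : Expr) (p : Prog)

/-- `Runs p σ T τ`: the program `p`, started in `σ`, halts in `τ` after `T` steps. -/
inductive Runs : Prog → State → ℕ → State → Prop
  | skip (σ : State) : Runs Prog.skip σ 1 σ
  | assign (r : ℕ) (e : Expr) (σ : State) :
      Runs (Prog.assign r e) σ (e.cost + 1) ⟨Function.update σ.reg r (e.eval σ), σ.arr⟩
  | store (a : ℕ) (i e : Expr) (σ : State) :
      Runs (Prog.store a i e) σ (i.cost + e.cost + 1)
        ⟨σ.reg, Function.update σ.arr a (Function.update (σ.arr a) (i.eval σ) (e.eval σ))⟩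
  | seq {p q : Prog} {σ τ υ : State} {S T : ℕ} (hp : Runs p σ S τ) (hq : Runs q τ T υ) :
      Runs (Prog.seq p q) σ (S + T) υ
  | ite_pos {e : Expr} {p q : Prog} {σ τ : State} {T : ℕ} (he : 0 < e.eval σ)
      (hp : Runs p σ T τ) : Runs (Prog.ite e p q) σ (e.cost + 1 + T) τ
  | ite_neg {e : Expr} {p q : Prog} {σ τ : State} {T : ℕ} (he : ¬ 0 < e.eval σ)
      (hq : Runs q σ T τ) : Runs (Prog.ite e p q) σ (e.cost + 1 + T) τ
  | loop_stop {e : Expr} {p : Prog} {σ : State} (he : ¬ 0 < e.eval σ) :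
      Runs (Prog.loop e p) σ (e.cost + 1) σ
  | loop_step {e : Expr} {p : Prog} {σ τ υ : State} {S T : ℕ} (he : 0 < e.eval σ)
      (hp : Runs p σ S τ) (hl : Runs (Prog.loop e p) τ T υ) :
      Runs (Prog.loop e p) σ (e.cost + 1 + S + T) υ

/-- The initial memory for an input: the input is in array `0`, its length in register `0`, and
everything else is `0`. -/
def init (w : List ℤ) : State where
  reg := fun r => if r = 0 then (w.length : ℤ) else 0
  arr := fun a i => if a = 0 ∧ 0 ≤ i then w.getD i.toNat 0 else 0

/-- One program decides, for every instance `x` given as the list of integers `code x`, whether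
`L x` holds, within a number of steps that is polynomial in `size x`; it answers `1` or `0` in
register `0`. -/
def DecidableInPolyTime {α : Type} (code : α → List ℤ) (size : α → ℕ) (L : α → Prop) : Prop :=
  ∃ (p : Prog) (q : Polynomial ℕ), ∀ x : α, ∃ (T : ℕ) (τ : State),
    Runs p (init (code x)) T τ ∧ T ≤ q.eval (size x) ∧
      (L x → τ.reg 0 = 1) ∧ (¬ L x → τ.reg 0 = 0)

end RAM

/-! The equivalence generated by the rules coincides, on Clifford morphisms, with equality of
matrices, and equality of matrices is decided by three inner products, each of them an exponential
sum of a quadratic form that elimination evaluates in polynomial time.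

A morphism denotes a matrix: every path, that is every assignment of bits, contributes a phase to
one entry (`SOP.interp`). Each rule preserves the matrix (`SOP.Rewrite.interp_eq`). For the
converse, two applications of (HH) to the same expression show that a variable may be shifted by a
polynomial in the others (`SOPBody.sim_shift`), and transvections and translations generate all
affine changes of variables over the field with two elements (`SOPBody.sim_linear`,
`SOPBody.sim_translate`). If two paths reach the same entry, then a direction exists along which no
ket or bra polynomial varies; an affine change turns it into a variable that occurs in the phase
only, and one of (Elim), (HH), (ω), (Z) removes it (`SOPBody.exists_sim_of_internal`). Hence every
Clifford morphism with positive scalar is equivalent to the vanishing one or to one whose paths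
reach distinct entries (`SOPBody.exists_sim_faithful`). Two morphisms of the latter kind with the
same matrix differ by an affine change of variables (`SOPBody.sim_of_faithful`). Together this gives
`ClifPair.equal_iff`.

Two vectors f and g agree exactly if ⟨f,f⟩ = ⟨f,g⟩ = ⟨g,g⟩, because then the squared norm of f - g
is zero (`eq_of_inner_eq`). An inner product is a sum over pairs of paths that reach the same entry.
Writing this condition as a sum of signs over one multiplier bit for each ket or bra polynomial
turns it into a power of `√2`, times an eighth root of unity, times the average of i^q for an
integral quadratic form q in bits (`ClifExpr.inner_eq_gauss`). The variables of q are averaged out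
one at a time: an odd diagonal entry gives a one-variable Gauss sum (`gauss_odd`), an even one
imposes a parity condition, which is solved for another variable (`gauss_pivot`) or is constant
(`gauss_free`). Each step multiplies by a simple scalar and changes the matrix of q by a rank-two
symmetric update at most, so the process is cubic elimination. It uses only additions, because the
multipliers in the update are bits or signs.

For the machine, a weakest-precondition calculus in which no loop runs more than N rounds yields
total correctness and, at once, a polynomial bound in N (`Prog.wp_sound`,
`Prog.exists_polynomial_time`). Variables receive indices only when they are first met, so that the
matrix has a side linear in the length of the input, however many summation variables are declared.
-/

noncomputable section

open MvPolynomial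

/-! ### Values of phase polynomials -/

/-- The real number `0` or `1` that a bit stands for. -/
def bit (a : ZMod 2) : ℝ := (a.val : ℝ)

theorem bit_zero : bit 0 = 0 := by simp [bit]

theorem bit_one : bit 1 = 1 := by simp [bit, ZMod.val_one]

theorem zmod_two_cases (a : ZMod 2) : a = 0 ∨ a = 1 := by revert a; decide

theorem bit_sq (a : ZMod 2) : bit a ^ 2 = bit a := by
  rcases zmod_two_cases a with rfl | rfl <;> simp [bit_zero, bit_one]

theorem bit_mul (a b : ZMod 2) : bit (a * b) = bit a * bit b := by
  rcases zmod_two_cases a with rfl | rfl <;> simp [bit_zero, bit_one]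

theorem bit_add (a b : ZMod 2) : bit (a + b) = bit a + bit b - 2 * (bit a * bit b) := by
  have h : (1 : ZMod 2) + 1 = 0 := by decide
  rcases zmod_two_cases a with rfl | rfl <;> rcases zmod_two_cases b with rfl | rfl <;>
    simp [bit_zero, bit_one, h]
  norm_num

theorem bit_prod {ι : Type*} (s : Finset ι) (f : ι → ZMod 2) :
    bit (∏ i ∈ s, f i) = ∏ i ∈ s, bit (f i) := by
  classical
  induction s using Finset.induction_on with
  | empty => simp [bit_one]
  | insert a s ha ih => rw [Finset.prod_insert ha, Finset.prod_insert ha, bit_mul, ih]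

theorem bit_pow (a : ZMod 2) (n : ℕ) : bit (a ^ n) = bit a ^ n := by
  simpa using bit_prod (Finset.range n) fun _ => a

theorem eval_squareIdeal {k : ℕ} (y : Fin k → ZMod 2) {P : MvPolynomial (Fin k) ℝ}
    (hP : P ∈ squareIdeal k) : eval (fun i => bit (y i)) P = 0 := by
  have hle : squareIdeal k ≤ RingHom.ker (eval fun i => bit (y i)) := by
    refine Ideal.span_le.2 ?_
    rintro _ ⟨i, rfl⟩
    simp [RingHom.mem_ker, bit_sq]
  exact hle hP

theorem eval_phaseZero {k : ℕ} (y : Fin k → ZMod 2) {P : MvPolynomial (Fin k) ℝ}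
    (hP : P ∈ phaseZero k) : ((eval (fun i => bit (y i)) P : ℝ) : UnitAddCircle) = 0 := by
  obtain ⟨a, ha, b, ⟨c, rfl⟩, rfl⟩ := AddSubgroup.mem_sup.1 hP
  have hy : (fun i => bit (y i)) = fun i => Int.castRingHom ℝ ((y i).val : ℤ) := by
    funext i; simp [bit]
  have hb : eval (fun i => bit (y i)) (MvPolynomial.map (Int.castRingHom ℝ) c) =
      ((eval (fun i => ((y i).val : ℤ)) c : ℤ) : ℝ) := by
    change _ = Int.castRingHom ℝ (eval₂ (RingHom.id ℤ) _ c)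
    rw [eval₂_comp_left, hy, eval_map]
    rfl
  rw [map_add, eval_squareIdeal y ha, zero_add]
  erw [hb]
  rw [AddCircle.coe_eq_zero_iff]
  exact ⟨eval (fun i => ((y i).val : ℤ)) c, by rw [zsmul_one]⟩

/-- The value of a phase polynomial at an assignment of bits to the variables. -/
def PhasePoly.value {k : ℕ} (y : Fin k → ZMod 2) : PhasePoly k →+ UnitAddCircle :=
  QuotientAddGroup.lift (phaseZero k)
    ((QuotientAddGroup.mk' (AddSubgroup.zmultiples (1 : ℝ))).comp
      (eval (R := ℝ) fun i => bit (y i)).toAddMonoidHom)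
    (fun _ hP => eval_phaseZero y hP)

theorem PhasePoly.value_mk {k : ℕ} (y : Fin k → ZMod 2) (P : MvPolynomial (Fin k) ℝ) :
    (PhasePoly.mk P).value y = ((eval (fun i => bit (y i)) P : ℝ) : UnitAddCircle) := rfl

/-- On the reals 0 and 1 the operation `hatAdd` is exclusive or, and every monomial in the support
of a Boolean polynomial has coefficient 1. -/
theorem eval_hat {k : ℕ} (y : Fin k → ZMod 2) (Q : BoolPoly k) :
    eval (fun i => bit (y i)) (hat Q) = bit (eval y Q) := by
  have hQ : eval y Q = ∑ d ∈ Q.support, eval y (monomial d (1 : ZMod 2)) := by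
    conv_lhs => rw [← MvPolynomial.support_sum_monomial_coeff Q]
    rw [map_sum]
    refine Finset.sum_congr rfl fun d hd => ?_
    have h1 : ∀ c : ZMod 2, c ≠ 0 → c = 1 := by decide
    rw [h1 _ (MvPolynomial.mem_support_iff.1 hd)]
  rw [hQ]
  unfold hat hatInt
  induction Q.support using Finset.induction_on with
  | empty => simp [bit_zero]
  | insert d s hd ih =>
    rw [Finset.fold_insert hd, Finset.sum_insert hd, bit_add, ← ih]
    have hm : eval (fun i => bit (y i)) (monomial d (1 : ℝ)) =
        bit (eval y (monomial d (1 : ZMod 2))) := by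
      rw [eval_monomial, eval_monomial, one_mul, one_mul, Finsupp.prod, Finsupp.prod, bit_prod]
      exact Finset.prod_congr rfl fun i _ => (bit_pow _ _).symm
    simp only [hatAdd, map_sub, map_add, map_mul, MvPolynomial.map_monomial, map_one, map_ofNat, hm]

theorem PhasePoly.value_subst {k l : ℕ} (σ : Fin k → BoolPoly l) (P : PhasePoly k)
    (y : Fin l → ZMod 2) : (P.subst σ).value y = P.value fun i => eval y (σ i) := by
  obtain ⟨P, rfl⟩ := QuotientAddGroup.mk_surjective P
  change ((eval (fun i => bit (y i)) (aeval (fun i => hat (σ i)) P) : ℝ) : UnitAddCircle) =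
    ((eval (fun i => bit (eval y (σ i))) P : ℝ) : UnitAddCircle)
  congr 1
  simp only [← eval_hat]
  rw [aeval_def, eval₂_eq_eval_map]
  induction P using MvPolynomial.induction_on with
  | C z => simp
  | add p q hp hq => simp only [map_add, hp, hq]
  | mul_X p i hp => simp only [map_mul, hp]; simp

theorem PhasePoly.value_rename {k l : ℕ} (f : Fin k → Fin l) (P : PhasePoly k)
    (y : Fin l → ZMod 2) : (P.rename f).value y = P.value (y ∘ f) := by
  rw [PhasePoly.rename, PhasePoly.value_subst]
  simp only [eval_X]
  rfl

theorem BoolPoly.eval_subst {k l : ℕ} (σ : Fin k → BoolPoly l) (Q : BoolPoly k)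
    (y : Fin l → ZMod 2) : eval y (Q.subst σ) = eval (fun i => eval y (σ i)) Q := by
  rw [BoolPoly.subst]
  induction Q using MvPolynomial.induction_on with
  | C z => simp
  | add p q hp hq => simp only [map_add, hp, hq]
  | mul_X p i hp => simp only [map_mul, hp, bind₁_X_right, eval_X]

theorem BoolPoly.eval_rename {k l : ℕ} (f : Fin k → Fin l) (Q : BoolPoly k)
    (y : Fin l → ZMod 2) : eval y (Q.rename f) = eval (y ∘ f) Q := by
  rw [BoolPoly.rename, MvPolynomial.eval_rename]

/-- The polynomial that is `1` at the vertex `b` of the cube and `0` at the other vertices. -/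
def vertexPoly {k : ℕ} (R : Type) [CommRing R] (b : Fin k → Bool) : MvPolynomial (Fin k) R :=
  ∏ i, if b i then X i else 1 - X i

/-- Lagrange interpolation on the cube: expanding the product of the `X i + (1 - X i)` shows that
the vertex polynomials sum to 1, and modulo the ideal multiplication by `X i` acts on each of them
as the `i`-th coordinate of its vertex. -/
theorem sub_interpolation_mem {k : ℕ} (P : MvPolynomial (Fin k) ℝ) :
    P - ∑ b : Fin k → Bool, C (eval (fun i => if b i then 1 else 0) P) * vertexPoly ℝ b ∈
      squareIdeal k := by
  rw [← Ideal.Quotient.eq]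
  induction P using MvPolynomial.induction_on with
  | C z =>
    have h1 : ∑ b : Fin k → Bool, vertexPoly ℝ b = 1 := by
      have := Finset.prod_univ_sum (fun _ : Fin k => (Finset.univ : Finset Bool))
        (fun i c => if c then (X i : MvPolynomial (Fin k) ℝ) else 1 - X i)
      simp only [Fintype.piFinset_univ] at this
      rw [← show _ = ∑ b : Fin k → Bool, vertexPoly ℝ b from this]
      simp
    simp only [eval_C]
    rw [← Finset.mul_sum, h1, mul_one]
  | add p q hp hq =>
    simp only [map_add, add_mul, Finset.sum_add_distrib] at hp hq ⊢
    rw [hp, hq]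
  | mul_X p i hp =>
    rw [map_mul, hp, map_sum, map_sum, Finset.sum_mul]
    refine Finset.sum_congr rfl fun b _ => ?_
    rw [← map_mul, Ideal.Quotient.eq]
    have hv : vertexPoly ℝ b * X i - (if b i then 1 else 0) * vertexPoly ℝ b ∈ squareIdeal k := by
      rw [vertexPoly, ← Finset.mul_prod_erase _ _ (Finset.mem_univ i)]
      have hX := X_sq_sub_mem i
      cases h : b i
      · have := Ideal.mul_mem_left _
          (-∏ x ∈ Finset.univ.erase i, if b x then (X x : MvPolynomial (Fin k) ℝ) else 1 - X x) hX
        convert this using 1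
        simp
        ring
      · have := Ideal.mul_mem_left _
          (∏ x ∈ Finset.univ.erase i, if b x then (X x : MvPolynomial (Fin k) ℝ) else 1 - X x) hX
        convert this using 1
        simp
        ring
    have := Ideal.mul_mem_left _ (C (eval (fun i => if b i then 1 else 0) p)) hv
    convert this using 1
    rw [map_mul, map_mul, eval_X]
    cases b i <;> simp <;> ring

/-- If all values are integers, then the interpolating combination of vertex polynomials has integer
coefficients. Phase polynomials can thus be compared by their values, which is how all identities
between phases are checked below. -/
theorem PhasePoly.eq_zero_of_value {k : ℕ} (P : PhasePoly k) (h : ∀ y, P.value y = 0) : P = 0 := by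
  obtain ⟨P, rfl⟩ := QuotientAddGroup.mk_surjective P
  rw [QuotientAddGroup.eq_zero_iff]
  rw [← sub_add_cancel P (∑ b : Fin k → Bool,
    C (eval (fun i => if b i then 1 else 0) P) * vertexPoly ℝ b)]
  refine add_mem (AddSubgroup.mem_sup_left (sub_interpolation_mem P))
    (AddSubgroup.mem_sup_right (sum_mem fun b _ => ?_))
  have hb := h fun i => if b i then 1 else 0
  change ((eval (fun i => bit (if b i then 1 else 0)) P : ℝ) : UnitAddCircle) = 0 at hb
  have hbit : (fun i => bit (if b i then 1 else 0)) = fun i => if b i then (1 : ℝ) else 0 := by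
    funext i; cases b i <;> simp [bit_zero, bit_one]
  rw [hbit, AddCircle.coe_eq_zero_iff] at hb
  obtain ⟨z, hz⟩ := hb
  refine ⟨C z * vertexPoly ℤ b, ?_⟩
  have hC : MvPolynomial.map (Int.castRingHom ℝ) (vertexPoly ℤ b) = vertexPoly ℝ b := by
    rw [vertexPoly, vertexPoly, map_prod]
    refine Finset.prod_congr rfl fun i _ => ?_
    cases b i <;> simp
  rw [map_mul, map_C, hC, ← hz]
  simp

theorem PhasePoly.ext_value {k : ℕ} {P P' : PhasePoly k} (h : ∀ y, P.value y = P'.value y) :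
    P = P' :=
  sub_eq_zero.1 (PhasePoly.eq_zero_of_value _ fun y => by rw [map_sub, h, sub_self])

/-! ### Interpretation of sums over paths as matrices -/

/-- The complex number `e^{2 i π x}`. -/
def phaseExp (x : UnitAddCircle) : ℂ := (AddCircle.toCircle x : ℂ)

theorem phaseExp_add (x y : UnitAddCircle) : phaseExp (x + y) = phaseExp x * phaseExp y := by
  simp [phaseExp, AddCircle.toCircle_add]

theorem phaseExp_zero : phaseExp 0 = 1 := by simp [phaseExp]

theorem phaseExp_injective : Function.Injective phaseExp := fun _ _ h =>
  AddCircle.injective_toCircle one_ne_zero (Circle.coe_injective h)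

theorem phaseExp_ne_zero (x : UnitAddCircle) : phaseExp x ≠ 0 := by simp [phaseExp]

theorem norm_phaseExp (x : UnitAddCircle) : ‖phaseExp x‖ = 1 := Circle.norm_coe _

theorem phaseExp_coe (r : ℝ) :
    phaseExp (r : UnitAddCircle) = Complex.exp (2 * Real.pi * r * Complex.I) := by
  rw [phaseExp, AddCircle.toCircle_apply_mk, Circle.coe_exp]
  push_cast
  ring_nf

theorem phaseExp_half : phaseExp ((1 / 2 : ℝ) : UnitAddCircle) = -1 := by
  rw [phaseExp_coe, show 2 * (Real.pi : ℂ) * ((1 / 2 : ℝ) : ℂ) * Complex.I = Real.pi * Complex.I by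
    push_cast; ring, Complex.exp_pi_mul_I]

theorem phaseExp_quarter : phaseExp ((1 / 4 : ℝ) : UnitAddCircle) = Complex.I := by
  rw [phaseExp_coe, show 2 * (Real.pi : ℂ) * ((1 / 4 : ℝ) : ℂ) * Complex.I =
    Real.pi / 2 * Complex.I by push_cast; ring, Complex.exp_pi_div_two_mul_I]

theorem phaseExp_eighth :
    phaseExp ((1 / 8 : ℝ) : UnitAddCircle) = √2 / 2 + √2 / 2 * Complex.I := by
  rw [phaseExp_coe, show (2 * Real.pi * ((1 / 8 : ℝ) : ℂ) * Complex.I) =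
    ((Real.pi / 4 : ℝ) : ℂ) * Complex.I by push_cast; ring, Complex.exp_mul_I,
    ← Complex.ofReal_cos, ← Complex.ofReal_sin, Real.cos_pi_div_four, Real.sin_pi_div_four]
  push_cast
  ring

theorem phaseExp_int (z : ℤ) : phaseExp ((z : ℝ) : UnitAddCircle) = 1 := by
  have : ((z : ℝ) : UnitAddCircle) = 0 := by
    rw [AddCircle.coe_eq_zero_iff]
    exact ⟨z, by rw [zsmul_one]⟩
  rw [this, phaseExp_zero]

theorem sqrt_two_sq_complex : (√2 : ℂ) * √2 = 2 := by
  rw [← Complex.ofReal_mul, Real.mul_self_sqrt (by norm_num)]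
  norm_num

theorem sum_cons {k : ℕ} (F : (Fin (k + 1) → ZMod 2) → ℂ) :
    ∑ y, F y = ∑ y : Fin k → ZMod 2, (F (Fin.cons 0 y) + F (Fin.cons 1 y)) := by
  rw [← (Fin.consEquiv fun _ : Fin (k + 1) => ZMod 2).sum_comp, Fintype.sum_prod_type]
  have h : (Finset.univ : Finset (ZMod 2)) = {0, 1} := by decide
  rw [h, Finset.sum_pair (by decide), Finset.sum_add_distrib]
  rfl

theorem cons_comp_succ {k : ℕ} (b : ZMod 2) (y : Fin k → ZMod 2) :
    (Fin.cons b y : Fin (k + 1) → ZMod 2) ∘ Fin.succ = y := by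
  funext i; simp

/-! ### Soundness of the rules for the matrix interpretation -/

namespace SOP

variable {n m : ℕ}

/-- The basis element that a path contributes to. -/
def point (f : SOP n m) (y : Fin f.numVars → ZMod 2) : (Fin m → ZMod 2) × (Fin n → ZMod 2) :=
  (fun i => eval y (f.ket i), fun i => eval y (f.bra i))

/-- The Kronecker symbol. -/
def kron {α : Type*} [DecidableEq α] (u v : α) : ℂ := if u = v then 1 else 0

/-- The matrix entries of a sum over paths. -/
def interp (f : SOP n m) (v : (Fin m → ZMod 2) × (Fin n → ZMod 2)) : ℂ :=
  f.scalar * ∑ y, kron (f.point y) v * phaseExp (f.phase.value y)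

theorem Alpha.interp_eq {f g : SOP n m} (h : Alpha f g) : f.interp = g.interp := by
  obtain ⟨e, s, P, O, I⟩ := h
  funext v
  simp only [interp, point, PhasePoly.value_rename, BoolPoly.eval_rename]
  congr 1
  exact (Equiv.sum_comp (e.arrowCongr (Equiv.refl (ZMod 2))).symm fun y =>
    kron ((fun i => eval y (O i)), fun i => eval y (I i)) v * phaseExp (P.value y)).symm

/-- Adding to the bit of `y₀` a quantity that does not depend on it is an involution of the set of
paths, so this substitution only permutes the sum. -/
theorem sum_involution_subst {k : ℕ} (F : (Fin k → ZMod 2) → ℂ) (y₀ : Fin k)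
    (Q Q' : BoolPoly k) (hQ : Q = X y₀ + Q') (hQ' : y₀ ∉ Q'.vars) :
    ∑ y, F y = ∑ y : Fin k → ZMod 2,
      F (fun i => eval y (Function.update (X : Fin k → BoolPoly k) y₀ Q i)) := by
  have hup : ∀ y : Fin k → ZMod 2,
      (fun i => eval y (Function.update (X : Fin k → BoolPoly k) y₀ Q i)) =
        Function.update y y₀ (y y₀ + eval y Q') := by
    intro y
    funext i
    by_cases hi : i = y₀
    · subst hi; simp [hQ]
    · simp [Function.update_of_ne hi]
  simp only [hup]
  have hfix : ∀ (y : Fin k → ZMod 2) c, eval (Function.update y y₀ c) Q' = eval y Q' := by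
    intro y c
    refine eval₂Hom_congr' rfl (fun i hi _ => ?_) rfl
    rw [Function.update_of_ne]
    rintro rfl
    exact hQ' hi
  have hinv : Function.Involutive fun y : Fin k → ZMod 2 =>
      Function.update y y₀ (y y₀ + eval y Q') := by
    intro y
    have h2 : ∀ a : ZMod 2, a + a = 0 := by decide
    simp [hfix, add_assoc, h2]
  exact (Equiv.sum_comp hinv.toPerm F).symm

/-- The other variables are fixed and the distinguished ones are summed. In (HH) the sum over y₀ is
2 if y₀' = Q and 0 otherwise; (ω) is 1 + i(-1)^Q = √2 e^{2iπ(1/8 - Q/4)}; in (Z) the two values of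
y₀ cancel; (ket) and (bra) permute the paths. -/
theorem Rewrite.interp_eq {f g : SOP n m} (h : Rewrite f g) : f.interp = g.interp := by
  funext v
  cases h with
  | elim s P O I =>
    simp only [interp, point]
    rw [sum_cons]
    simp only [PhasePoly.value_rename, BoolPoly.eval_rename, cons_comp_succ, ← two_mul]
    rw [← Finset.mul_sum]
    push_cast
    ring
  | hh s Q R O I =>
    rename_i k
    simp only [interp, point]
    rw [sum_cons, sum_cons]
    have hsub : ∀ y : Fin k → ZMod 2,
        (fun i => eval y ((Fin.cons Q X : Fin (k + 1) → BoolPoly k) i)) =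
          Fin.cons (eval y Q) y := by
      intro y
      funext i
      refine Fin.cases ?_ (fun j => ?_) i <;> simp
    simp only [map_add, PhasePoly.value_rename, PhasePoly.value_subst, BoolPoly.eval_subst,
      BoolPoly.eval_rename, cons_comp_succ, hsub, PhasePoly.value_mk, phaseExp_add]
    rw [Complex.ofReal_mul, Complex.ofReal_ofNat, mul_comm (2 : ℂ), mul_assoc (s : ℂ) 2,
      Finset.mul_sum Finset.univ _ (2 : ℂ)]
    congr 1
    refine Finset.sum_congr rfl fun y _ => ?_
    have hev : ∀ (a b : ZMod 2),
        eval (fun i => bit ((Fin.cons a (Fin.cons b y : Fin (k + 1) → ZMod 2) :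
          Fin (k + 2) → ZMod 2) i))
          (C (1 / 2) * X 0 * (X 1 + hat (Q.rename fun j => j.succ.succ))) =
        1 / 2 * bit a * (bit b + bit (eval y Q)) := by
      intro a b
      simp only [map_mul, map_add, eval_C, eval_X, eval_hat, BoolPoly.eval_rename]
      rfl
    simp only [hev]
    have h1 := phaseExp_int 1
    rcases zmod_two_cases (eval y Q) with hq | hq <;> rw [hq] <;>
      norm_num [bit_zero, bit_one, phaseExp_zero, -one_div, phaseExp_half] at h1 ⊢ <;>
      try rw [h1]
    all_goals ring
  | omega s Q R O I =>
    rename_i k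
    simp only [interp, point]
    rw [sum_cons]
    simp only [map_add, PhasePoly.value_rename, BoolPoly.eval_rename, cons_comp_succ,
      PhasePoly.value_mk, phaseExp_add]
    rw [Complex.ofReal_mul, mul_comm (√2 : ℂ), mul_assoc (s : ℂ) √2, Finset.mul_sum Finset.univ _ (√2 : ℂ)]
    congr 1
    refine Finset.sum_congr rfl fun y _ => ?_
    have hev : ∀ a : ZMod 2,
        eval (fun i => bit ((Fin.cons a y : Fin (k + 1) → ZMod 2) i))
          (C (1 / 4) * X 0 + C (1 / 2) * X 0 * hat (Q.rename Fin.succ)) =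
        1 / 4 * bit a + 1 / 2 * bit a * bit (eval y Q) := by
      intro a
      simp only [map_mul, map_add, eval_C, eval_X, eval_hat, BoolPoly.eval_rename, cons_comp_succ]
      rfl
    rw [← map_add, ← map_add, hev, hev, map_sub, map_mul, eval_C, eval_C, eval_hat]
    have h8 := phaseExp_eighth
    have h4 : phaseExp ((1 / 8 - 1 / 4 : ℝ) : UnitAddCircle) * Complex.I =
        phaseExp ((1 / 8 : ℝ) : UnitAddCircle) := by
      rw [← phaseExp_quarter, ← phaseExp_add, ← AddCircle.coe_add, sub_add_cancel]
    have h34 : phaseExp ((1 / 4 + 1 / 2 : ℝ) : UnitAddCircle) = -Complex.I := by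
      rw [AddCircle.coe_add, phaseExp_add, phaseExp_quarter, phaseExp_half, mul_neg_one]
    have hs := sqrt_two_sq_complex
    rcases zmod_two_cases (eval y Q) with hq | hq
    · rw [hq, bit_zero, bit_one, mul_zero, mul_zero, mul_zero, add_zero, add_zero,
        mul_one, sub_zero, AddCircle.coe_zero, phaseExp_zero, phaseExp_quarter, h8]
      linear_combination (-1 / 2 - Complex.I / 2) *
        (kron (fun i => eval y (O i), fun i => eval y (I i)) v * phaseExp (R.value y)) * hs
    · rw [hq, bit_zero, bit_one, mul_zero, mul_zero, zero_mul, add_zero,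
        mul_one, mul_one, mul_one, AddCircle.coe_zero, phaseExp_zero, h34]
      have h5 : phaseExp ((1 / 8 - 1 / 4 : ℝ) : UnitAddCircle) =
          -Complex.I * phaseExp ((1 / 8 : ℝ) : UnitAddCircle) := by
        linear_combination (-Complex.I) * h4 -
          phaseExp ((1 / 8 - 1 / 4 : ℝ) : UnitAddCircle) * (-Complex.I_mul_I)
      rw [h5, h8]
      linear_combination (-1 / 2 + Complex.I / 2) *
        (kron (fun i => eval y (O i), fun i => eval y (I i)) v * phaseExp (R.value y)) * hs
        + (√2 * √2 / 2) * 
        (kron (fun i => eval y (O i), fun i => eval y (I i)) v * phaseExp (R.value y)) *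
          Complex.I_mul_I
  | ket s P O I i y₀ O' hi hlt hO' hne =>
    simp only [interp, point]
    rw [sum_involution_subst _ y₀ _ _ hi hO']
    simp only [PhasePoly.value_subst, BoolPoly.eval_subst]
  | bra s P O I i y₀ I' hi hO hlt hI' hne =>
    simp only [interp, point]
    rw [sum_involution_subst _ y₀ _ _ hi hI']
    simp only [PhasePoly.value_subst, BoolPoly.eval_subst]
  | z s R O I hne =>
    have hvan : ∀ {k : ℕ} (s : ℝ) (R : PhasePoly k) (O : Fin m → BoolPoly k)
        (I : Fin n → BoolPoly k), interp ⟨s, k + 1, PhasePoly.mk (C (1 / 2) * X 0) +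
          R.rename Fin.succ, fun i => (O i).rename Fin.succ, fun i => (I i).rename Fin.succ⟩ v =
          0 := by
      intro k s R O I
      simp only [interp, point]
      rw [sum_cons]
      simp only [map_add, PhasePoly.value_rename, BoolPoly.eval_rename, cons_comp_succ,
        PhasePoly.value_mk, phaseExp_add, map_mul, eval_C, eval_X, Fin.cons_zero, bit_zero,
        bit_one, mul_zero, mul_one, AddCircle.coe_zero, phaseExp_zero, phaseExp_half]
      simp
    rw [hvan]
    -- The right-hand side of (Z) has the same shape, with no further variable, so it vanishes too;
    -- this is why the scalar may be dropped.
    have := hvan (k := 0) 1 0 0 0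
    simpa [BoolPoly.rename, Pi.zero_def] using this.symm
theorem interp_eq_of_clifPlus {f g : SOP n m} (h : clifPlus n m f g) : f.interp = g.interp := by
  induction h with
  | rel _ _ h => exact h.elim Alpha.interp_eq Rewrite.interp_eq
  | refl _ => rfl
  | symm _ _ _ ih => exact ih.symm
  | trans _ _ _ _ _ ih₁ ih₂ => exact ih₁.trans ih₂

end SOP

/-! ### Affine Boolean polynomials -/

theorem zmod_two_add_self (a : ZMod 2) : a + a = 0 := by revert a; decide

/-- The Boolean polynomials of degree at most one. -/
def affinePolys (k : ℕ) : Submodule (ZMod 2) (BoolPoly k) :=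
  Submodule.span (ZMod 2) (insert 1 (Set.range X))

theorem mem_affinePolys_iff {k : ℕ} {Q : BoolPoly k} :
    Q ∈ affinePolys k ↔ ∃ (c : ZMod 2) (a : Fin k → ZMod 2), Q = C c + ∑ i, C (a i) * X i := by
  rw [affinePolys, Submodule.mem_span_insert]
  constructor
  · rintro ⟨c, z, hz, rfl⟩
    obtain ⟨a, rfl⟩ := (Submodule.mem_span_range_iff_exists_fun _).1 hz
    exact ⟨c, a, by simp only [smul_eq_C_mul, mul_one]⟩
  · rintro ⟨c, a, rfl⟩
    refine ⟨c, _, (Submodule.mem_span_range_iff_exists_fun _).2 ⟨a, rfl⟩, ?_⟩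
    simp only [smul_eq_C_mul, mul_one]

theorem one_mem_affinePolys (k : ℕ) : (1 : BoolPoly k) ∈ affinePolys k :=
  Submodule.subset_span (Set.mem_insert _ _)

theorem X_mem_affinePolys {k : ℕ} (i : Fin k) : (X i : BoolPoly k) ∈ affinePolys k :=
  Submodule.subset_span (Set.mem_insert_of_mem _ ⟨i, rfl⟩)

theorem C_mem_affinePolys {k : ℕ} (c : ZMod 2) : (C c : BoolPoly k) ∈ affinePolys k := by
  have := (affinePolys k).smul_mem c (one_mem_affinePolys k)
  rwa [smul_eq_C_mul, mul_one] at this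

theorem C_mul_mem_affinePolys {k : ℕ} (c : ZMod 2) {Q : BoolPoly k} (hQ : Q ∈ affinePolys k) :
    C c * Q ∈ affinePolys k := by
  have := (affinePolys k).smul_mem c hQ
  rwa [smul_eq_C_mul] at this

theorem subst_mem_affinePolys {k l : ℕ} {σ : Fin k → BoolPoly l} (hσ : ∀ i, σ i ∈ affinePolys l)
    {Q : BoolPoly k} (hQ : Q ∈ affinePolys k) : Q.subst σ ∈ affinePolys l := by
  obtain ⟨c, a, rfl⟩ := mem_affinePolys_iff.1 hQ
  simp only [BoolPoly.subst, map_add, map_sum, map_mul, algHom_C, bind₁_X_right]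
  exact add_mem (C_mem_affinePolys c) (sum_mem fun i _ => C_mul_mem_affinePolys _ (hσ i))

theorem BoolPoly.rename_eq_subst {k l : ℕ} (f : Fin k → Fin l) (Q : BoolPoly k) :
    Q.rename f = Q.subst fun i => X (f i) := by
  rw [BoolPoly.rename, BoolPoly.subst, ← Function.comp_def X f, ← bind₁_rename]
  simp

theorem rename_mem_affinePolys {k l : ℕ} (f : Fin k → Fin l)
    {Q : BoolPoly k} (hQ : Q ∈ affinePolys k) : Q.rename f ∈ affinePolys l := by
  rw [BoolPoly.rename_eq_subst]
  exact subst_mem_affinePolys (fun i => X_mem_affinePolys (f i)) hQ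

/-- The value at 0 is the constant term and the values at the unit vectors give the coefficients.
The restriction to affine polynomials matters: `BoolPoly` distinguishes `X i ^ 2` from `X i`. -/
theorem affinePolys_ext {k : ℕ} {Q Q' : BoolPoly k} (hQ : Q ∈ affinePolys k)
    (hQ' : Q' ∈ affinePolys k) (h : ∀ y, eval y Q = eval y Q') : Q = Q' := by
  obtain ⟨c, a, rfl⟩ := mem_affinePolys_iff.1 hQ
  obtain ⟨c', a', rfl⟩ := mem_affinePolys_iff.1 hQ'
  simp only [map_add, map_sum, map_mul, eval_C, eval_X] at h
  have h0 : c = c' := by simpa using h 0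
  subst h0
  have ha : a = a' := by
    funext i
    simpa [Pi.single_apply] using h (Pi.single i 1)
  rw [ha]

theorem eval_add_affine {k : ℕ} {Q : BoolPoly k} (hQ : Q ∈ affinePolys k) (x y : Fin k → ZMod 2) :
    eval (x + y) Q = eval x Q + eval y Q + eval 0 Q := by
  obtain ⟨c, a, rfl⟩ := mem_affinePolys_iff.1 hQ
  simp only [map_add, map_sum, map_mul, eval_C, eval_X, Pi.add_apply, mul_add,
    Finset.sum_add_distrib, Pi.zero_apply, mul_zero, Finset.sum_const_zero, add_zero]
  linear_combination -zmod_two_add_self c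

theorem exists_split_affine {k : ℕ} {Q : BoolPoly (k + 1)} (hQ : Q ∈ affinePolys (k + 1)) :
    ∃ (a : ZMod 2) (Q' : BoolPoly k), Q' ∈ affinePolys k ∧
      Q = C a * X 0 + Q'.rename Fin.succ := by
  obtain ⟨c, a, rfl⟩ := mem_affinePolys_iff.1 hQ
  refine ⟨a 0, C c + ∑ i : Fin k, C (a i.succ) * X i, mem_affinePolys_iff.2 ⟨c, _, rfl⟩, ?_⟩
  rw [Fin.sum_univ_succ]
  simp only [BoolPoly.rename, map_add, map_sum, map_mul, algHom_C, rename_X, algebraMap_eq]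
  ring

/-! ### Bodies of sums over paths -/

/-- A sum over paths in `k` variables without its scalar. -/
structure SOPBody (n m k : ℕ) where
  /-- the phase polynomial -/
  phase : PhasePoly k
  /-- the ket polynomials -/
  ket : Fin m → BoolPoly k
  /-- the bra polynomials -/
  bra : Fin n → BoolPoly k

namespace SOPBody

variable {n m k l j : ℕ}

/-- The sum over paths with a given scalar. -/
def toSOP (b : SOPBody n m k) (s : ℝ) : SOP n m := ⟨s, k, b.phase, b.ket, b.bra⟩

/-- Substitution of Boolean polynomials for the variables. -/
def subst (b : SOPBody n m k) (σ : Fin k → BoolPoly l) : SOPBody n m l :=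
  ⟨b.phase.subst σ, fun i => (b.ket i).subst σ, fun i => (b.bra i).subst σ⟩

/-- Addition of a phase. -/
def addPhase (P : PhasePoly k) (b : SOPBody n m k) : SOPBody n m k := ⟨P + b.phase, b.ket, b.bra⟩

theorem subst_subst (b : SOPBody n m k) (σ : Fin k → BoolPoly l) (τ : Fin l → BoolPoly j) :
    (b.subst σ).subst τ = b.subst fun i => (σ i).subst τ := by
  simp only [subst, mk.injEq]
  refine ⟨PhasePoly.ext_value fun y => ?_, ?_, ?_⟩
  · simp only [PhasePoly.value_subst, BoolPoly.eval_subst]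
  · funext i; simp only [BoolPoly.subst, bind₁_bind₁]
  · funext i; simp only [BoolPoly.subst, bind₁_bind₁]

theorem subst_X (b : SOPBody n m k) : b.subst X = b := by
  obtain ⟨P, O, I⟩ := b
  simp only [subst, mk.injEq]
  refine ⟨PhasePoly.ext_value fun y => ?_, ?_, ?_⟩
  · simp only [PhasePoly.value_subst, eval_X]
  · funext i; simp [BoolPoly.subst]
  · funext i; simp [BoolPoly.subst]

theorem subst_addPhase (P : PhasePoly k) (b : SOPBody n m k) (σ : Fin k → BoolPoly l) :
    (b.addPhase P).subst σ = (b.subst σ).addPhase (P.subst σ) := by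
  simp [subst, addPhase]

/-- Equivalence of sums over paths. -/
abbrev Sim (f g : SOP n m) : Prop :=
  Relation.EqvGen (fun f g => SOP.Alpha f g ∨ SOP.Rewrite f g) f g

theorem sim_alpha (b : SOPBody n m k) (s : ℝ) (e : Equiv.Perm (Fin k)) :
    Sim (b.toSOP s) ((b.subst fun i => X (e i)).toSOP s) := by
  refine .rel _ _ (.inl ?_)
  have := SOP.Alpha.mk e s b.phase b.ket b.bra
  simp only [BoolPoly.rename_eq_subst _ (b.ket _), BoolPoly.rename_eq_subst _ (b.bra _)] at this
  exact this

theorem sim_elim (b : SOPBody n m k) (s : ℝ) :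
    Sim ((b.subst fun i => X i.succ).toSOP s) (b.toSOP (2 * s)) := by
  refine .rel _ _ (.inr ?_)
  have := SOP.Rewrite.elim s b.phase b.ket b.bra
  simp only [BoolPoly.rename_eq_subst _ (b.ket _), BoolPoly.rename_eq_subst _ (b.bra _)] at this
  exact this

theorem sim_hh (b : SOPBody n m (k + 1)) (s : ℝ) (Q : BoolPoly k) :
    Sim (((b.subst fun i => X i.succ).addPhase (PhasePoly.mk
        (C (1 / 2) * X 0 * (X 1 + hat (Q.rename fun j => j.succ.succ))))).toSOP s)
      ((b.subst (Fin.cons Q X)).toSOP (2 * s)) := by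
  refine .rel _ _ (.inr ?_)
  have := SOP.Rewrite.hh s Q b.phase b.ket b.bra
  simp only [BoolPoly.rename_eq_subst _ (b.ket _), BoolPoly.rename_eq_subst _ (b.bra _)] at this
  exact this

theorem sim_omega (b : SOPBody n m k) (s : ℝ) (Q : BoolPoly k) :
    Sim (((b.subst fun i => X i.succ).addPhase (PhasePoly.mk
        (C (1 / 4) * X 0 + C (1 / 2) * X 0 * hat (Q.rename Fin.succ)))).toSOP s)
      ((b.addPhase (PhasePoly.mk (C (1 / 8) - C (1 / 4) * hat Q))).toSOP (√2 * s)) := by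
  refine .rel _ _ (.inr ?_)
  have := SOP.Rewrite.omega s Q b.phase b.ket b.bra
  simp only [BoolPoly.rename_eq_subst _ (b.ket _), BoolPoly.rename_eq_subst _ (b.bra _)] at this
  exact this

/-- The vanishing sum over paths that the rule (Z) produces. -/
def vanishing (n m : ℕ) : SOP n m := ⟨1, 1, PhasePoly.mk (C (1 / 2) * X 0), 0, 0⟩

theorem sim_z (b : SOPBody n m k) (s : ℝ) (h : b.phase ≠ 0 ∨ b.ket ≠ 0 ∨ b.bra ≠ 0) :
    Sim (((b.subst fun i => X i.succ).addPhase (PhasePoly.mk (C (1 / 2) * X 0))).toSOP s)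
      (vanishing n m) := by
  refine .rel _ _ (.inr ?_)
  have := SOP.Rewrite.z s b.phase b.ket b.bra h
  simp only [BoolPoly.rename_eq_subst _ (b.ket _), BoolPoly.rename_eq_subst _ (b.bra _)] at this
  exact this

/-! ### Affine changes of variables -/

theorem subst_rename (f : Fin k → Fin l) (σ : Fin l → BoolPoly j) (Q : BoolPoly k) :
    (Q.rename f).subst σ = Q.subst (σ ∘ f) := by
  rw [BoolPoly.subst, BoolPoly.rename, bind₁_rename, BoolPoly.subst]

theorem X_subst (σ : Fin k → BoolPoly l) (i : Fin k) : BoolPoly.subst σ (X i) = σ i := by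
  simp [BoolPoly.subst]

theorem coe_eq_coe_of_sub {x y : ℝ} (z : ℤ) (h : x = y + z) : (x : UnitAddCircle) = y := by
  rw [h, AddCircle.coe_add]
  have : ((z : ℝ) : UnitAddCircle) = 0 := by
    rw [AddCircle.coe_eq_zero_iff]
    exact ⟨z, by rw [zsmul_one]⟩
  rw [this, add_zero]

/-- The phase y₀(y₁ + y₂ + Q)/2 is symmetric in y₁ and y₂. If the rest uses y₂, then (HH) removes y₀
and y₁ and returns the original; if the rest uses y₁ instead, then (HH) replaces it by y₂ + Q. The
two expressions are renamings of each other. The scalar starts at `s / 2` because (HH) doubles it.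
-/
theorem sim_shift_zero (b : SOPBody n m (k + 1)) (s : ℝ) (Q : BoolPoly k) :
    Sim (b.toSOP s)
      ((b.subst (Fin.cons (X 0 + Q.rename Fin.succ) fun i => X i.succ)).toSOP s) := by
  have h1 := sim_hh (b.subst fun i => X i.succ) (s / 2) (X 0 + Q.rename Fin.succ)
  have h2 := sim_hh (b.subst (Fin.cons (X 0) fun i => X i.succ.succ)) (s / 2)
    (X 0 + Q.rename Fin.succ)
  rw [mul_div_cancel₀ _ (two_ne_zero' ℝ), subst_subst] at h1 h2
  have hb : (b.subst fun i => BoolPoly.subst (Fin.cons (X 0 + Q.rename Fin.succ) X :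
      Fin (k + 2) → BoolPoly (k + 1)) (X i.succ)) = b := by
    conv_rhs => rw [← subst_X b]
    congr 1
    funext i
    rw [X_subst, Fin.cons_succ]
  have hb' : (fun i => BoolPoly.subst (Fin.cons (X 0 + Q.rename Fin.succ) X :
      Fin (k + 2) → BoolPoly (k + 1)) ((Fin.cons (X 0) fun i => X i.succ.succ :
        Fin (k + 1) → BoolPoly (k + 2)) i)) =
      Fin.cons (X 0 + Q.rename Fin.succ) fun i => X i.succ := by
    funext i
    refine Fin.cases ?_ (fun i => ?_) i
    · rw [Fin.cons_zero, X_subst]; rfl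
    · rw [Fin.cons_succ, X_subst]; rfl
  rw [subst_subst, hb] at h1
  rw [subst_subst, hb'] at h2
  refine (Relation.EqvGen.symm _ _ h1).trans _ _ _ (Relation.EqvGen.trans _ _ _ ?_ h2)
  have h3 := sim_alpha ((b.subst fun i => BoolPoly.subst (fun i => X i.succ) (X i.succ)).addPhase
    (PhasePoly.mk (C (1 / 2) * X 0 *
      (X 1 + hat ((X 0 + Q.rename Fin.succ : BoolPoly (k + 1)).rename fun j => j.succ.succ)))))
    (s / 2) (Equiv.swap 1 2)
  rw [subst_addPhase, subst_subst] at h3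
  have hne : ∀ i : Fin (k + 3), (i : ℕ) ≠ 1 → (i : ℕ) ≠ 2 → Equiv.swap (1 : Fin (k + 3)) 2 i = i :=
    fun i h1 h2 => Equiv.swap_apply_of_ne_of_ne (fun h => h1 (by rw [h]; rfl))
      (fun h => h2 (by rw [h, ← Fin.succ_one_eq_two]; rfl))
  have hswap : ∀ i : Fin k, Equiv.swap (1 : Fin (k + 3)) 2 i.succ.succ.succ =
      i.succ.succ.succ := fun i => hne _ (by simp) (by simp)
  have h0 : Equiv.swap (1 : Fin (k + 3)) 2 0 = 0 := hne _ (by simp) (by simp)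
  convert h3 using 3
  · refine PhasePoly.ext_value fun y => ?_
    rw [PhasePoly.value_subst]
    simp only [PhasePoly.value_mk, map_mul, map_add, eval_C, eval_X, eval_hat,
      BoolPoly.eval_rename, bit_add, Function.comp_def, Fin.succ_zero_eq_one,
      Fin.succ_one_eq_two, Equiv.swap_apply_left, Equiv.swap_apply_right]
    simp only [hswap, h0]
    generalize eval (fun i : Fin k => y i.succ.succ.succ) Q = q
    -- The two ways of expanding the exclusive or in the phase differ by an integer.
    refine coe_eq_coe_of_sub ((y 0).val * ((y 1).val * q.val - (y 2).val * q.val)) ?_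
    simp only [bit]
    push_cast
    ring
  · congr 1
    funext x
    refine Fin.cases ?_ (fun i => ?_) x
    · simp only [Fin.cons_zero, X_subst, Fin.succ_zero_eq_one, Fin.succ_one_eq_two,
        Equiv.swap_apply_right]
    · simp only [Fin.cons_succ, X_subst, hswap]

theorem Sim.comp {f g h : SOP n m} (h₁ : Sim f g) (h₂ : Sim g h) : Sim f h :=
  Relation.EqvGen.trans _ _ _ h₁ h₂

theorem Sim.inv {f g : SOP n m} (h : Sim f g) : Sim g f := Relation.EqvGen.symm _ _ h

theorem subst_rename_perm (b : SOPBody n m k) (e : Equiv.Perm (Fin k)) (σ : Fin k → BoolPoly l) :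
    (b.subst fun i => X (e i)).subst σ = b.subst (σ ∘ e) := by
  rw [subst_subst]
  simp only [X_subst]
  rfl

/-- Any variable may be shifted by a Boolean polynomial in the other variables. -/
theorem sim_shift (b : SOPBody n m (k + 1)) (s : ℝ) (i : Fin (k + 1)) (Q : BoolPoly k) :
    Sim (b.toSOP s) ((b.subst (Function.update X i
      (X i + Q.rename fun j => Equiv.swap 0 i j.succ))).toSOP s) := by
  have h1 := sim_alpha b s (Equiv.swap 0 i)
  have h2 := sim_shift_zero (b.subst fun j => X (Equiv.swap 0 i j)) s Q
  have h3 := sim_alpha ((b.subst fun j => X (Equiv.swap 0 i j)).subst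
    (Fin.cons (X 0 + Q.rename Fin.succ) fun i => X i.succ)) s (Equiv.swap 0 i)
  refine (h1.comp h2).comp ?_
  convert h3 using 2
  rw [subst_subst, subst_rename_perm]
  congr 1
  funext x
  simp only [Function.comp_def]
  by_cases hx : x = i
  · subst hx
    rw [Function.update_self, Equiv.swap_apply_right, Fin.cons_zero, BoolPoly.subst, map_add]
    simp only [bind₁_X_right, Equiv.swap_apply_left]
    change _ = X x + (Q.rename Fin.succ).subst _
    rw [subst_rename, BoolPoly.rename_eq_subst]
    rfl
  · rw [Function.update_of_ne hx]
    obtain ⟨y, hy⟩ := Fin.exists_succ_eq.2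
      (show Equiv.swap 0 i x ≠ 0 from fun h => hx ((Equiv.swap 0 i).injective
        (h.trans (Equiv.swap_apply_right 0 i).symm)))
    rw [← hy, Fin.cons_succ, X_subst, hy, Equiv.swap_apply_self]

/-- The linear substitution given by a matrix. -/
def linear (M : Matrix (Fin k) (Fin k) (ZMod 2)) (i : Fin k) : BoolPoly k :=
  ∑ j, C (M i j) * X j

theorem eval_linear (M : Matrix (Fin k) (Fin k) (ZMod 2)) (y : Fin k → ZMod 2) (i : Fin k) :
    eval y (linear M i) = M.mulVec y i := by
  simp [linear, Matrix.mulVec, dotProduct]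

theorem linear_mem_affinePolys (M : Matrix (Fin k) (Fin k) (ZMod 2)) (i : Fin k) :
    linear M i ∈ affinePolys k :=
  sum_mem fun _ _ => C_mul_mem_affinePolys _ (X_mem_affinePolys _)

theorem linear_mul (M N : Matrix (Fin k) (Fin k) (ZMod 2)) :
    linear (M * N) = fun i => (linear M i).subst (linear N) := by
  funext i
  refine affinePolys_ext (linear_mem_affinePolys _ _)
    (subst_mem_affinePolys (linear_mem_affinePolys N) (linear_mem_affinePolys M i)) fun y => ?_
  rw [BoolPoly.eval_subst, eval_linear, ← Matrix.mulVec_mulVec]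
  simp only [eval_linear]

theorem linear_one : linear (1 : Matrix (Fin k) (Fin k) (ZMod 2)) = X := by
  funext i
  refine affinePolys_ext (linear_mem_affinePolys _ _) (X_mem_affinePolys i) fun y => ?_
  rw [eval_linear, Matrix.one_mulVec, eval_X]

/-- Over the field with two elements an invertible diagonal matrix is the identity, so the
invertible matrices are products of transvections, and a transvection is a shift of one variable by
another. -/
theorem sim_linear (M : Matrix (Fin k) (Fin k) (ZMod 2)) (hM : M.det ≠ 0) :
    ∀ (b : SOPBody n m k) (s : ℝ), Sim (b.toSOP s) ((b.subst (linear M)).toSOP s) := by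
  refine Matrix.diagonal_transvection_induction_of_det_ne_zero
    (fun M => ∀ (b : SOPBody n m k) (s : ℝ), Sim (b.toSOP s) ((b.subst (linear M)).toSOP s))
    M hM ?_ ?_ ?_
  · intro D hD b s
    have h1 : Matrix.diagonal D = 1 := by
      rw [← Matrix.diagonal_one]
      congr 1
      funext i
      rw [Matrix.det_diagonal, Finset.prod_ne_zero_iff] at hD
      exact (zmod_two_cases (D i)).resolve_left (hD i (Finset.mem_univ i))
    rw [h1, linear_one, subst_X]
    exact .refl _
  · rintro ⟨i, j, hij, c⟩ b s
    rcases zmod_two_cases c with rfl | rfl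
    · have : (Matrix.TransvectionStruct.mk i j hij (0 : ZMod 2)).toMatrix = 1 := by
        simp [Matrix.TransvectionStruct.toMatrix]
      rw [this, linear_one, subst_X]
      exact .refl _
    · obtain _ | k := k
      · exact i.elim0
      obtain ⟨j', hj'⟩ := Fin.exists_succ_eq.2
        (show Equiv.swap 0 i j ≠ 0 from fun h => hij ((Equiv.swap 0 i).injective
          (h.trans (Equiv.swap_apply_right 0 i).symm)).symm)
      have := sim_shift b s i (X j')
      convert this using 3
      funext x
      refine affinePolys_ext (linear_mem_affinePolys _ _) ?_ fun y => ?_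
      · by_cases hx : x = i
        · subst hx
          rw [Function.update_self]
          exact add_mem (X_mem_affinePolys _) (rename_mem_affinePolys _ (X_mem_affinePolys _))
        · rw [Function.update_of_ne hx]
          exact X_mem_affinePolys _
      · rw [eval_linear, Matrix.TransvectionStruct.toMatrix, Matrix.transvection, Matrix.add_mulVec,
          Matrix.one_mulVec, Pi.add_apply]
        by_cases hx : x = i
        · subst hx
          rw [Function.update_self, map_add, BoolPoly.eval_rename]
          simp [hj', Matrix.mulVec, dotProduct, Matrix.single_apply]
        · rw [Function.update_of_ne hx]
          simp [Matrix.mulVec, dotProduct, Ne.symm hx]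
  · intro A B _ _ hA hB b s
    rw [linear_mul, ← subst_subst]
    exact (hA b s).comp (hB _ s)

/-- Each coordinate of the translation is a shift by a constant polynomial; the coordinates are
treated one after the other. -/
theorem sim_translate (b : SOPBody n m k) (s : ℝ) (c : Fin k → ZMod 2) :
    Sim (b.toSOP s) ((b.subst fun i => X i + C (c i)).toSOP s) := by
  classical
  have key : ∀ S : Finset (Fin k), Sim (b.toSOP s)
      ((b.subst fun i => X i + if i ∈ S then C (c i) else 0).toSOP s) := by
    intro S
    induction S using Finset.induction_on with
    | empty =>
      simp only [Finset.notMem_empty, if_false, add_zero]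
      change Sim _ ((b.subst X).toSOP s)
      rw [subst_X]
      exact .refl _
    | insert a S ha ih =>
      refine ih.comp ?_
      obtain _ | k := k
      · exact a.elim0
      have := sim_shift (b.subst fun i => X i + if i ∈ S then C (c i) else 0) s a (C (c a))
      convert this using 2
      rw [subst_subst]
      congr 1
      funext x
      by_cases hx : x = a
      · subst hx
        simp [ha, BoolPoly.subst, BoolPoly.rename]
      · by_cases hS : x ∈ S <;> simp [hx, hS, BoolPoly.subst]
  simpa using key Finset.univ

end SOPBody

/-! ### Clifford phases -/

/-- The phases `P⁽⁰⁾ / 8 + P⁽¹⁾ / 4 + P⁽²⁾ / 2`, generated by `1 / 8` and by the quarters of affine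
Boolean polynomials. -/
def clifPhases (k : ℕ) : AddSubgroup (PhasePoly k) :=
  AddSubgroup.closure (insert (PhasePoly.mk (C (1 / 8)))
    ((fun Q : BoolPoly k => PhasePoly.mk (C (1 / 4) * hat Q)) '' affinePolys k))

theorem eighth_mem_clifPhases (k : ℕ) : PhasePoly.mk (C (1 / 8)) ∈ clifPhases k :=
  AddSubgroup.subset_closure (Set.mem_insert _ _)

theorem quarter_mem_clifPhases {k : ℕ} {Q : BoolPoly k} (hQ : Q ∈ affinePolys k) :
    PhasePoly.mk (C (1 / 4) * hat Q) ∈ clifPhases k :=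
  AddSubgroup.subset_closure (Set.mem_insert_of_mem _ ⟨Q, hQ, rfl⟩)

theorem value_eighth {k : ℕ} (y : Fin k → ZMod 2) :
    (PhasePoly.mk (C (1 / 8))).value y = ((1 / 8 : ℝ) : UnitAddCircle) := by
  rw [PhasePoly.value_mk, eval_C]

theorem value_quarter {k : ℕ} (y : Fin k → ZMod 2) (Q : BoolPoly k) :
    (PhasePoly.mk (C (1 / 4) * hat Q)).value y =
      ((1 / 4 * bit (eval y Q) : ℝ) : UnitAddCircle) := by
  rw [PhasePoly.value_mk, map_mul, eval_C, eval_hat]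

theorem subst_mem_clifPhases {k l : ℕ} {σ : Fin k → BoolPoly l} (hσ : ∀ i, σ i ∈ affinePolys l)
    {P : PhasePoly k} (hP : P ∈ clifPhases k) : P.subst σ ∈ clifPhases l := by
  have hle : clifPhases k ≤ (clifPhases l).comap (PhasePoly.subst σ) := by
    refine (AddSubgroup.closure_le _).2 ?_
    rintro _ (rfl | ⟨Q, hQ, rfl⟩)
    · change PhasePoly.subst σ _ ∈ clifPhases l
      convert eighth_mem_clifPhases l using 1
      refine PhasePoly.ext_value fun y => ?_
      rw [PhasePoly.value_subst, value_eighth, value_eighth]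
    · change PhasePoly.subst σ _ ∈ clifPhases l
      convert quarter_mem_clifPhases (subst_mem_affinePolys hσ hQ) using 1
      refine PhasePoly.ext_value fun y => ?_
      rw [PhasePoly.value_subst, value_quarter, value_quarter, BoolPoly.eval_subst]
  exact hle hP

/-- The dependence of a Clifford phase on one variable. -/
theorem exists_split_phase {k : ℕ} {P : PhasePoly (k + 1)} (hP : P ∈ clifPhases (k + 1)) :
    ∃ (c : ℤ) (Q : BoolPoly k) (R : PhasePoly k), Q ∈ affinePolys k ∧ R ∈ clifPhases k ∧
      ∀ (a : ZMod 2) (y : Fin k → ZMod 2), P.value (Fin.cons a y) =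
        ((c / 4 * bit a + 1 / 2 * bit a * bit (eval y Q) : ℝ) : UnitAddCircle) + R.value y := by
  induction hP using AddSubgroup.closure_induction with
  | mem P hP =>
    rcases hP with rfl | ⟨Q, hQ, rfl⟩
    · refine ⟨0, 0, _, zero_mem _, eighth_mem_clifPhases k, fun a y => ?_⟩
      rw [value_eighth, value_eighth]
      simp [bit_zero]
    · obtain ⟨c, Q', hQ', rfl⟩ := exists_split_affine hQ
      refine ⟨c.val, C c * Q', _, C_mul_mem_affinePolys _ hQ', quarter_mem_clifPhases hQ',
        fun a y => ?_⟩
      rw [value_quarter, value_quarter, ← AddCircle.coe_add]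
      simp only [map_add, map_mul, eval_C, eval_X, BoolPoly.eval_rename, cons_comp_succ,
        Fin.cons_zero, bit_add, bit_mul]
      -- A quarter of `a ⊕ b` is a/4 + b/4 - ab/2, and the sign of the last term is irrelevant
      -- modulo 1.
      refine SOPBody.coe_eq_coe_of_sub (-(c.val * a.val * (eval y Q').val)) ?_
      simp only [bit]
      push_cast
      ring
  | zero => exact ⟨0, 0, 0, zero_mem _, zero_mem _, fun a y => by simp [bit_zero]⟩
  | add P P' _ _ ih ih' =>
    obtain ⟨c, Q, R, hQ, hR, h⟩ := ih
    obtain ⟨c', Q', R', hQ', hR', h'⟩ := ih'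
    refine ⟨c + c', Q + Q', R + R', add_mem hQ hQ', add_mem hR hR', fun a y => ?_⟩
    rw [map_add, map_add, h, h', add_add_add_comm, ← AddCircle.coe_add]
    simp only [map_add]
    congr 1
    rw [bit_add]
    refine SOPBody.coe_eq_coe_of_sub (a.val * (eval y Q).val * (eval y Q').val) ?_
    simp only [bit]
    push_cast
    ring
  | neg P _ ih =>
    obtain ⟨c, Q, R, hQ, hR, h⟩ := ih
    refine ⟨-c, Q, -R, hQ, neg_mem hR, fun a y => ?_⟩
    rw [map_neg, map_neg, h, neg_add, ← AddCircle.coe_neg]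
    congr 1
    refine SOPBody.coe_eq_coe_of_sub (-(a.val * (eval y Q).val)) ?_
    simp only [bit]
    push_cast
    ring

/-! ### Elimination of variables that occur in the phase only -/

namespace SOPBody

variable {n m k l j : ℕ}

/-- Clifford bodies. -/
structure IsClif (b : SOPBody n m k) : Prop where
  phase : b.phase ∈ clifPhases k
  ket : ∀ i, b.ket i ∈ affinePolys k
  bra : ∀ i, b.bra i ∈ affinePolys k

theorem IsClif.subst {b : SOPBody n m k} (hb : b.IsClif) {σ : Fin k → BoolPoly l}
    (hσ : ∀ i, σ i ∈ affinePolys l) : (b.subst σ).IsClif :=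
  ⟨subst_mem_clifPhases hσ hb.phase, fun i => subst_mem_affinePolys hσ (hb.ket i),
    fun i => subst_mem_affinePolys hσ (hb.bra i)⟩

/-- The basis element that a path contributes to. -/
def point (b : SOPBody n m k) (y : Fin k → ZMod 2) : (Fin m → ZMod 2) × (Fin n → ZMod 2) :=
  (fun i => eval y (b.ket i), fun i => eval y (b.bra i))

/-- This removes the side condition of (Z) that something else be nonzero. If all the rest is zero,
then a fresh variable is introduced by (Elim) backwards and the old one is shifted by it; the phase
becomes half the sum of both, so (Z) applies to one of them with the other as nonzero rest. -/
theorem sim_vanishing (b : SOPBody n m k) (s : ℝ) :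
    Sim (((b.subst fun i => X i.succ).addPhase (PhasePoly.mk (C (1 / 2) * X 0))).toSOP s)
      (vanishing n m) := by
  by_cases h : b.phase ≠ 0 ∨ b.ket ≠ 0 ∨ b.bra ≠ 0
  · exact sim_z b s h
  · push Not at h
    obtain ⟨hP, hO, hI⟩ := h
    obtain ⟨P, O, I⟩ := b
    dsimp only at hP hO hI
    subst hP hO hI
    set z : SOPBody n m (k + 1) := ⟨PhasePoly.mk (C (1 / 2) * X 0), 0, 0⟩ with hz
    have hz1 : ((⟨0, 0, 0⟩ : SOPBody n m k).subst fun i => X i.succ).addPhase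
        (PhasePoly.mk (C (1 / 2) * X 0)) = z := by
      simp only [SOPBody.subst, addPhase, map_zero, add_zero, hz, BoolPoly.subst, Pi.zero_apply]
      rfl
    rw [hz1]
    have h1 := (sim_elim z (s / 2)).inv
    rw [mul_div_cancel₀ _ (two_ne_zero' ℝ)] at h1
    have h2 := sim_shift (z.subst fun i => X i.succ) (s / 2) 1 (X 0)
    refine (h1.comp h2).comp ?_
    have hne : z.phase ≠ 0 := by
      intro h
      have h0 : z.phase.value 1 = 0 := by rw [h, map_zero]
      rw [hz, PhasePoly.value_mk, map_mul, eval_C, eval_X, Pi.one_apply, bit_one, mul_one] at h0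
      have h3 := phaseExp_half
      rw [h0, phaseExp_zero] at h3
      norm_num at h3
    have h4 := sim_z z (s / 2) (.inl hne)
    convert h4 using 2
    rw [subst_subst]
    simp only [SOPBody.subst, addPhase, hz, mk.injEq, Pi.zero_apply, BoolPoly.subst, map_zero,
      and_true]
    refine PhasePoly.ext_value fun y => ?_
    rw [map_add, PhasePoly.value_subst, PhasePoly.value_subst]
    simp only [PhasePoly.value_mk, map_mul, eval_C, eval_X, bind₁_X_right, Fin.succ_zero_eq_one,
      Function.update_self, map_add, BoolPoly.eval_rename, Function.comp_apply,
      Equiv.swap_apply_right, bit_add, ← AddCircle.coe_add]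
    refine coe_eq_coe_of_sub (-((y 1).val * (y 0).val)) ?_
    simp only [bit]
    push_cast
    ring

theorem exists_eq_bit_add (d : ℤ) : ∃ e : ℤ, (d : ℝ) = bit (d : ZMod 2) + 2 * e := by
  refine ⟨d / 2, ?_⟩
  have : ((d : ZMod 2).val : ℤ) = d % 2 := ZMod.val_intCast d
  have h2 : (d : ℤ) = (d : ZMod 2).val + 2 * (d / 2) := by rw [this]; omega
  rw [bit]
  exact_mod_cast h2

/-- A variable on which the basis elements do not depend can be eliminated. -/
theorem exists_sim_of_internal {b : SOPBody n m (k + 1)} (hb : b.IsClif) {s : ℝ} (hs : 0 < s)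
    (h0 : b.point (Fin.cons 0 0) = b.point (Fin.cons 1 0)) :
    Sim (b.toSOP s) (vanishing n m) ∨
      ∃ (l : ℕ) (b' : SOPBody n m l) (s' : ℝ), l ≤ k ∧ b'.IsClif ∧ 0 < s' ∧
        Sim (b.toSOP s) (b'.toSOP s') := by
  have hren : ∀ Q ∈ affinePolys (k + 1), eval (Fin.cons 0 0) Q = eval (Fin.cons 1 0) Q →
      ∃ Q' ∈ affinePolys k, Q = BoolPoly.subst (fun i => X i.succ) Q' := by
    intro Q hQ h
    obtain ⟨a, Q', hQ', rfl⟩ := exists_split_affine hQ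
    refine ⟨Q', hQ', ?_⟩
    simp only [map_add, map_mul, eval_C, eval_X, BoolPoly.eval_rename, cons_comp_succ,
      Fin.cons_zero, mul_zero, mul_one, zero_add] at h
    have ha : a = 0 := by simpa using h
    rw [ha, map_zero, zero_mul, zero_add, BoolPoly.rename_eq_subst]
  choose O hO hO' using fun i => hren (b.ket i) (hb.ket i) (congrFun (congrArg Prod.fst h0) i)
  choose I hI hI' using fun i => hren (b.bra i) (hb.bra i) (congrFun (congrArg Prod.snd h0) i)
  obtain ⟨c, Q, R, hQ, hR, hP⟩ := exists_split_phase hb.phase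
  set r : SOPBody n m k := ⟨R, O, I⟩ with hr
  have hrc : r.IsClif := ⟨hR, hO, hI⟩
  have hform : ∀ T : PhasePoly (k + 1), (∀ a y, T.value (Fin.cons a y) =
      ((c / 4 * bit a + 1 / 2 * bit a * bit (eval y Q) : ℝ) : UnitAddCircle)) →
      b = (r.subst fun i => X i.succ).addPhase T := by
    intro T hT
    obtain ⟨P, O₁, I₁⟩ := b
    simp only [addPhase, SOPBody.subst, hr, mk.injEq]
    refine ⟨PhasePoly.ext_value fun y => ?_, funext hO', funext hI'⟩
    rw [← Fin.cons_self_tail y, hP, map_add, hT, PhasePoly.value_subst]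
    simp only [eval_X, Fin.cons_succ]
  -- With c = 2d the part of the phase that involves y₀ is y₀(Q + d)/2; with c = 2d + 1 it is y₀/4 +
  -- y₀(Q + d)/2, the shape of (ω).
  obtain ⟨d, hd | hd⟩ := Int.even_or_odd' c
  · have hQ1 : Q + C (d : ZMod 2) ∈ affinePolys k := add_mem hQ (C_mem_affinePolys _)
    have hb1 := hform (PhasePoly.mk (C (1 / 2) * X 0 * hat ((Q + C (d : ZMod 2)).rename Fin.succ)))
      (fun a y => ?_)
    swap
    · rw [PhasePoly.value_mk]
      simp only [map_mul, eval_C, eval_X, eval_hat, BoolPoly.eval_rename, cons_comp_succ,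
        Fin.cons_zero, map_add, bit_add]
      obtain ⟨e, he⟩ := exists_eq_bit_add d
      rw [hd]
      refine coe_eq_coe_of_sub (-(a.val * (eval y Q).val * (d : ZMod 2).val) - e * a.val) ?_
      push_cast
      rw [he]
      simp only [bit]
      ring
    generalize Q + C (d : ZMod 2) = Q1 at hQ1 hb1
    -- The constant 0 calls for (Elim) and the constant 1 for (Z); otherwise some variable occurs in
    -- `Q1` and serves as y₀' in (HH).
    by_cases hconst : ∃ c, Q1 = C c
    · obtain ⟨c, rfl⟩ := hconst
      rcases zmod_two_cases c with rfl | rfl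
      · right
        refine ⟨k, r, 2 * s, le_rfl, hrc, by positivity, ?_⟩
        convert sim_elim r s using 2
        rw [hb1]
        simp [addPhase, BoolPoly.rename, hat, hatInt, PhasePoly.mk]
      · left
        convert sim_vanishing r s using 2
        rw [hb1]
        congr 1
        refine PhasePoly.ext_value fun y => ?_
        rw [PhasePoly.value_mk, PhasePoly.value_mk, map_mul, eval_hat]
        simp [BoolPoly.rename, bit_one]
    · right
      obtain ⟨c, a, hca⟩ := mem_affinePolys_iff.1 hQ1
      have ⟨i, hi⟩ : ∃ i, a i ≠ 0 := by
        by_contra! h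
        exact hconst ⟨c, by rw [hca]; simp [h]⟩
      obtain _ | k := k
      · exact i.elim0
      -- `e` moves the variable to be solved for to the front of the remaining ones, and `e'` is the
      -- same renaming with y₀ kept in place.
      set e : Equiv.Perm (Fin (k + 1)) := Equiv.swap 0 i
      set e' : Equiv.Perm (Fin (k + 2)) := Equiv.swap (Fin.succ 0) i.succ with he'
      have hee : ∀ x, e' (Fin.succ x) = Fin.succ (e x) := by
        intro x
        rw [he', Equiv.swap_apply_def, show e x = _ from Equiv.swap_apply_def 0 i x]
        simp only [Fin.succ_inj]
        split_ifs <;> rfl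
      have he0 : e' 0 = 0 := Equiv.swap_apply_of_ne_of_ne (Fin.succ_ne_zero _).symm
        (Fin.succ_ne_zero _).symm
      obtain ⟨a', Q2, hQ2, hQ2e⟩ := exists_split_affine (rename_mem_affinePolys e hQ1)
      have ha' : a' = 1 := by
        -- The coefficient of a variable in an affine polynomial is the sum of its values at the
        -- unit vector and at 0.
        have h1 := congrArg (fun q => eval (Pi.single 0 1) q + eval 0 q) hQ2e
        simp only [BoolPoly.eval_rename, map_add, map_mul, eval_C, eval_X, hca, map_sum] at h1
        have hs : ∀ x, (Pi.single 0 1 : Fin (k + 1) → ZMod 2) (e x) =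
            (Pi.single i 1 : Fin (k + 1) → ZMod 2) x := by
          intro x
          have hiff : e x = 0 ↔ x = i := by
            rw [← Equiv.swap_apply_right 0 i]
            exact e.injective.eq_iff
          simp only [Pi.single_apply, hiff]
        have hs' : (Pi.single 0 1 : Fin (k + 1) → ZMod 2) ∘ Fin.succ = 0 := by
          funext x; simp
        have hs'' : (0 : Fin (k + 1) → ZMod 2) ∘ Fin.succ = 0 := rfl
        simp only [Function.comp_apply, hs, hs', hs'', Pi.zero_apply, mul_zero,
          Finset.sum_const_zero, Pi.single_apply, mul_ite, mul_one, Finset.sum_ite_eq',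
          Finset.mem_univ, if_true] at h1
        have h2 : a i = 1 := (zmod_two_cases _).resolve_left hi
        have h3 : a i = a' := by
          linear_combination h1 - zmod_two_add_self c + zmod_two_add_self (eval 0 Q2)
        exact h3.symm.trans h2
      subst ha'
      refine ⟨k, (r.subst fun x => X (e x)).subst (Fin.cons Q2 X), 2 * s, k.le_succ,
        (hrc.subst fun x => X_mem_affinePolys _).subst ?_, by positivity, ?_⟩
      · refine Fin.cases hQ2 fun x => ?_
        rw [Fin.cons_succ]
        exact X_mem_affinePolys _
      · refine (sim_alpha b s e').comp ?_
        convert sim_hh (r.subst fun x => X (e x)) s Q2 using 2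
        rw [hb1, subst_addPhase, subst_subst, subst_subst]
        simp only [X_subst, hee]
        congr 1
        refine PhasePoly.ext_value fun y => ?_
        rw [PhasePoly.value_subst, PhasePoly.value_mk, PhasePoly.value_mk]
        have hQy : eval (fun x : Fin (k + 1) => y (Fin.succ (e x))) Q1 =
            y 1 + eval (fun x : Fin k => y x.succ.succ) Q2 := by
          have h1 := congrArg (eval (y ∘ Fin.succ)) hQ2e
          rw [BoolPoly.eval_rename, map_add, BoolPoly.eval_rename, map_one, one_mul, eval_X] at h1
          exact h1
        simp only [map_mul, eval_C, eval_X, eval_hat, BoolPoly.eval_rename, map_add,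
          Function.comp_def, hee, he0, hQy, bit_add]
        refine coe_eq_coe_of_sub
          (-((y 0).val * (y 1).val * (eval (fun x : Fin k => y x.succ.succ) Q2).val)) ?_
        simp only [bit]
        push_cast
        ring
  · right
    have hQ1 : Q + C (d : ZMod 2) ∈ affinePolys k := add_mem hQ (C_mem_affinePolys _)
    refine ⟨k, r.addPhase (PhasePoly.mk (C (1 / 8) - C (1 / 4) * hat (Q + C (d : ZMod 2)))), √2 * s,
      le_rfl, ⟨add_mem (sub_mem (eighth_mem_clifPhases k) (quarter_mem_clifPhases hQ1)) hR, hO, hI⟩,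
      by positivity, ?_⟩
    convert sim_omega r s (Q + C (d : ZMod 2)) using 2
    refine hform _ fun a y => ?_
    rw [PhasePoly.value_mk]
    simp only [map_mul, eval_C, eval_X, eval_hat, BoolPoly.eval_rename, cons_comp_succ,
      Fin.cons_zero, map_add, bit_add]
    obtain ⟨e, he⟩ := exists_eq_bit_add d
    rw [hd]
    refine coe_eq_coe_of_sub (-(a.val * (eval y Q).val * (d : ZMod 2).val) - e * a.val) ?_
    push_cast
    rw [he]
    simp only [bit]
    ring

end SOPBody

/-! ### Completeness -/

namespace SOPBody

variable {n m k l j : ℕ}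

theorem point_subst (b : SOPBody n m k) (σ : Fin k → BoolPoly l) (y : Fin l → ZMod 2) :
    (b.subst σ).point y = b.point fun i => eval y (σ i) := by
  simp only [point, subst, BoolPoly.eval_subst]

/-- If two paths reach the same basis element, then, the ket and bra polynomials being affine, these
do not change along the difference `v` of the two paths. A linear change of variables makes `v` the
first unit vector; the first variable is then internal, it is eliminated, and the number of
variables drops. -/
theorem exists_sim_faithful : ∀ (k : ℕ) {b : SOPBody n m k} (_ : b.IsClif) {s : ℝ} (_ : 0 < s),
    Sim (b.toSOP s) (vanishing n m) ∨
      ∃ (l : ℕ) (b' : SOPBody n m l) (s' : ℝ), b'.IsClif ∧ 0 < s' ∧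
        Function.Injective b'.point ∧ Sim (b.toSOP s) (b'.toSOP s') := by
  intro k
  induction k using Nat.strong_induction_on with
  | _ k ih =>
    intro b hb s hs
    by_cases hinj : Function.Injective b.point
    · exact .inr ⟨k, b, s, hb, hs, hinj, .refl _⟩
    obtain ⟨x, y, hxy, hne⟩ := Function.not_injective_iff.1 hinj
    set v := x + y with hv
    obtain ⟨i, hi⟩ : ∃ i, v i ≠ 0 := by
      by_contra! h
      refine hne (funext fun i => ?_)
      have : x i + y i = 0 := h i
      linear_combination this - zmod_two_add_self (y i)
    have hpt : b.point v = b.point 0 := by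
      have haff : ∀ Q ∈ affinePolys k, eval x Q = eval y Q → eval v Q = eval 0 Q := by
        intro Q hQ h
        rw [hv, eval_add_affine hQ, h, zmod_two_add_self, zero_add]
      refine Prod.ext (funext fun i => ?_) (funext fun i => ?_)
      · exact haff _ (hb.ket i) (congrFun (congrArg Prod.fst hxy) i)
      · exact haff _ (hb.bra i) (congrFun (congrArg Prod.snd hxy) i)
    obtain _ | k := k
    · exact i.elim0
    -- The identity with its column `i` replaced by `v`: it sends the `i`-th unit vector to `v` and
    -- has determinant `v i`.
    set M : Matrix (Fin (k + 1)) (Fin (k + 1)) (ZMod 2) := Matrix.updateCol 1 i v with hM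
    have hdet : M.det ≠ 0 := by
      rw [hM, ← Matrix.cramer_apply, Matrix.cramer_one]
      exact hi
    have hMi : M.mulVec (Pi.single i 1) = v := by
      rw [Matrix.mulVec_single_one]
      funext x
      simp [hM, Matrix.col]
    have h1 := (sim_linear M hdet b s).comp (sim_alpha _ s (Equiv.swap 0 i))
    have hc : ((b.subst (linear M)).subst fun j => X (Equiv.swap 0 i j)).IsClif :=
      (hb.subst (linear_mem_affinePolys M)).subst fun _ => X_mem_affinePolys _
    have hint : ((b.subst (linear M)).subst fun j => X (Equiv.swap 0 i j)).point (Fin.cons 0 0) =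
        ((b.subst (linear M)).subst fun j => X (Equiv.swap 0 i j)).point (Fin.cons 1 0) := by
      simp only [point_subst, eval_linear, eval_X]
      have hz : (fun j => (Fin.cons 0 0 : Fin (k + 1) → ZMod 2) (Equiv.swap 0 i j)) = 0 := by
        funext j
        rcases Fin.eq_zero_or_eq_succ (Equiv.swap 0 i j) with h | ⟨y, h⟩ <;> rw [h] <;> simp
      have hz' : (fun j => (Fin.cons 1 0 : Fin (k + 1) → ZMod 2) (Equiv.swap 0 i j)) =
          Pi.single i 1 := by
        funext j
        rw [Pi.single_apply]
        split_ifs with h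
        · rw [h, Equiv.swap_apply_right, Fin.cons_zero]
        · obtain ⟨y, hy⟩ := Fin.exists_succ_eq.2 (show Equiv.swap 0 i j ≠ 0 from
            fun h' => h ((Equiv.swap 0 i).injective (h'.trans (Equiv.swap_apply_right 0 i).symm)))
          rw [← hy, Fin.cons_succ, Pi.zero_apply]
      change b.point (M.mulVec _) = b.point (M.mulVec _)
      rw [hz, hz', hMi, Matrix.mulVec_zero, hpt]
    rcases exists_sim_of_internal hc hs hint with h2 | ⟨l, b', s', hl, hb', hs', h2⟩
    · exact .inl (h1.comp h2)
    · rcases ih l (Nat.lt_succ_of_le hl) hb' hs' with h3 | ⟨l', b'', s'', hb'', hs'', hinj', h3⟩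
      · exact .inl ((h1.comp h2).comp h3)
      · exact .inr ⟨l', b'', s'', hb'', hs'', hinj', (h1.comp h2).comp h3⟩

theorem interp_toSOP (b : SOPBody n m k) (s : ℝ) (v : (Fin m → ZMod 2) × (Fin n → ZMod 2)) :
    (b.toSOP s).interp v =
      s * ∑ y : Fin k → ZMod 2, SOP.kron (b.point y) v * phaseExp (b.phase.value y) := rfl

theorem interp_vanishing : (vanishing n m).interp = 0 := by
  funext v
  change ((⟨PhasePoly.mk (C (1 / 2) * X 0), 0, 0⟩ : SOPBody n m 1).toSOP 1).interp v = 0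
  rw [interp_toSOP, sum_cons]
  simp [point, PhasePoly.value_mk, bit_zero, bit_one, phaseExp_zero, -one_div, phaseExp_half]

theorem interp_point {b : SOPBody n m k} (hb : Function.Injective b.point) (s : ℝ)
    (y : Fin k → ZMod 2) :
    (b.toSOP s).interp (b.point y) = s * phaseExp (b.phase.value y) := by
  rw [interp_toSOP]
  congr 1
  rw [Finset.sum_eq_single y]
  · rw [SOP.kron, if_pos rfl, one_mul]
  · intro z _ hz
    rw [SOP.kron, if_neg fun h => hz (hb h), zero_mul]
  · intro h
    exact absurd (Finset.mem_univ y) h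

theorem exists_point_eq {b : SOPBody n m k} {s : ℝ} {v : (Fin m → ZMod 2) × (Fin n → ZMod 2)}
    (h : (b.toSOP s).interp v ≠ 0) : ∃ y, b.point y = v := by
  by_contra! hne
  refine h ?_
  rw [interp_toSOP, Finset.sum_eq_zero, mul_zero]
  intro y _
  rw [SOP.kron, if_neg (hne y), zero_mul]

theorem interp_point_ne_zero {b : SOPBody n m k} (hb : Function.Injective b.point) {s : ℝ}
    (hs : 0 < s) (y : Fin k → ZMod 2) : (b.toSOP s).interp (b.point y) ≠ 0 := by
  rw [interp_point hb]
  exact mul_ne_zero (by exact_mod_cast hs.ne') (phaseExp_ne_zero _)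

/-- With at most one path for each basis element, the nonzero entries of the matrix are the single
terms `s` times a phase. Equal matrices therefore match the paths by a bijection `T` that preserves
phases, and norms of entries give `s = s'`. As both maps from paths to basis elements are affine and
injective, `T` is affine, so it is realized by a change of variables. -/
theorem sim_of_faithful {b : SOPBody n m k} {b' : SOPBody n m l} (hb : b.IsClif) (hb' : b'.IsClif)
    {s s' : ℝ} (hs : 0 < s) (hs' : 0 < s') (hi : Function.Injective b.point)
    (hi' : Function.Injective b'.point) (h : (b.toSOP s).interp = (b'.toSOP s').interp) :
    Sim (b.toSOP s) (b'.toSOP s') := by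
  choose T hT using fun y => exists_point_eq (b := b') (s := s') (v := b.point y)
    (by rw [← h]; exact interp_point_ne_zero hi hs y)
  choose T' hT' using fun y => exists_point_eq (b := b) (s := s) (v := b'.point y)
    (by rw [h]; exact interp_point_ne_zero hi' hs' y)
  -- A bijection between the sets of paths gives 2^k = 2^l.
  have hcard : k = l := by
    have hbij : Function.Bijective T := by
      refine ⟨fun x y hxy => hi ?_, fun y => ⟨T' y, hi' ?_⟩⟩
      · rw [← hT, ← hT, hxy]
      · rw [hT, hT']
    have := Fintype.card_of_bijective hbij
    simp only [Fintype.card_fun, ZMod.card, Fintype.card_fin] at this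
    exact Nat.pow_right_injective le_rfl this
  subst hcard
  have hval : ∀ y, (s : ℂ) * phaseExp (b.phase.value y) =
      s' * phaseExp (b'.phase.value (T y)) := by
    intro y
    rw [← interp_point hi, ← interp_point hi', hT, h]
  have hss : s = s' := by
    have := congrArg norm (hval 0)
    rw [norm_mul, norm_mul, norm_phaseExp, norm_phaseExp, mul_one, mul_one, Complex.norm_real,
      Complex.norm_real, Real.norm_of_nonneg hs.le, Real.norm_of_nonneg hs'.le] at this
    exact this
  subst hss
  have hphase : ∀ y, b.phase.value y = b'.phase.value (T y) := fun y =>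
    phaseExp_injective (mul_left_cancel₀ (by exact_mod_cast hs.ne') (hval y))
  -- In characteristic 2 adding `T 0` is subtracting it, so this is additivity of the linear part of
  -- `T`; it is tested on the coordinates of the injective map `b'.point`.
  have hadd : ∀ x y, T (x + y) + T 0 = (T x + T 0) + (T y + T 0) := by
    intro x y
    refine hi' ?_
    have key : ∀ (Q Q' : BoolPoly k), Q ∈ affinePolys k → Q' ∈ affinePolys k →
        (∀ y, eval (T y) Q' = eval y Q) →
        eval (T (x + y) + T 0) Q' = eval (T x + T 0 + (T y + T 0)) Q' := by
      intro Q Q' hQ hQ' hQQ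
      simp only [eval_add_affine hQ', hQQ, eval_add_affine hQ x y]
      linear_combination - zmod_two_add_self (eval 0 Q')
    refine Prod.ext (funext fun i => ?_) (funext fun i => ?_)
    · exact key (b.ket i) (b'.ket i) (hb.ket i) (hb'.ket i)
        fun y => congrFun (congrArg Prod.fst (hT y)) i
    · exact key (b.bra i) (b'.bra i) (hb.bra i) (hb'.bra i)
        fun y => congrFun (congrArg Prod.snd (hT y)) i
  have h00 : T 0 + T 0 = 0 := funext fun i => zmod_two_add_self _
  let L : (Fin k → ZMod 2) →ₗ[ZMod 2] (Fin k → ZMod 2) :=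
    AddMonoidHom.toZModLinearMap 2 ⟨⟨fun y => T y + T 0, h00⟩, hadd⟩
  have hL : ∀ y, L y = T y + T 0 := fun y => rfl
  have hLinj : Function.Injective L := by
    intro x y hxy
    rw [hL, hL, add_left_inj] at hxy
    exact hi (by rw [← hT, ← hT, hxy])
  have hdet : (LinearMap.toMatrix' L).det ≠ 0 := by
    rw [LinearMap.det_toMatrix']
    exact (LinearMap.isUnit_iff_isUnit_det L).1
      ((Module.End.isUnit_iff L).2 ⟨hLinj, LinearMap.injective_iff_surjective.1 hLinj⟩) |>.ne_zero
  have hsim := (sim_translate b' s (T 0)).comp (sim_linear _ hdet _ s)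
  refine Sim.inv ?_
  convert hsim using 2
  have hev : ∀ y, (fun i => eval (fun j => eval y (linear (LinearMap.toMatrix' L) j))
      (X i + C (T 0 i) : BoolPoly k)) = T y := by
    intro y
    funext i
    simp only [eval_linear, map_add, eval_X, eval_C]
    rw [LinearMap.toMatrix'_mulVec, hL, Pi.add_apply, add_assoc, zmod_two_add_self, add_zero]
  have hmem : ∀ i, BoolPoly.subst (linear (LinearMap.toMatrix' L)) (X i + C (T 0 i)) ∈
      affinePolys k := fun i => subst_mem_affinePolys (linear_mem_affinePolys _)
        (add_mem (X_mem_affinePolys i) (C_mem_affinePolys _))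
  rw [subst_subst]
  obtain ⟨P, O, I⟩ := b
  simp only [subst, mk.injEq]
  refine ⟨PhasePoly.ext_value fun y => ?_, funext fun i => ?_, funext fun i => ?_⟩
  · rw [hphase, PhasePoly.value_subst]
    simp only [BoolPoly.eval_subst, hev]
  · refine affinePolys_ext (hb.ket i) (subst_mem_affinePolys hmem (hb'.ket i)) fun y => ?_
    rw [BoolPoly.eval_subst]
    simp only [BoolPoly.eval_subst, hev]
    exact (congrFun (congrArg Prod.fst (hT y)) i).symm
  · refine affinePolys_ext (hb.bra i) (subst_mem_affinePolys hmem (hb'.bra i)) fun y => ?_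
    rw [BoolPoly.eval_subst]
    simp only [BoolPoly.eval_subst, hev]
    exact (congrFun (congrArg Prod.snd (hT y)) i).symm

/-- A vanishing normal form cannot match a faithful one, since the latter has a nonzero entry at the
image of the path 0; two vanishing ones are literally the same morphism, whatever the scalars were.
-/
theorem sim_of_interp_eq {b : SOPBody n m k} {b' : SOPBody n m l} (hb : b.IsClif) (hb' : b'.IsClif)
    {s s' : ℝ} (hs : 0 < s) (hs' : 0 < s') (h : (b.toSOP s).interp = (b'.toSOP s').interp) :
    Sim (b.toSOP s) (b'.toSOP s') := by
  have hsound : ∀ {f g : SOP n m}, Sim f g → f.interp = g.interp := fun h =>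
    SOP.interp_eq_of_clifPlus h
  rcases exists_sim_faithful k hb hs with h1 | ⟨_, b₁, s₁, hb₁, hs₁, hi₁, h1⟩ <;>
    rcases exists_sim_faithful l hb' hs' with h2 | ⟨_, b₂, s₂, hb₂, hs₂, hi₂, h2⟩
  · exact h1.comp h2.inv
  · refine absurd ?_ (interp_point_ne_zero hi₂ hs₂ 0)
    rw [← hsound h2, ← h, hsound h1, interp_vanishing, Pi.zero_apply]
  · refine absurd ?_ (interp_point_ne_zero hi₁ hs₁ 0)
    rw [← hsound h1, h, hsound h2, interp_vanishing, Pi.zero_apply]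
  · refine (h1.comp (sim_of_faithful hb₁ hb₂ hs₁ hs₂ hi₁ hi₂ ?_)).comp h2.inv
    rw [← hsound h1, h, hsound h2]

end SOPBody

/-! ### Expressions -/

namespace ClifExpr

variable {n m : ℕ}

/-- The morphism that an expression denotes, without its scalar. -/
def body (t : ClifExpr n m) : SOPBody n m t.numVars :=
  ⟨t.toSOP.phase, t.toSOP.ket, t.toSOP.bra⟩

theorem factor_mem_affinePolys {k : ℕ} (a : Option (Fin k)) :
    factor (ZMod 2) a ∈ affinePolys k := by
  cases a
  · exact one_mem_affinePolys k
  · exact X_mem_affinePolys _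

theorem linear_mem_affinePolys {k : ℕ} (l : List (Option (Fin k))) : linear l ∈ affinePolys k := by
  refine list_sum_mem fun x hx => ?_
  obtain ⟨a, _, rfl⟩ := List.mem_map.1 hx
  exact factor_mem_affinePolys a

theorem eval_map_factor {k : ℕ} (a : Option (Fin k)) (y : Fin k → ZMod 2) :
    eval (fun i => bit (y i)) (MvPolynomial.map (Int.castRingHom ℝ) (factor ℤ a)) =
      bit (eval y (factor (ZMod 2) a)) := by
  cases a <;> simp [factor, bit_one]

theorem mk_add {k : ℕ} (P Q : MvPolynomial (Fin k) ℝ) :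
    PhasePoly.mk (P + Q) = PhasePoly.mk P + PhasePoly.mk Q := rfl

theorem mk_list_mem {k : ℕ} {ι : Type} (H : AddSubgroup (PhasePoly k)) (r : ℝ) (l : List ι)
    (f : ι → MvPolynomial (Fin k) ℤ)
    (h : ∀ x, PhasePoly.mk (C r * MvPolynomial.map (Int.castRingHom ℝ) (f x)) ∈ H) :
    PhasePoly.mk (C r * MvPolynomial.map (Int.castRingHom ℝ) (l.map f).sum) ∈ H := by
  induction l with
  | nil =>
    rw [List.map_nil, List.sum_nil, map_zero, mul_zero]
    exact zero_mem H
  | cons x l ih =>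
    rw [List.map_cons, List.sum_cons, map_add, mul_add, mk_add]
    exact add_mem (h x) ih

theorem isClif_body (t : ClifExpr n m) : t.body.IsClif := by
  refine ⟨?_, fun i => linear_mem_affinePolys _, fun i => linear_mem_affinePolys _⟩
  change PhasePoly.mk (clifPhase t.P₀ t.poly₁ t.poly₂) ∈ clifPhases t.numVars
  rw [clifPhase, mk_add, mk_add]
  refine add_mem (add_mem ?_ (mk_list_mem _ _ _ _ fun x => ?_)) (mk_list_mem _ _ _ _ fun x => ?_)
  · convert zsmul_mem (eighth_mem_clifPhases t.numVars) t.P₀ using 1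
    refine PhasePoly.ext_value fun y => ?_
    rw [map_zsmul, PhasePoly.value_mk, PhasePoly.value_mk, ← AddCircle.coe_zsmul, map_mul, eval_C,
      eval_C, zsmul_eq_mul, mul_comm]
  · convert zsmul_mem (quarter_mem_clifPhases (factor_mem_affinePolys x.2)) x.1 using 1
    refine PhasePoly.ext_value fun y => ?_
    rw [map_zsmul, PhasePoly.value_mk, value_quarter, ← AddCircle.coe_zsmul, zsmul_eq_mul]
    simp only [map_mul, map_C, eval_C, eval_map_factor]
    congr 1
    simp
    ring
  -- The product term is recovered from ab/2 = a/4 + b/4 - (a ⊕ b)/4.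
  · have h1 := quarter_mem_clifPhases (factor_mem_affinePolys x.2.1)
    have h2 := quarter_mem_clifPhases (factor_mem_affinePolys x.2.2)
    have h3 := quarter_mem_clifPhases
      (add_mem (factor_mem_affinePolys x.2.1) (factor_mem_affinePolys x.2.2))
    convert zsmul_mem (sub_mem (add_mem h1 h2) h3) x.1 using 1
    refine PhasePoly.ext_value fun y => ?_
    rw [map_zsmul, map_sub, map_add, PhasePoly.value_mk, value_quarter, value_quarter,
      value_quarter, ← AddCircle.coe_add, ← AddCircle.coe_sub, ← AddCircle.coe_zsmul, zsmul_eq_mul]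
    simp only [map_mul, map_C, eval_C, eval_map_factor, map_add, bit_add]
    congr 1
    simp
    ring

end ClifExpr

/-- Soundness and completeness combined. Completeness needs positive scalars, and powers of `1 / √2`
are positive. -/
theorem ClifPair.equal_iff (x : ClifPair) :
    x.Equal ↔ x.left.toSOP.interp = x.right.toSOP.interp := by
  have hiff : x.Equal ↔ SOPBody.Sim x.left.toSOP x.right.toSOP := Quotient.eq
  rw [hiff]
  refine ⟨fun h => SOP.interp_eq_of_clifPlus h, fun h => ?_⟩
  exact SOPBody.sim_of_interp_eq x.left.isClif_body x.right.isClif_body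
    (s := (1 / √2) ^ x.left.p) (s' := (1 / √2) ^ x.right.p) (by positivity) (by positivity) h

/-! ### Averages of exponentials of quadratic forms -/

/-- The powers of `e^{i π / 4}`. -/
def eighthRoot (z : ℤ) : ℂ := phaseExp ((z / 8 : ℝ) : UnitAddCircle)

theorem eighthRoot_add (a b : ℤ) : eighthRoot (a + b) = eighthRoot a * eighthRoot b := by
  rw [eighthRoot, eighthRoot, eighthRoot, ← phaseExp_add, ← AddCircle.coe_add]
  push_cast
  rw [add_div]

theorem eighthRoot_eq_iff (a b : ℤ) : eighthRoot a = eighthRoot b ↔ (8 : ℤ) ∣ a - b := by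
  rw [eighthRoot, eighthRoot, phaseExp_injective.eq_iff, ← sub_eq_zero, ← AddCircle.coe_sub,
    AddCircle.coe_eq_zero_iff]
  constructor
  · rintro ⟨z, hz⟩
    refine ⟨z, ?_⟩
    rw [zsmul_one] at hz
    have : (a - b : ℝ) = 8 * z := by rw [hz]; ring
    exact_mod_cast this
  · rintro ⟨z, hz⟩
    refine ⟨z, ?_⟩
    have : (a - b : ℝ) = 8 * z := by exact_mod_cast hz
    rw [zsmul_one, ← sub_div, this]
    ring

theorem eighthRoot_congr {a b : ℤ} (c : ℤ) (h : a = b + 8 * c) : eighthRoot a = eighthRoot b :=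
  (eighthRoot_eq_iff a b).2 ⟨c, by rw [h]; ring⟩

theorem eighthRoot_zero : eighthRoot 0 = 1 := by simp [eighthRoot, phaseExp_zero]

theorem eighthRoot_one : eighthRoot 1 = √2 / 2 + √2 / 2 * Complex.I := by
  rw [eighthRoot, Int.cast_one, phaseExp_eighth]

theorem eighthRoot_two : eighthRoot 2 = Complex.I := by
  rw [eighthRoot, ← phaseExp_quarter]
  norm_num

theorem eighthRoot_four : eighthRoot 4 = -1 := by
  rw [eighthRoot, ← phaseExp_half]
  norm_num

theorem eighthRoot_ne_zero (a : ℤ) : eighthRoot a ≠ 0 := phaseExp_ne_zero _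

theorem norm_eighthRoot (a : ℤ) : ‖eighthRoot a‖ = 1 := norm_phaseExp _

theorem sqrt_two_ne_zero_complex : (√2 : ℂ) ≠ 0 := by
  intro h
  have := sqrt_two_sq_complex
  rw [h] at this
  norm_num at this

theorem eighthRoot_two_mul_of_even {u : ℤ} (hu : Even u) : eighthRoot (4 * u) = 1 := by
  obtain ⟨v, rfl⟩ := hu
  rw [← eighthRoot_zero]
  exact eighthRoot_congr v (by ring)

theorem eighthRoot_two_mul_of_odd {u : ℤ} (hu : ¬ Even u) : eighthRoot (4 * u) = -1 := by
  obtain ⟨v, rfl⟩ := Int.not_even_iff_odd.1 hu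
  rw [← eighthRoot_four]
  exact eighthRoot_congr v (by ring)

/-- The Gauss sum over one variable with an odd coefficient. -/
theorem one_add_eighthRoot_div_two {c : ℤ} (hc : c = 1 ∨ c = -1) (u : ℤ) :
    (1 + eighthRoot (2 * (c + 2 * u))) / 2 =
      (√2 : ℂ)⁻¹ * (eighthRoot c * eighthRoot (2 * (-c * u ^ 2))) := by
  have h1 := eighthRoot_one
  have h2 := eighthRoot_two
  have hs := sqrt_two_sq_complex
  have hn := sqrt_two_ne_zero_complex
  have hI := Complex.I_mul_I
  have hm1 : eighthRoot (-1) = √2 / 2 - √2 / 2 * Complex.I := by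
    have h3 : eighthRoot (-1) * eighthRoot 2 = eighthRoot 1 := by rw [← eighthRoot_add]; rfl
    rw [h1, h2] at h3
    linear_combination (-Complex.I) * h3 + eighthRoot (-1) * hI - √2 / 2 * hI
  have hm2 : eighthRoot (-2) = -Complex.I := by
    have h3 : eighthRoot (-2) * eighthRoot 2 = eighthRoot 0 := by rw [← eighthRoot_add]; rfl
    rw [eighthRoot_zero, h2] at h3
    linear_combination (-Complex.I) * h3 + eighthRoot (-2) * hI
  obtain ⟨v, rfl | rfl⟩ := Int.even_or_odd' u
  · rw [eighthRoot_congr (b := 2 * c) v (by ring),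
      eighthRoot_congr (a := 2 * (-c * (2 * v) ^ 2)) (b := 0) (-c * v ^ 2) (by ring),
      eighthRoot_zero]
    rcases hc with rfl | rfl
    · rw [mul_one, h2, h1]
      field_simp
    · rw [show (2 * -1 : ℤ) = -2 by rfl, hm2, hm1]
      field_simp
      ring
  · rw [eighthRoot_congr (b := 4 + 2 * c) v (by ring),
      eighthRoot_congr (a := 2 * (-c * (2 * v + 1) ^ 2)) (b := 2 * -c) (-c * (v ^ 2 + v)) (by ring),
      eighthRoot_add, eighthRoot_four, ← eighthRoot_add]
    rcases hc with rfl | rfl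
    · rw [mul_one, h2, show (1 + 2 * -1 : ℤ) = -1 by rfl, hm1]
      field_simp
      ring
    · rw [show (2 * -1 : ℤ) = -2 by rfl, hm2, show (-1 + 2 * - -1 : ℤ) = 1 by rfl, h1]
      field_simp

/-- The integer vector of an assignment of bits, with the entry `1` at the index `0`. -/
def liftBits {W : ℕ} (x : Fin W → ZMod 2) (i : ℕ) : ℤ :=
  if i = 0 then 1 else if h : i < W then ((x ⟨i, h⟩).val : ℤ) else 0

theorem liftBits_zero {W : ℕ} (x : Fin W → ZMod 2) : liftBits x 0 = 1 := if_pos rfl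

theorem liftBits_of_lt {W : ℕ} (x : Fin W → ZMod 2) {i : ℕ} (h0 : i ≠ 0) (h : i < W) :
    liftBits x i = (x ⟨i, h⟩).val := by
  rw [liftBits, if_neg h0, dif_pos h]

theorem liftBits_eq {W : ℕ} (x : Fin W → ZMod 2) (i : ℕ) : liftBits x i = 0 ∨ liftBits x i = 1 := by
  rw [liftBits]
  split_ifs with h h'
  · exact .inr rfl
  · rcases zmod_two_cases (x ⟨i, h'⟩) with h2 | h2 <;> rw [h2]
    · exact .inl rfl
    · exact .inr rfl
  · exact .inl rfl

theorem liftBits_update {W : ℕ} (x : Fin W → ZMod 2) {j : ℕ} (h0 : j ≠ 0) (h : j < W)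
    (a : ZMod 2) :
    liftBits (Function.update x ⟨j, h⟩ a) = Function.update (liftBits x) j (a.val : ℤ) := by
  funext i
  by_cases hi : i = j
  · subst hi
    rw [liftBits_of_lt _ h0 h, Function.update_self, Function.update_self]
  · rw [Function.update_of_ne hi, liftBits, liftBits]
    split_ifs with h1 h2
    · rfl
    · rw [Function.update_of_ne]
      intro h3
      exact hi (congrArg Fin.val h3)
    · rfl

/-- The average of a function over all assignments of bits. -/
def average (W : ℕ) (F : (ℕ → ℤ) → ℂ) : ℂ := (∑ x : Fin W → ZMod 2, F (liftBits x)) / 2 ^ W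

theorem average_congr {W : ℕ} {F G : (ℕ → ℤ) → ℂ}
    (h : ∀ x : Fin W → ZMod 2, F (liftBits x) = G (liftBits x)) : average W F = average W G := by
  rw [average, average, Finset.sum_congr rfl fun x _ => h x]

theorem average_mul_left (W : ℕ) (c : ℂ) (F : (ℕ → ℤ) → ℂ) :
    average W (fun x => c * F x) = c * average W F := by
  rw [average, average, ← Finset.mul_sum, mul_div_assoc]

/-- Adding the unit vector at `j` permutes the assignments; each one is paired with its image, and
the two members of a pair are the updates of `x` at `j` by 0 and by 1. -/
theorem sum_update_eq {J : Type*} [Fintype J] [DecidableEq J] (G : (J → ZMod 2) → ℂ) (j : J) :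
    ∑ x, G x = ∑ x, (G (Function.update x j 0) + G (Function.update x j 1)) / 2 := by
  have h : ∑ x, G x = ∑ x : J → ZMod 2, G (x + Pi.single j 1) :=
    (Equiv.sum_comp (Equiv.addRight (Pi.single j (1 : ZMod 2) : J → ZMod 2)) G).symm
  have h2 : ∀ x : J → ZMod 2, G x + G (x + Pi.single j 1) =
      G (Function.update x j 0) + G (Function.update x j 1) := by
    intro x
    have hx1 : x + Pi.single j 1 = Function.update x j (x j + 1) := by
      funext i
      by_cases hi : i = j
      · subst hi; simp
      · simp [hi]
    have hx : x = Function.update x j (x j) := (Function.update_eq_self j x).symm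
    rw [hx1]
    rcases zmod_two_cases (x j) with h0 | h0
    · rw [h0] at hx ⊢
      rw [zero_add, ← hx]
    · rw [h0] at hx ⊢
      rw [show (1 : ZMod 2) + 1 = 0 from rfl, ← hx, add_comm]
  calc ∑ x, G x = (∑ x, G x + ∑ x : J → ZMod 2, G (x + Pi.single j 1)) / 2 := by rw [← h]; ring
    _ = _ := by
      rw [← Finset.sum_add_distrib, Finset.sum_div]
      exact Finset.sum_congr rfl fun x _ => by rw [h2]

theorem average_split {W j : ℕ} (h0 : j ≠ 0) (h : j < W) (F : (ℕ → ℤ) → ℂ) :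
    average W F =
      average W fun x => (F (Function.update x j 0) + F (Function.update x j 1)) / 2 := by
  rw [average, average, sum_update_eq _ ⟨j, h⟩]
  simp only [liftBits_update _ h0 h]
  rfl

/-- The value at `x` of the quadratic form with matrix `B` on the indices below `j`. -/
def quadForm (j : ℕ) (B : ℕ → ℕ → ℤ) (x : ℕ → ℤ) : ℤ :=
  ∑ i ∈ Finset.range j, ∑ k ∈ Finset.range j, B i k * (x i * x k)

/-- The value at `x` of a linear form on the indices below `j`. -/
def linForm (j : ℕ) (b : ℕ → ℤ) (x : ℕ → ℤ) : ℤ := ∑ k ∈ Finset.range j, b k * x k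

/-- The average of `i ^ q` for a quadratic form `q`. -/
def gauss (W j : ℕ) (B : ℕ → ℕ → ℤ) : ℂ := average W fun x => eighthRoot (2 * quadForm j B x)

/-- The matrix `B + b vᵀ + v bᵀ + e b bᵀ`. -/
def rankUpdate (B : ℕ → ℕ → ℤ) (b v : ℕ → ℤ) (e : ℤ) (i k : ℕ) : ℤ :=
  B i k + b i * v k + b k * v i + b i * b k * e

theorem quadForm_rankUpdate (j : ℕ) (B : ℕ → ℕ → ℤ) (b v : ℕ → ℤ) (e : ℤ) (x : ℕ → ℤ) :
    quadForm j (rankUpdate B b v e) x =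
      quadForm j B x + 2 * (linForm j b x * linForm j v x) + e * linForm j b x ^ 2 := by
  have h1 : linForm j b x * linForm j v x =
      ∑ i ∈ Finset.range j, ∑ k ∈ Finset.range j, b i * v k * (x i * x k) := by
    rw [linForm, linForm, Finset.sum_mul_sum]
    exact Finset.sum_congr rfl fun i _ => Finset.sum_congr rfl fun k _ => by ring
  have h2 : linForm j b x * linForm j v x =
      ∑ i ∈ Finset.range j, ∑ k ∈ Finset.range j, b k * v i * (x i * x k) := by
    rw [mul_comm, linForm, linForm, Finset.sum_mul_sum]
    exact Finset.sum_congr rfl fun i _ => Finset.sum_congr rfl fun k _ => by ring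
  have h3 : e * linForm j b x ^ 2 =
      ∑ i ∈ Finset.range j, ∑ k ∈ Finset.range j, b i * b k * e * (x i * x k) := by
    rw [sq, linForm, Finset.sum_mul_sum, Finset.mul_sum]
    refine Finset.sum_congr rfl fun i _ => ?_
    rw [Finset.mul_sum]
    exact Finset.sum_congr rfl fun k _ => by ring
  rw [two_mul, ← add_assoc, h3]
  nth_rewrite 2 [h2]
  rw [h1, quadForm, quadForm, ← Finset.sum_add_distrib, ← Finset.sum_add_distrib,
    ← Finset.sum_add_distrib]
  refine Finset.sum_congr rfl fun i _ => ?_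
  rw [← Finset.sum_add_distrib, ← Finset.sum_add_distrib, ← Finset.sum_add_distrib]
  exact Finset.sum_congr rfl fun k _ => by rw [rankUpdate]; ring

theorem rankUpdate_symm {B : ℕ → ℕ → ℤ} (hB : ∀ i k, B i k = B k i) (b v : ℕ → ℤ) (e : ℤ)
    (i k : ℕ) : rankUpdate B b v e i k = rankUpdate B b v e k i := by
  rw [rankUpdate, rankUpdate, hB i k]; ring

theorem quadForm_succ {B : ℕ → ℕ → ℤ} (hB : ∀ i k, B i k = B k i) (j : ℕ) (x : ℕ → ℤ) :
    quadForm (j + 1) B x = quadForm j B x + 2 * (x j * linForm j (B j) x) + B j j * x j ^ 2 := by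
  have h1 : ∑ i ∈ Finset.range j, B i j * (x i * x j) = x j * linForm j (B j) x := by
    rw [linForm, Finset.mul_sum]
    exact Finset.sum_congr rfl fun i _ => by rw [hB i j]; ring
  have h2 : ∑ i ∈ Finset.range j, B j i * (x j * x i) = x j * linForm j (B j) x := by
    rw [linForm, Finset.mul_sum]
    exact Finset.sum_congr rfl fun i _ => by ring
  rw [quadForm, Finset.sum_range_succ, Finset.sum_range_succ, h2]
  simp only [Finset.sum_range_succ, Finset.sum_add_distrib]
  rw [h1, quadForm]
  ring

theorem linForm_update {j l : ℕ} (hl : l < j) (b x : ℕ → ℤ) (t : ℤ) :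
    linForm j b (Function.update x l t) = linForm j b x + b l * (t - x l) := by
  have hmem := Finset.mem_range.2 hl
  rw [linForm, linForm, ← Finset.add_sum_erase _ _ hmem, ← Finset.add_sum_erase _ _ hmem,
    Function.update_self, Finset.sum_congr rfl fun i hi =>
      by rw [Function.update_of_ne (Finset.ne_of_mem_erase hi)]]
  ring

theorem quadForm_update {B : ℕ → ℕ → ℤ} (hB : ∀ i k, B i k = B k i) {j l : ℕ} (hl : l < j)
    (x : ℕ → ℤ) (t : ℤ) :
    quadForm j B (Function.update x l t) =
      quadForm j B x + 2 * ((t - x l) * linForm j (B l) x) + B l l * (t - x l) ^ 2 := by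
  have hmem := Finset.mem_range.2 hl
  have h1 : ∀ y : ℕ → ℤ, quadForm j B y = ∑ i ∈ Finset.range j, linForm j (B i) y * y i := by
    intro y
    refine Finset.sum_congr rfl fun i _ => ?_
    rw [linForm, Finset.sum_mul]
    exact Finset.sum_congr rfl fun k _ => by ring
  have h2 : linForm j (B l) x = ∑ i ∈ Finset.range j, B i l * x i :=
    Finset.sum_congr rfl fun i _ => by rw [hB l i]
  rw [h1, h1]
  simp only [linForm_update hl]
  have h3 : ∀ y : ℕ → ℤ, ∑ i ∈ Finset.range j, y i * Function.update x l t i =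
      ∑ i ∈ Finset.range j, y i * x i + y l * (t - x l) := fun y => linForm_update hl y x t
  rw [h3 (fun i => linForm j (B i) x + B i l * (t - x l))]
  simp only [add_mul, Finset.sum_add_distrib]
  have h4 : ∑ i ∈ Finset.range j, B i l * (t - x l) * x i = (t - x l) * linForm j (B l) x := by
    rw [h2, Finset.mul_sum]
    exact Finset.sum_congr rfl fun i _ => by ring
  rw [h4]
  ring

theorem linForm_congr_two {j : ℕ} {b b' : ℕ → ℤ} (h : ∀ k < j, (2 : ℤ) ∣ b k - b' k) (x : ℕ → ℤ) :
    (2 : ℤ) ∣ linForm j b x - linForm j b' x := by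
  rw [linForm, linForm, ← Finset.sum_sub_distrib]
  refine Finset.dvd_sum fun k hk => ?_
  rw [← sub_mul]
  exact (h k (Finset.mem_range.1 hk)).mul_right _

/-! ### Averaging out the last variable of a quadratic form -/

section Elimination

variable {W j : ℕ} {B : ℕ → ℕ → ℤ} {b : ℕ → ℤ}

/-- The form splits as q + 2 x_j ℓ + B_jj x_j², where q and ℓ do not involve x_j, so only the last
factor has to be averaged over the two values of x_j. Being an average, `gauss` keeps the number `W`
of bits: those no longer used do not count. -/
theorem gauss_succ (hB : ∀ i k, B i k = B k i) (h0 : j ≠ 0) (hj : j < W) :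
    gauss W (j + 1) B = average W fun x => eighthRoot (2 * quadForm j B x) *
      ((1 + eighthRoot (2 * (B j j + 2 * linForm j (B j) x))) / 2) := by
  rw [gauss, average_split h0 hj]
  refine average_congr fun x => ?_
  have hq : ∀ t, quadForm j B (Function.update (liftBits x) j t) = quadForm j B (liftBits x) := by
    intro t
    refine Finset.sum_congr rfl fun i hi => Finset.sum_congr rfl fun k hk => ?_
    rw [Function.update_of_ne (Finset.mem_range.1 hi).ne,
      Function.update_of_ne (Finset.mem_range.1 hk).ne]
  have hl : ∀ t, linForm j (B j) (Function.update (liftBits x) j t) =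
      linForm j (B j) (liftBits x) := by
    intro t
    refine Finset.sum_congr rfl fun i hi => ?_
    rw [Function.update_of_ne (Finset.mem_range.1 hi).ne]
  rw [quadForm_succ hB, quadForm_succ hB, hq, hq, hl, hl, Function.update_self,
    Function.update_self]
  rw [show 2 * (quadForm j B (liftBits x) + 2 * (0 * linForm j (B j) (liftBits x)) +
      B j j * 0 ^ 2) = 2 * quadForm j B (liftBits x) by ring,
    show 2 * (quadForm j B (liftBits x) + 2 * (1 * linForm j (B j) (liftBits x)) +
      B j j * 1 ^ 2) = 2 * quadForm j B (liftBits x) +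
        2 * (B j j + 2 * linForm j (B j) (liftBits x)) by ring, eighthRoot_add]
  ring

/-- The one-variable Gauss sum equals (√2)⁻¹ e^{iπc/4} i^{-cu²} with u the linear form of the row,
and -cu² is again quadratic. Modulo 4 the square of u depends on the parity of u only, so the row
may be replaced by bits. -/
theorem gauss_odd (hB : ∀ i k, B i k = B k i) (h0 : j ≠ 0) (hj : j < W) {c : ℤ}
    (hc : c = 1 ∨ c = -1) (hBj : (4 : ℤ) ∣ B j j - c) (hb : ∀ k < j, (2 : ℤ) ∣ B j k - b k) :
    gauss W (j + 1) B =
      (√2 : ℂ)⁻¹ * eighthRoot c * gauss W j (rankUpdate B b (fun _ => 0) (-c)) := by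
  rw [gauss_succ hB h0 hj, gauss, ← average_mul_left]
  refine average_congr fun x => ?_
  obtain ⟨d, hd⟩ := hBj
  obtain ⟨u, hu⟩ := linForm_congr_two hb (liftBits x)
  rw [quadForm_rankUpdate, eighthRoot_congr (a := 2 * (B j j + 2 * linForm j (B j) (liftBits x)))
    (b := 2 * (c + 2 * linForm j b (liftBits x))) (d + u) (by linear_combination 2 * hd + 4 * hu),
    one_add_eighthRoot_div_two hc]
  have hz : linForm j (fun _ => 0) (liftBits x) = 0 := by simp [linForm]
  rw [hz, mul_zero, mul_zero, add_zero, mul_add, eighthRoot_add]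
  ring

/-- For a diagonal entry 2h the average over x_j is 1 if ℓ + h is even and 0 otherwise. The
coordinate of index 0 is constantly 1, so h is absorbed by the entry `b 0`. -/
theorem gauss_even (hB : ∀ i k, B i k = B k i) (h0 : j ≠ 0) (hj : j < W) {h : ℤ}
    (hBj : B j j = 2 * h) (hb0 : (2 : ℤ) ∣ B j 0 + h - b 0)
    (hb : ∀ k < j, k ≠ 0 → (2 : ℤ) ∣ B j k - b k) :
    gauss W (j + 1) B = average W fun x => eighthRoot (2 * quadForm j B x) *
      ((1 + eighthRoot (4 * linForm j b x)) / 2) := by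
  rw [gauss_succ hB h0 hj]
  refine average_congr fun x => ?_
  have hmem : 0 ∈ Finset.range j := Finset.mem_range.2 (Nat.pos_of_ne_zero h0)
  have hpar : (2 : ℤ) ∣ linForm j (B j) (liftBits x) + h - linForm j b (liftBits x) := by
    rw [linForm, linForm, ← Finset.add_sum_erase _ _ hmem, ← Finset.add_sum_erase _ _ hmem,
      liftBits_zero]
    have : (2 : ℤ) ∣ ∑ k ∈ (Finset.range j).erase 0, (B j k - b k) * liftBits x k :=
      Finset.dvd_sum fun k hk => (hb k (Finset.mem_range.1 (Finset.mem_of_mem_erase hk))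
        (Finset.ne_of_mem_erase hk)).mul_right _
    simp only [sub_mul, Finset.sum_sub_distrib] at this
    refine (dvd_add hb0 this).trans (dvd_of_eq ?_)
    ring
  obtain ⟨u, hu⟩ := hpar
  rw [hBj, eighthRoot_congr (a := 2 * (2 * h + 2 * linForm j (B j) (liftBits x))) 
    (b := 4 * linForm j b (liftBits x)) u (by linear_combination 4 * hu)]

/-- The condition that u = b·x be even contains x_l, so exactly one of the two values of x_l
satisfies it, namely x_l + u modulo 2. This accounts for the factor 1/2, and substituting it in the
form produces the update by the row `l`. -/
theorem gauss_pivot (hB : ∀ i k, B i k = B k i) (h0 : j ≠ 0) (hj : j < W) {h : ℤ}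
    (hBj : B j j = 2 * h) (hb0 : (2 : ℤ) ∣ B j 0 + h - b 0)
    (hb : ∀ k < j, k ≠ 0 → (2 : ℤ) ∣ B j k - b k) {l : ℕ} (hl0 : l ≠ 0) (hl : l < j)
    (hbl : b l = 1) :
    gauss W (j + 1) B =
      (√2 : ℂ)⁻¹ * (√2 : ℂ)⁻¹ * gauss W j (rankUpdate B b (B l) (B l l)) := by
  rw [gauss_even hB h0 hj hBj hb0 hb, average_split hl0 (hl.trans hj), gauss, ← average_mul_left]
  refine average_congr fun x => ?_
  have hhalf : (√2 : ℂ)⁻¹ * (√2 : ℂ)⁻¹ = 1 / 2 := by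
    rw [← mul_inv, sqrt_two_sq_complex]
    norm_num
  rw [hhalf]
  set y := liftBits x
  set u := linForm j b y with hu
  rw [quadForm_rankUpdate, linForm_update hl, linForm_update hl, hbl, ← hu]
  -- An admissible `t` satisfies t - y_l = u - 2d; the terms with d change the form by a multiple of
  -- 4, which i^q does not see.
  have hq : ∀ t, Even (y l + u - t) → eighthRoot (2 * quadForm j B (Function.update y l t)) =
      eighthRoot (2 * (quadForm j B y + 2 * (u * linForm j (B l) y) + B l l * u ^ 2)) := by
    rintro t ⟨d, hd⟩
    rw [quadForm_update hB hl]
    refine eighthRoot_congr (-(d * linForm j (B l) y) + B l l * (d ^ 2 - u * d)) ?_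
    have ht : t - y l = u - 2 * d := by linear_combination -hd
    rw [ht]
    ring
  have hyl := liftBits_eq x l
  change y l = 0 ∨ y l = 1 at hyl
  by_cases hev : Even (y l + u)
  · have h1 : Even (u + 1 * (0 - y l)) := by
      rw [Int.even_iff] at hev ⊢; omega
    have h2 : ¬ Even (u + 1 * (1 - y l)) := by
      rw [Int.even_iff] at hev ⊢; omega
    rw [eighthRoot_two_mul_of_even h1, eighthRoot_two_mul_of_odd h2, hq 0 (by rwa [sub_zero])]
    ring
  · have h1 : ¬ Even (u + 1 * (0 - y l)) := by
      rw [Int.even_iff] at hev ⊢; omega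
    have h2 : Even (u + 1 * (1 - y l)) := by
      rw [Int.even_iff] at hev ⊢; omega
    rw [eighthRoot_two_mul_of_even h2, eighthRoot_two_mul_of_odd h1,
      hq 1 (by rw [Int.even_iff] at hev ⊢; omega)]
    ring

/-- Here the parity condition involves no variable: it always holds or never does, according to the
constant `b 0`. -/
theorem gauss_free (hB : ∀ i k, B i k = B k i) (h0 : j ≠ 0) (hj : j < W) {h : ℤ}
    (hBj : B j j = 2 * h) (hb0 : (2 : ℤ) ∣ B j 0 + h - b 0)
    (hb : ∀ k < j, k ≠ 0 → (2 : ℤ) ∣ B j k - b k) (hz : ∀ k < j, k ≠ 0 → b k = 0) :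
    gauss W (j + 1) B = if Even (b 0) then gauss W j B else 0 := by
  rw [gauss_even hB h0 hj hBj hb0 hb]
  have hl : ∀ x : Fin W → ZMod 2, linForm j b (liftBits x) = b 0 := by
    intro x
    rw [linForm, Finset.sum_eq_single 0, liftBits_zero, mul_one]
    · intro k hk hk0
      rw [hz k (Finset.mem_range.1 hk) hk0, zero_mul]
    · intro h
      exact absurd (Finset.mem_range.2 (Nat.pos_of_ne_zero h0)) h
  split_ifs with hev
  · refine average_congr fun x => ?_
    rw [hl, eighthRoot_two_mul_of_even hev]
    ring
  · rw [← zero_mul (average W fun _ => 1), ← average_mul_left]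
    refine average_congr fun x => ?_
    rw [hl, eighthRoot_two_mul_of_odd hev]
    ring

theorem gauss_one (W : ℕ) (B : ℕ → ℕ → ℤ) : gauss W 1 B = eighthRoot (2 * B 0 0) := by
  have : gauss W 1 B = average W fun _ => eighthRoot (2 * B 0 0) * 1 := by
    refine average_congr fun x => ?_
    simp [quadForm, liftBits_zero]
  rw [this, average_mul_left, average]
  simp [ZMod.card]

end Elimination

/-! ### Inner products of Clifford morphisms -/

/-- The squared norm of f - g is ⟨f,f⟩ - ⟨f,g⟩ - ⟨g,f⟩ + ⟨g,g⟩. The hypotheses make ⟨f,g⟩ equal to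
⟨f,f⟩, hence equal to its conjugate, and all four terms cancel. -/
theorem eq_of_inner_eq {ι : Type*} [Fintype ι] (f g : ι → ℂ)
    (h1 : ∑ v, star (f v) * f v = ∑ v, star (f v) * g v)
    (h2 : ∑ v, star (f v) * g v = ∑ v, star (g v) * g v) : f = g := by
  have h3 : ∑ v, star (g v) * f v = ∑ v, star (f v) * f v := by
    have := congrArg star h1
    simp only [star_sum, star_mul, star_star] at this
    exact this.symm
  have h4 : ∑ v, star (f v - g v) * (f v - g v) = 0 := by
    have : ∀ v, star (f v - g v) * (f v - g v) =
        (star (f v) * f v - star (f v) * g v) - (star (g v) * f v - star (g v) * g v) := by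
      intro v
      rw [star_sub]
      ring
    simp only [this, Finset.sum_sub_distrib]
    rw [h3, h1, h2]
    ring
  have h5 : ∀ v, star (f v - g v) * (f v - g v) = ((‖f v - g v‖ ^ 2 : ℝ) : ℂ) := by
    intro v
    rw [Complex.ofReal_pow]
    exact Complex.conj_mul' _
  simp only [h5] at h4
  rw [← Complex.ofReal_sum, Complex.ofReal_eq_zero, Finset.sum_eq_zero_iff_of_nonneg
    fun _ _ => by positivity] at h4
  funext v
  have := h4 v (Finset.mem_univ v)
  rw [sq_eq_zero_iff, norm_eq_zero, sub_eq_zero] at this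
  exact this

/-- Averages over bits are averages over any set of indices that contains those that matter. -/
theorem average_comp {J : Type} [Fintype J] [DecidableEq J] {W : ℕ} (S : Set J) (κ : J → ℕ)
    (hpos : ∀ v ∈ S, κ v ≠ 0) (hlt : ∀ v ∈ S, κ v < W) (hinj : Set.InjOn κ S)
    (H : (J → ZMod 2) → ℂ) (hH : ∀ w w' : J → ZMod 2, (∀ v ∈ S, w v = w' v) → H w = H w') :
    average W (fun x => H fun v => ((x (κ v) : ℤ) : ZMod 2)) =
      (∑ w, H w) / 2 ^ Fintype.card J := by
  classical
  -- A function of the coordinates in the range of an injection has the same average over the large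
  -- cube as over the small one: each assignment extends in the same number of ways.
  have key : ∀ {I : Type} [Fintype I] [DecidableEq I] (ι : S → I) (_ : Function.Injective ι)
      (G : (S → ZMod 2) → ℂ),
      (∑ x : I → ZMod 2, G (x ∘ ι)) / 2 ^ Fintype.card I =
        (∑ u, G u) / 2 ^ Fintype.card S := by
    intro I _ _ ι hι G
    let e : S ≃ {i // i ∈ Set.range ι} := Equiv.ofInjective ι hι
    rw [← (Equiv.piEquivPiSubtypeProd (fun i => i ∈ Set.range ι)
      (fun _ => ZMod 2)).symm.sum_comp, Fintype.sum_prod_type]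
    have h1 : ∀ (a : {i // i ∈ Set.range ι} → ZMod 2) (b : {i // i ∉ Set.range ι} → ZMod 2),
        (Equiv.piEquivPiSubtypeProd (fun i => i ∈ Set.range ι)
          (fun _ => ZMod 2)).symm (a, b) ∘ ι = a ∘ e := by
      intro a b
      funext s
      have : ι s ∈ Set.range ι := ⟨s, rfl⟩
      simp only [Function.comp_apply, Equiv.piEquivPiSubtypeProd_symm_apply, this, dif_pos]
      rfl
    simp only [h1, Finset.sum_const, Finset.card_univ, nsmul_eq_mul]
    rw [← Finset.mul_sum, Fintype.card_fun, ZMod.card]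
    have h2 : ∑ a : {i // i ∈ Set.range ι} → ZMod 2, G (a ∘ e) = ∑ u, G u :=
      (Equiv.arrowCongr e (Equiv.refl (ZMod 2))).symm.sum_comp G
    have h3 : Fintype.card I = Fintype.card {i // i ∉ Set.range ι} + Fintype.card S := by
      rw [Fintype.card_congr e, add_comm]
      exact (Fintype.card_congr (Equiv.sumCompl (· ∈ Set.range ι))).symm.trans Fintype.card_sum
    rw [h2, h3, pow_add]
    push_cast
    rw [mul_div_mul_left _ _ (pow_ne_zero _ two_ne_zero)]
  -- Coordinates outside `S` are filled with 0, which does not matter because `H` ignores them.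
  let G : (S → ZMod 2) → ℂ := fun u => H fun v => if h : v ∈ S then u ⟨v, h⟩ else 0
  have hG : ∀ w : J → ZMod 2, H w = G (w ∘ Subtype.val) := fun w =>
    hH _ _ fun v hv => by simp [hv]
  let ι : S → Fin W := fun v => ⟨κ v, hlt v v.2⟩
  have hι : Function.Injective ι := fun v v' h =>
    Subtype.ext (hinj v.2 v'.2 (congrArg Fin.val h))
  have hGx : ∀ x : Fin W → ZMod 2,
      (H fun v => ((liftBits x (κ v) : ℤ) : ZMod 2)) = G (x ∘ ι) := by
    intro x
    refine hH _ _ fun v hv => ?_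
    rw [liftBits_of_lt x (hpos v hv) (hlt v hv)]
    simp [hv, ι]
  have k1 := key ι hι G
  have k2 := key (Subtype.val : S → J) Subtype.val_injective G
  rw [average]
  simp only [hGx, hG]
  rw [k2, ← k1, Fintype.card_fin]

/-! ### Inner products of expressions as quadratic exponential sums -/

namespace ClifExpr

variable {n m : ℕ}

/-- The value of a factor of a monomial. -/
def factorVal {k : ℕ} (ρ : Fin k → ℤ) : Option (Fin k) → ℤ
  | none => 1
  | some i => ρ i

/-- The value of a sum of variables and ones. -/
def rowVal {k : ℕ} (ρ : Fin k → ℤ) (l : List (Option (Fin k))) : ℤ := (l.map (factorVal ρ)).sum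

/-- The ket polynomials followed by the bra polynomials. -/
def row (t : ClifExpr n m) : Fin (m + n) → List (Option (Fin t.numVars)) := Fin.append t.ket t.bra

/-- Four times the phase without its constant term. -/
def phaseForm (t : ClifExpr n m) (ρ : Fin t.numVars → ℤ) : ℤ :=
  (t.P₁.map fun x => x.1 * factorVal ρ x.2).sum +
    2 * (t.P₂.map fun x => x.1 * (factorVal ρ x.2.1 * factorVal ρ x.2.2)).sum

/-- The phase together with the ket and bra polynomials, each with a multiplier. -/
def form (t : ClifExpr n m) (ρ : Fin t.numVars → ℤ) (ζ : ℕ → ℤ) : ℤ :=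
  t.phaseForm ρ + 2 * ∑ j : Fin (m + n), ζ (j + 1) * rowVal ρ (t.row j)

/-- The integers of an assignment of bits. -/
def bitVal {k : ℕ} (y : Fin k → ZMod 2) (i : Fin k) : ℤ := (y i).val

theorem bit_eval_factor {k : ℕ} (y : Fin k → ZMod 2) (a : Option (Fin k)) :
    bit (eval y (factor (ZMod 2) a)) = (factorVal (bitVal y) a : ℤ) := by
  cases a <;> simp [factor, factorVal, bitVal, bit, ZMod.val_one]

theorem eval_linear {k : ℕ} (y : Fin k → ZMod 2) (l : List (Option (Fin k))) :
    eval y (linear l) = ((rowVal (bitVal y) l : ℤ) : ZMod 2) := by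
  induction l with
  | nil => simp [linear, rowVal]
  | cons a l ih =>
    have : linear (a :: l) = factor (ZMod 2) a + linear l := by simp [linear]
    have h2 : rowVal (bitVal y) (a :: l) = factorVal (bitVal y) a + rowVal (bitVal y) l := by
      simp [rowVal]
    rw [this, map_add, ih, h2, Int.cast_add]
    congr 1
    cases a <;> simp [factor, factorVal, bitVal]

theorem phaseExp_value (t : ClifExpr n m) (y : Fin t.numVars → ZMod 2) :
    phaseExp (t.body.phase.value y) = eighthRoot (t.P₀ + 2 * t.phaseForm (bitVal y)) := by
  change phaseExp ((PhasePoly.mk (clifPhase t.P₀ t.poly₁ t.poly₂)).value y) = _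
  rw [PhasePoly.value_mk, eighthRoot, clifPhase]
  congr 2
  have h1 : eval (fun i => bit (y i)) (MvPolynomial.map (Int.castRingHom ℝ) t.poly₁) =
      (((t.P₁.map fun x => x.1 * factorVal (bitVal y) x.2).sum : ℤ) : ℝ) := by
    rw [poly₁, map_list_sum, map_list_sum, Int.cast_list_sum]
    simp only [List.map_map]
    congr 1
    refine List.map_congr_left fun x _ => ?_
    simp only [Function.comp_apply, map_mul, map_C, eval_C, eval_map_factor, bit_eval_factor]
    push_cast
    rfl
  have h2 : eval (fun i => bit (y i)) (MvPolynomial.map (Int.castRingHom ℝ) t.poly₂) =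
      (((t.P₂.map fun x => x.1 * (factorVal (bitVal y) x.2.1 *
        factorVal (bitVal y) x.2.2)).sum : ℤ) : ℝ) := by
    rw [poly₂, map_list_sum, map_list_sum, Int.cast_list_sum]
    simp only [List.map_map]
    congr 1
    refine List.map_congr_left fun x _ => ?_
    simp only [Function.comp_apply, map_mul, map_C, eval_C, eval_map_factor, bit_eval_factor]
    push_cast
    rfl
  simp only [map_add, map_mul, eval_C, h1, h2, phaseForm]
  push_cast
  ring

/-- The inner product of the matrices of two expressions. -/
def inner (s t : ClifExpr n m) : ℂ := ∑ v, star (s.toSOP.interp v) * t.toSOP.interp v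

/-- Orthogonality of characters: the exponent 4 makes each summand a sign, and flipping the
multiplier of an odd `d j` cancels the terms in pairs. -/
theorem sum_eighthRoot_eq {r : ℕ} (d : Fin r → ℤ) :
    ∑ z : Fin r → ZMod 2, eighthRoot (4 * ∑ j, bitVal z j * d j) =
      if ∀ j, Even (d j) then 2 ^ r else 0 := by
  split_ifs with h
  · have : ∀ z : Fin r → ZMod 2, eighthRoot (4 * ∑ j, bitVal z j * d j) = 1 := fun z =>
      eighthRoot_two_mul_of_even (Finset.even_sum _ fun j _ => (h j).mul_left _)
    simp [this, ZMod.card]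
  · push Not at h
    obtain ⟨j, hj⟩ := h
    rw [sum_update_eq _ j, Finset.sum_eq_zero]
    intro z _
    have hup : ∀ a : ZMod 2, ∑ i, bitVal (Function.update z j a) i * d i =
        a.val * d j + ∑ i ∈ Finset.univ.erase j, bitVal z i * d i := by
      intro a
      rw [← Finset.add_sum_erase _ _ (Finset.mem_univ j)]
      congr 1
      · simp [bitVal]
      · refine Finset.sum_congr rfl fun i hi => ?_
        rw [bitVal, Function.update_of_ne (Finset.ne_of_mem_erase hi), bitVal]
    rw [hup, hup, mul_add, mul_add, eighthRoot_add, eighthRoot_add, ZMod.val_zero, ZMod.val_one,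
      Nat.cast_one, one_mul, Nat.cast_zero, zero_mul, mul_zero, eighthRoot_zero,
      eighthRoot_two_mul_of_odd hj]
    ring

/-- Two paths reach the same basis element if the difference of each pair of rows is even. Detecting
this with multiplier bits replaces the condition by terms that are bilinear in multipliers and
variables, so the whole exponent stays quadratic. -/
theorem kron_point (s t : ClifExpr n m) (y : Fin s.numVars → ZMod 2) (y' : Fin t.numVars → ZMod 2) :
    SOP.kron (s.body.point y) (t.body.point y') =
      (∑ z : Fin (m + n) → ZMod 2, eighthRoot (4 * ∑ j, bitVal z j *
        (rowVal (bitVal y') (t.row j) - rowVal (bitVal y) (s.row j)))) / 2 ^ (m + n) := by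
  rw [sum_eighthRoot_eq, SOP.kron]
  have hiff : s.body.point y = t.body.point y' ↔
      ∀ j, Even (rowVal (bitVal y') (t.row j) - rowVal (bitVal y) (s.row j)) := by
    have h2 : ∀ a b : ℤ, ((a : ZMod 2) = b) ↔ Even (b - a) := by
      intro a b
      rw [← ZMod.intCast_eq_zero_iff_even, Int.cast_sub, sub_eq_zero, eq_comm]
    rw [SOPBody.point, SOPBody.point, Prod.ext_iff, funext_iff, funext_iff]
    change ((∀ i, eval y (linear (s.ket i)) = eval y' (linear (t.ket i))) ∧
      ∀ i, eval y (linear (s.bra i)) = eval y' (linear (t.bra i))) ↔ _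
    simp only [eval_linear, h2]
    rw [Fin.forall_fin_add]
    simp [row]
  rw [if_congr hiff rfl rfl]
  split_ifs <;> simp

theorem star_eighthRoot (a : ℤ) : star (eighthRoot a) = eighthRoot (-a) := by
  have h1 : eighthRoot (-a) * eighthRoot a = 1 := by
    rw [← eighthRoot_add, neg_add_cancel, eighthRoot_zero]
  have h2 : star (eighthRoot a) * eighthRoot a = 1 := by
    have := Complex.conj_mul' (eighthRoot a)
    rw [norm_eighthRoot] at this
    simpa using this
  exact mul_right_cancel₀ (eighthRoot_ne_zero a) (h2.trans h1.symm)

theorem star_kron {α : Type*} [DecidableEq α] (u v : α) : star (SOP.kron u v) = SOP.kron u v := by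
  rw [SOP.kron]
  split_ifs <;> simp

theorem sum_kron_mul_kron {α : Type*} [DecidableEq α] [Fintype α] (u v : α) :
    ∑ x, SOP.kron u x * SOP.kron v x = SOP.kron u v := by
  simp only [SOP.kron]
  rw [Finset.sum_eq_single u (fun x _ hx => by rw [if_neg hx.symm, zero_mul])
    (fun h => absurd (Finset.mem_univ u) h), if_pos rfl, one_mul]
  exact if_congr eq_comm rfl rfl

/-- Summing over the basis contracts the two Kronecker symbols to one, to which `kron_point`
applies. The unknowns are the multipliers, the variables of `s` and those of `t`; conjugation gives
the phase of `s` its minus sign. -/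
theorem inner_eq (s t : ClifExpr n m) :
    inner s t = (((1 / √2) ^ s.p * (1 / √2) ^ t.p : ℝ) : ℂ) * eighthRoot (t.P₀ - s.P₀) *
      ((∑ w : Fin (m + n) ⊕ Fin s.numVars ⊕ Fin t.numVars → ZMod 2,
        eighthRoot (2 * (t.phaseForm (bitVal fun i => w (.inr (.inr i))) -
          s.phaseForm (bitVal fun i => w (.inr (.inl i)))) +
          4 * ∑ j, bitVal (fun i => w (.inl i)) j *
            (rowVal (bitVal fun i => w (.inr (.inr i))) (t.row j) -
              rowVal (bitVal fun i => w (.inr (.inl i))) (s.row j)))) / 2 ^ (m + n)) := by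
  have hinterp : ∀ (t : ClifExpr n m) v, t.toSOP.interp v = (((1 / √2) ^ t.p : ℝ) : ℂ) *
      ∑ y : Fin t.numVars → ZMod 2, SOP.kron (t.body.point y) v *
        eighthRoot (t.P₀ + 2 * t.phaseForm (bitVal y)) := by
    intro t v
    simp only [← phaseExp_value]
    rfl
  have hsum : ∀ F : (Fin (m + n) ⊕ Fin s.numVars ⊕ Fin t.numVars → ZMod 2) → ℂ,
      ∑ w, F w = ∑ y : Fin s.numVars → ZMod 2, ∑ y' : Fin t.numVars → ZMod 2,
        ∑ z : Fin (m + n) → ZMod 2, F (Sum.elim z (Sum.elim y y')) := by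
    intro F
    rw [← (Equiv.sumArrowEquivProdArrow _ _ _).symm.sum_comp, Fintype.sum_prod_type,
      Finset.sum_comm, ← (Equiv.sumArrowEquivProdArrow _ _ _).symm.sum_comp,
      Fintype.sum_prod_type]
    rfl
  rw [hsum, inner]
  simp only [hinterp, Sum.elim_inl, Sum.elim_inr, star_mul', star_sum, star_kron, star_eighthRoot]
  have hstar : star (((1 / √2) ^ s.p : ℝ) : ℂ) = (((1 / √2) ^ s.p : ℝ) : ℂ) :=
    Complex.conj_ofReal _
  rw [hstar, Complex.ofReal_mul]
  have h1 : ∀ v : (Fin m → ZMod 2) × (Fin n → ZMod 2),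
      (((1 / √2) ^ s.p : ℝ) : ℂ) * (∑ y : Fin s.numVars → ZMod 2, SOP.kron (s.body.point y) v *
        eighthRoot (-(s.P₀ + 2 * s.phaseForm (bitVal y)))) * ((((1 / √2) ^ t.p : ℝ) : ℂ) *
        ∑ y : Fin t.numVars → ZMod 2, SOP.kron (t.body.point y) v *
          eighthRoot (t.P₀ + 2 * t.phaseForm (bitVal y))) =
      (((1 / √2) ^ s.p : ℝ) : ℂ) * (((1 / √2) ^ t.p : ℝ) : ℂ) *
        ∑ y : Fin s.numVars → ZMod 2, ∑ y' : Fin t.numVars → ZMod 2,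
          (eighthRoot (-(s.P₀ + 2 * s.phaseForm (bitVal y))) *
            eighthRoot (t.P₀ + 2 * t.phaseForm (bitVal y'))) *
            (SOP.kron (s.body.point y) v * SOP.kron (t.body.point y') v) := by
    intro v
    rw [mul_mul_mul_comm, Finset.sum_mul_sum]
    congr 1
    exact Finset.sum_congr rfl fun y _ => Finset.sum_congr rfl fun y' _ => by ring
  simp only [h1]
  rw [← Finset.mul_sum, mul_assoc _ (eighthRoot _)]
  congr 1
  rw [Finset.sum_comm, Finset.sum_div, Finset.mul_sum]
  refine Finset.sum_congr rfl fun y _ => ?_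
  rw [Finset.sum_comm, Finset.sum_div, Finset.mul_sum]
  refine Finset.sum_congr rfl fun y' _ => ?_
  rw [← Finset.mul_sum, sum_kron_mul_kron, kron_point, mul_div_assoc', mul_div_assoc',
    Finset.mul_sum, Finset.mul_sum]
  congr 1
  refine Finset.sum_congr rfl fun z _ => ?_
  rw [← eighthRoot_add, ← eighthRoot_add, ← eighthRoot_add]
  congr 1
  ring

theorem interp_eq_iff (s t : ClifExpr n m) :
    s.toSOP.interp = t.toSOP.interp ↔ inner s s = inner s t ∧ inner s t = inner t t := by
  refine ⟨fun h => ?_, fun h => eq_of_inner_eq _ _ h.1 h.2⟩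
  rw [inner, inner, inner, h]
  exact ⟨rfl, rfl⟩

/-- The variable of a factor, if any, has been given a nonzero index. -/
def Seen {k : ℕ} (κ : Fin k → ℕ) (a : Option (Fin k)) : Prop := ∀ v, a = some v → κ v ≠ 0

/-- All variables that occur in an expression have been given a nonzero index. -/
structure AllSeen (t : ClifExpr n m) (κ : Fin t.numVars → ℕ) : Prop where
  linear : ∀ x ∈ t.P₁, Seen κ x.2
  quadratic : ∀ x ∈ t.P₂, Seen κ x.2.1 ∧ Seen κ x.2.2
  row : ∀ j, ∀ a ∈ t.row j, Seen κ a

theorem factorVal_congr {k : ℕ} {κ : Fin k → ℕ} {a : Option (Fin k)} (ha : Seen κ a)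
    {ρ ρ' : Fin k → ℤ} (h : ∀ v, κ v ≠ 0 → ρ v = ρ' v) : factorVal ρ a = factorVal ρ' a := by
  cases a with
  | none => rfl
  | some v => exact h v (ha v rfl)

theorem form_congr {t : ClifExpr n m} {κ : Fin t.numVars → ℕ} (ht : t.AllSeen κ)
    {ρ ρ' : Fin t.numVars → ℤ} (h : ∀ v, κ v ≠ 0 → ρ v = ρ' v) (ζ : ℕ → ℤ) :
    t.form ρ ζ = t.form ρ' ζ := by
  rw [form, form, phaseForm, phaseForm,
    List.map_congr_left fun x hx => by rw [factorVal_congr (ht.linear x hx) h],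
    List.map_congr_left (l := t.P₂) fun x hx => by
      rw [factorVal_congr (ht.quadratic x hx).1 h, factorVal_congr (ht.quadratic x hx).2 h]]
  congr 2
  refine Finset.sum_congr rfl fun j _ => ?_
  rw [rowVal, rowVal, List.map_congr_left fun a ha => factorVal_congr (ht.row j a ha) h]

theorem intCast_val {x : ℤ} (hx : x = 0 ∨ x = 1) : (((x : ZMod 2)).val : ℤ) = x := by
  rcases hx with rfl | rfl <;> simp [ZMod.val_one]

/-- The inner product as an average over bits that are indexed by natural numbers. -/
theorem inner_eq_gauss (s t : ClifExpr n m) (κ : Fin s.numVars → ℕ) (κ' : Fin t.numVars → ℕ)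
    {W l : ℕ} (hs : s.AllSeen κ) (ht : t.AllSeen κ')
    (hκ : ∀ v, κ v ≠ 0 → m + n < κ v ∧ κ v < l) (hκ' : ∀ v, κ' v ≠ 0 → l ≤ κ' v ∧ κ' v < W)
    (hl : m + n < l) (hlW : l ≤ W)
    (hinj : ∀ v v', κ v ≠ 0 → κ v = κ v' → v = v')
    (hinj' : ∀ v v', κ' v ≠ 0 → κ' v = κ' v' → v = v') (B : ℕ → ℕ → ℤ)
    (hB : ∀ x : ℕ → ℤ, x 0 = 1 → (∀ i, x i = 0 ∨ x i = 1) →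
      quadForm W B x = t.form (fun v => x (κ' v)) x - s.form (fun v => x (κ v)) x) :
    inner s t = (((1 / √2) ^ s.p * (1 / √2) ^ t.p : ℝ) : ℂ) * 2 ^ (s.numVars + t.numVars) *
      eighthRoot (t.P₀ - s.P₀) * gauss W W B := by
  let J := Fin (m + n) ⊕ Fin s.numVars ⊕ Fin t.numVars
  -- Multipliers get the indices 1, …, m + n, because the index 0 stands for the constant 1.
  let ξ : J → ℕ := Sum.elim (fun j => j + 1) (Sum.elim κ κ')
  let E : (J → ZMod 2) → ℂ := fun w =>
    eighthRoot (2 * (t.phaseForm (bitVal fun i => w (.inr (.inr i))) -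
      s.phaseForm (bitVal fun i => w (.inr (.inl i)))) +
      4 * ∑ j, bitVal (fun i => w (.inl i)) j *
        (rowVal (bitVal fun i => w (.inr (.inr i))) (t.row j) -
          rowVal (bitVal fun i => w (.inr (.inl i))) (s.row j)))
  have hE : ∀ (w : J → ZMod 2) (ζ : ℕ → ℤ), (∀ j : Fin (m + n), ζ (j + 1) = (w (.inl j)).val) →
      E w = eighthRoot (2 * (t.form (bitVal fun i => w (.inr (.inr i))) ζ -
        s.form (bitVal fun i => w (.inr (.inl i))) ζ)) := by
    intro w ζ hζ
    simp only [E, form, hζ, bitVal]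
    simp only [mul_sub, Finset.sum_sub_distrib]
    congr 1
    ring
  have hg : gauss W W B = average W fun x => E fun v => ((x (ξ v) : ℤ) : ZMod 2) := by
    refine average_congr fun x => ?_
    have hb := liftBits_eq x
    have hv : ∀ i, (((liftBits x i : ℤ) : ZMod 2).val : ℤ) = liftBits x i := fun i =>
      intCast_val (hb i)
    rw [hB _ (liftBits_zero x) hb]
    refine Eq.trans ?_ (hE (fun v => ((liftBits x (ξ v) : ℤ) : ZMod 2)) (liftBits x)
      fun j => (hv (j + 1)).symm).symm
    congr 4
    · funext i; exact (hv _).symm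
    · funext i; exact (hv _).symm
  -- Index 0 marks variables that do not occur; the integrand does not depend on them, so only those
  -- with a nonzero index enter the average.
  have hav := average_comp (W := W) {v : J | ξ v ≠ 0} ξ (fun v hv => hv) ?_ ?_ E ?_
  · rw [inner_eq, hg, hav]
    -- The average divides by two to the number of all unknowns, the inner product only by two to
    -- the number of multipliers; the powers of 2 of both families of variables remain.
    simp only [J, Fintype.card_sum, Fintype.card_fin, pow_add]
    change _ * ((∑ w, E w) / _) = _
    field_simp
    rfl
  · rintro (j | v | v) hv
    · have : (j : ℕ) + 1 < W := by have := j.2; omega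
      exact this
    · exact (hκ v hv).2.trans_le hlW
    · exact (hκ' v hv).2
  · rintro (j | v | v) hv (j' | v' | v') hv' h
    · have : (j : ℕ) + 1 = j' + 1 := h
      rw [Fin.ext (Nat.succ_injective this)]
    · have h1 := hκ v' hv'
      have h2 : (j : ℕ) + 1 = κ v' := h
      have := j.2
      omega
    · have h1 := hκ' v' hv'
      have h2 : (j : ℕ) + 1 = κ' v' := h
      have := j.2
      omega
    · have h1 := hκ v hv
      have h2 : κ v = j' + 1 := h
      have := j'.2
      omega
    · rw [hinj v v' hv h]
    · have h1 := hκ v hv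
      have h1' := hκ' v' hv'
      have h2 : κ v = κ' v' := h
      omega
    · have h1 := hκ' v hv
      have h2 : κ' v = j' + 1 := h
      have := j'.2
      omega
    · have h1 := hκ' v hv
      have h1' := hκ v' hv'
      have h2 : κ' v = κ v' := h
      omega
    · rw [hinj' v v' hv h]
  · intro w w' hww
    let ζ : ℕ → ℤ := fun i => if h : i - 1 < m + n then ((w (.inl ⟨i - 1, h⟩)).val : ℤ) else 0
    have hζ : ∀ j : Fin (m + n), ζ (j + 1) = (w (.inl j)).val := by
      intro j
      simp [ζ]
    have hζ' : ∀ j : Fin (m + n), ζ (j + 1) = (w' (.inl j)).val := by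
      intro j
      rw [hζ, hww (.inl j) (Nat.succ_ne_zero _)]
    rw [hE w ζ hζ, hE w' ζ hζ',
      form_congr ht (ρ' := bitVal fun i => w' (.inr (.inr i))) fun v hv => ?_,
      form_congr hs (ρ' := bitVal fun i => w' (.inr (.inl i))) fun v hv => ?_]
    · rw [bitVal, bitVal, hww (.inr (.inl v)) hv]
    · rw [bitVal, bitVal, hww (.inr (.inr v)) hv]

end ClifExpr
end

/-! ### Total correctness of programs with bounded loops -/

namespace RAM

/-- A bound for the running time if no loop runs for more than `N` rounds. -/
def Prog.time (N : ℕ) : Prog → ℕ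
  | skip => 1
  | assign _ e => e.cost + 1
  | store _ i e => i.cost + e.cost + 1
  | seq p q => p.time N + q.time N
  | ite e p q => e.cost + 1 + (p.time N + q.time N)
  | loop e p => N * (e.cost + 1 + p.time N) + (e.cost + 1)

/-- For a fixed program each loop contributes one factor `N`, so the degree is governed by the
nesting of loops, which does not depend on the input. -/
theorem Prog.exists_polynomial_time (p : Prog) : ∃ q : Polynomial ℕ, ∀ N, p.time N = q.eval N := by
  induction p with
  | skip => exact ⟨1, fun N => by simp [time]⟩
  | assign r e => exact ⟨Polynomial.C (e.cost + 1), fun N => by rw [time, Polynomial.eval_C]⟩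
  | store a i e =>
    exact ⟨Polynomial.C (i.cost + e.cost + 1), fun N => by rw [time, Polynomial.eval_C]⟩
  | seq p q hp hq =>
    obtain ⟨P, hP⟩ := hp
    obtain ⟨Q, hQ⟩ := hq
    exact ⟨P + Q, fun N => by rw [time, hP, hQ, Polynomial.eval_add]⟩
  | ite e p q hp hq =>
    obtain ⟨P, hP⟩ := hp
    obtain ⟨Q, hQ⟩ := hq
    exact ⟨Polynomial.C (e.cost + 1) + (P + Q), fun N => by
      rw [time, hP, hQ, Polynomial.eval_add, Polynomial.eval_add, Polynomial.eval_C]⟩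
  | loop e p hp =>
    obtain ⟨P, hP⟩ := hp
    exact ⟨Polynomial.X * (Polynomial.C (e.cost + 1) + P) + Polynomial.C (e.cost + 1), fun N => by
      rw [time, hP, Polynomial.eval_add, Polynomial.eval_mul, Polynomial.eval_X,
        Polynomial.eval_add, Polynomial.eval_C]⟩

/-- The condition under which a loop stops within `k` rounds in a state that satisfies `Q`. -/
def loopWp (e : Expr) (body : (State → Prop) → State → Prop) (Q : State → Prop) :
    ℕ → State → Prop
  | 0, σ => ¬ 0 < e.eval σ ∧ Q σ
  | k + 1, σ => (0 < e.eval σ → body (loopWp e body Q k) σ) ∧ (¬ 0 < e.eval σ → Q σ)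

/-- The weakest precondition for halting in a state that satisfies `Q`, with no loop running for
more than `N` rounds. -/
def Prog.wp (N : ℕ) : Prog → (State → Prop) → State → Prop
  | skip, Q, σ => Q σ
  | assign r e, Q, σ => Q ⟨Function.update σ.reg r (e.eval σ), σ.arr⟩
  | store a i e, Q, σ =>
    Q ⟨σ.reg, Function.update σ.arr a (Function.update (σ.arr a) (i.eval σ) (e.eval σ))⟩
  | seq p q, Q, σ => p.wp N (q.wp N Q) σ
  | ite e p q, Q, σ => (0 < e.eval σ → p.wp N Q σ) ∧ (¬ 0 < e.eval σ → q.wp N Q σ)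
  | loop e p, Q, σ => loopWp e (p.wp N) Q N σ

/-- Total correctness and the time bound come together, because `Prog.wp` already requires every
loop to stop within `N` rounds. -/
theorem Prog.wp_sound {N : ℕ} {p : Prog} {Q : State → Prop} {σ : State} (h : p.wp N Q σ) :
    ∃ (T : ℕ) (τ : State), Runs p σ T τ ∧ T ≤ p.time N ∧ Q τ := by
  induction p generalizing Q σ with
  | skip => exact ⟨_, _, Runs.skip σ, le_rfl, h⟩
  | assign r e => exact ⟨_, _, Runs.assign r e σ, le_rfl, h⟩
  | store a i e => exact ⟨_, _, Runs.store a i e σ, le_rfl, h⟩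
  | seq p q hp hq =>
    obtain ⟨S, τ, hr, hS, h'⟩ := hp h
    obtain ⟨T, υ, hr', hT, h''⟩ := hq h'
    exact ⟨_, _, Runs.seq hr hr', Nat.add_le_add hS hT, h''⟩
  | ite e p q hp hq =>
    by_cases he : 0 < e.eval σ
    · obtain ⟨T, τ, hr, hT, h'⟩ := hp (h.1 he)
      exact ⟨_, _, Runs.ite_pos he hr, by rw [time]; omega, h'⟩
    · obtain ⟨T, τ, hr, hT, h'⟩ := hq (h.2 he)
      exact ⟨_, _, Runs.ite_neg he hr, by rw [time]; omega, h'⟩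
  | loop e p hp =>
    have key : ∀ (k : ℕ) (σ : State), loopWp e (p.wp N) Q k σ →
        ∃ (T : ℕ) (τ : State), Runs (loop e p) σ T τ ∧
          T ≤ k * (e.cost + 1 + p.time N) + (e.cost + 1) ∧ Q τ := by
      intro k
      induction k with
      | zero =>
        intro σ h
        exact ⟨_, _, Runs.loop_stop h.1, by omega, h.2⟩
      | succ k ih =>
        intro σ h
        by_cases he : 0 < e.eval σ
        · obtain ⟨S, τ, hr, hS, h'⟩ := hp (h.1 he)
          obtain ⟨T, υ, hr', hT, h''⟩ := ih τ h'
          refine ⟨_, _, Runs.loop_step he hr hr', ?_, h''⟩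
          rw [Nat.succ_mul]
          omega
        · exact ⟨_, _, Runs.loop_stop he, by omega, h.2 he⟩
    exact key N σ h

theorem loopWp_mono {e : Expr} {body : (State → Prop) → State → Prop} {Q Q' : State → Prop}
    (hbody : ∀ (P P' : State → Prop) (σ : State), (∀ τ, P τ → P' τ) → body P σ → body P' σ)
    (hQ : ∀ τ, Q τ → Q' τ) : ∀ (k : ℕ) {σ : State}, loopWp e body Q k σ → loopWp e body Q' k σ
  | 0, _, h => ⟨h.1, hQ _ h.2⟩
  | k + 1, _, h => ⟨fun he => hbody _ _ _ (fun _ => loopWp_mono hbody hQ k) (h.1 he),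
      fun he => hQ _ (h.2 he)⟩

theorem Prog.wp_mono {N : ℕ} {p : Prog} {Q Q' : State → Prop} {σ : State}
    (hQ : ∀ τ, Q τ → Q' τ) (h : p.wp N Q σ) : p.wp N Q' σ := by
  induction p generalizing Q Q' σ with
  | skip => exact hQ _ h
  | assign r e => exact hQ _ h
  | store a i e => exact hQ _ h
  | seq p q hp hq => exact hp (fun _ h => hq hQ h) h
  | ite e p q hp hq => exact ⟨fun he => hp hQ (h.1 he), fun he => hq hQ (h.2 he)⟩
  | loop e p hp => exact loopWp_mono (body := p.wp N) (fun _ _ _ hPP h => hp hPP h) hQ N h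

/-- The registers that a program assigns. -/
def Prog.regs : Prog → List ℕ
  | skip => []
  | assign r _ => [r]
  | store _ _ _ => []
  | seq p q => p.regs ++ q.regs
  | ite _ p q => p.regs ++ q.regs
  | loop _ p => p.regs

/-- The arrays that a program assigns. -/
def Prog.arrs : Prog → List ℕ
  | skip => []
  | assign _ _ => []
  | store a _ _ => [a]
  | seq p q => p.arrs ++ q.arrs
  | ite _ p q => p.arrs ++ q.arrs
  | loop _ p => p.arrs

/-- The memory that a program does not assign is the same in two states. -/
structure Frame (p : Prog) (σ τ : State) : Prop where
  reg : ∀ r, r ∉ p.regs → τ.reg r = σ.reg r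
  arr : ∀ a, a ∉ p.arrs → τ.arr a = σ.arr a

theorem Frame.refl (p : Prog) (σ : State) : Frame p σ σ := ⟨fun _ _ => rfl, fun _ _ => rfl⟩

theorem Frame.trans {p : Prog} {σ τ υ : State} (h : Frame p σ τ) (h' : Frame p τ υ) :
    Frame p σ υ :=
  ⟨fun r hr => (h'.reg r hr).trans (h.reg r hr), fun a ha => (h'.arr a ha).trans (h.arr a ha)⟩

theorem Frame.mono {p q : Prog} {σ τ : State} (h : Frame p σ τ) (hr : ∀ r ∈ p.regs, r ∈ q.regs)
    (ha : ∀ a ∈ p.arrs, a ∈ q.arrs) : Frame q σ τ :=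
  ⟨fun r hq => h.reg r fun hp => hq (hr r hp), fun a hq => h.arr a fun hp => hq (ha a hp)⟩

theorem loopWp_frame {N : ℕ} {e : Expr} {p : Prog} {Q : State → Prop}
    (hp : ∀ {P : State → Prop} {σ : State}, p.wp N P σ → p.wp N (fun τ => P τ ∧ Frame p σ τ) σ) :
    ∀ (k : ℕ) {σ₀ σ : State}, Frame p σ₀ σ → loopWp e (p.wp N) Q k σ →
      loopWp e (p.wp N) (fun τ => Q τ ∧ Frame p σ₀ τ) k σ
  | 0, _, _, hf, h => ⟨h.1, h.2, hf⟩
  | k + 1, _, _, hf, h => ⟨fun he => Prog.wp_mono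
      (fun _ h' => loopWp_frame hp k (hf.trans h'.2) h'.1) (hp (h.1 he)), fun he => ⟨h.2 he, hf⟩⟩

/-- Specifications can then mention only what a program changes; that the other registers and arrays
survive is read off its text. -/
theorem Prog.wp_frame {N : ℕ} {p : Prog} {Q : State → Prop} {σ : State} (h : p.wp N Q σ) :
    p.wp N (fun τ => Q τ ∧ Frame p σ τ) σ := by
  induction p generalizing Q σ with
  | skip => exact ⟨h, Frame.refl _ _⟩
  | assign r e =>
    exact ⟨h, fun r' hr' => Function.update_of_ne (by simpa [regs] using hr') _ _, fun _ _ => rfl⟩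
  | store a i e =>
    exact ⟨h, fun _ _ => rfl, fun a' ha' => Function.update_of_ne (by simpa [arrs] using ha') _ _⟩
  | seq p q hp hq =>
    change p.wp N (q.wp N _) σ
    refine wp_mono (fun τ hτ => wp_mono (fun υ hυ => ⟨hυ.1, ?_⟩) (hq hτ.1)) (hp h)
    exact (hτ.2.mono (fun r hr => List.mem_append_left _ hr)
      fun a ha => List.mem_append_left _ ha).trans
      (hυ.2.mono (fun r hr => List.mem_append_right _ hr) fun a ha => List.mem_append_right _ ha)
  | ite e p q hp hq =>
    refine ⟨fun he => wp_mono (fun τ hτ => ⟨hτ.1, ?_⟩) (hp (h.1 he)),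
      fun he => wp_mono (fun τ hτ => ⟨hτ.1, ?_⟩) (hq (h.2 he))⟩
    · exact hτ.2.mono (fun r hr => List.mem_append_left _ hr)
        fun a ha => List.mem_append_left _ ha
    · exact hτ.2.mono (fun r hr => List.mem_append_right _ hr)
        fun a ha => List.mem_append_right _ ha
  | loop e p hp =>
    exact loopWp_mono (body := p.wp N) (fun _ _ _ hPP h => wp_mono hPP h)
      (fun τ hτ => ⟨hτ.1, hτ.2.mono (fun _ h => h) fun _ h => h⟩) N
      (loopWp_frame (fun h => hp h) N (Frame.refl p σ) h)

/-- The rule of consequence, with the frame. -/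
theorem Prog.wp_consequence {N : ℕ} {p : Prog} {P Q : State → Prop} {σ : State} (h : p.wp N P σ)
    (hQ : ∀ τ, P τ → Frame p σ τ → Q τ) : p.wp N Q σ :=
  wp_mono (fun τ hτ => hQ τ hτ.1 hτ.2) (wp_frame h)

/-- The rule for loops whose guard is a register that counts the remaining rounds. -/
theorem Prog.wp_for {N r : ℕ} {body : Prog} {Q : State → Prop} {σ₀ : State} (k : ℕ) (hk : k ≤ N)
    (Inv : ℕ → State → Prop) (h0 : Inv k σ₀) (hr : ∀ k σ, Inv k σ → σ.reg r = k)
    (step : ∀ k' σ, k' < k → Frame body σ₀ σ → Inv (k' + 1) σ → body.wp N (Inv k') σ)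
    (hQ : ∀ τ, Frame body σ₀ τ → Inv 0 τ → Q τ) : (loop (Expr.reg r) body).wp N Q σ₀ := by
  have key : ∀ (N' k' : ℕ) (σ : State), k' ≤ N' → k' ≤ k → Frame body σ₀ σ → Inv k' σ →
      loopWp (Expr.reg r) (body.wp N) Q N' σ := by
    intro N'
    induction N' with
    | zero =>
      intro k' σ hk' _ hf hI
      obtain rfl : k' = 0 := by omega
      refine ⟨?_, hQ σ hf hI⟩
      rw [Expr.eval, hr 0 σ hI]
      simp
    | succ N' ih =>
      intro k' σ hk' hkk hf hI
      have hσ := hr k' σ hI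
      refine ⟨fun he => ?_, fun he => ?_⟩
      · rw [Expr.eval, hσ] at he
        obtain ⟨k'', rfl⟩ : ∃ k'', k' = k'' + 1 := ⟨k' - 1, by omega⟩
        exact wp_consequence (step k'' σ hkk hf hI) fun τ hτ hf' =>
          ih k'' τ (by omega) (by omega) (hf.trans hf') hτ
      · rw [Expr.eval, hσ] at he
        obtain rfl : k' = 0 := by omega
        exact hQ σ hf hI
  exact key N k σ₀ hk le_rfl (Frame.refl _ _) h0

/-! ### Elimination of variables on the machine -/

open RAM.Expr

/-- Programs in a row. -/
def Prog.block : List Prog → Prog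
  | [] => skip
  | p :: ps => seq p (block ps)

theorem Prog.wp_nil (N : ℕ) (Q : State → Prop) (σ : State) : (block []).wp N Q σ = Q σ := rfl

theorem Prog.wp_cons (N : ℕ) (p : Prog) (ps : List Prog) (Q : State → Prop) (σ : State) :
    (block (p :: ps)).wp N Q σ = p.wp N ((block ps).wp N Q) σ := rfl

theorem Prog.wp_skip (N : ℕ) (Q : State → Prop) (σ : State) : skip.wp N Q σ = Q σ := rfl

theorem Prog.wp_assign (N r : ℕ) (e : Expr) (Q : State → Prop) (σ : State) :
    (assign r e).wp N Q σ = Q ⟨Function.update σ.reg r (e.eval σ), σ.arr⟩ := rfl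

theorem Prog.wp_store (N a : ℕ) (i e : Expr) (Q : State → Prop) (σ : State) :
    (store a i e).wp N Q σ = Q ⟨σ.reg, Function.update σ.arr a
      (Function.update (σ.arr a) (i.eval σ) (e.eval σ))⟩ := rfl

theorem Prog.wp_ite (N : ℕ) (e : Expr) (p q : Prog) (Q : State → Prop) (σ : State) :
    (ite e p q).wp N Q σ =
      ((0 < e.eval σ → p.wp N Q σ) ∧ (¬ 0 < e.eval σ → q.wp N Q σ)) := rfl

/-- The remainder modulo two. -/
def parity (e : Expr) : Expr := sub e (add (half e) (half e))

theorem eval_parity (e : Expr) (σ : State) : (parity e).eval σ = e.eval σ % 2 := by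
  simp only [parity, Expr.eval]
  omega

/-- The entry of a matrix whose rows start at the addresses listed in array `1`. -/
def cell (M : ℕ) (i k : Expr) : Expr := get M (add (get 1 i) k)

/-- Assignment of a matrix entry. -/
def setCell (M : ℕ) (i k e : Expr) : Prog := Prog.store M (add (get 1 i) k) e

/-- Array `1` lists the addresses of the rows of a matrix with rows of length `W`. -/
def HasTable (σ : State) (W : ℕ) : Prop := ∀ i : ℕ, i < W → σ.arr 1 i = (i : ℤ) * W

/-- Array `M` holds the entries of `B` with indices below `j`. -/
def HasMatrix (σ : State) (M W j : ℕ) (B : ℕ → ℕ → ℤ) : Prop :=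
  ∀ i k : ℕ, i < j → k < j → σ.arr M ((i : ℤ) * W + k) = B i k

/-- Uniqueness of quotient and remainder by `W`: distinct entries of a matrix stored by rows occupy
distinct cells, so writing one leaves the others intact. -/
theorem address_inj {W i k i' k' : ℕ} (hk : k < W) (hk' : k' < W)
    (h : (i : ℤ) * W + k = i' * W + k') : i = i' ∧ k = k' := by
  have h' : i * W + k = i' * W + k' := by exact_mod_cast h
  have hW : 0 < W := by omega
  have h1 := congrArg (· / W) h'
  have h2 := congrArg (· % W) h'
  simp only [Nat.mul_comm _ W, Nat.mul_add_div hW, Nat.div_eq_of_lt hk, Nat.div_eq_of_lt hk',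
    Nat.mul_add_mod, Nat.mod_eq_of_lt hk, Nat.mod_eq_of_lt hk', Nat.add_zero] at h1 h2
  exact ⟨h1, h2⟩

/-- The bits of the row `j`; for an even pivot, half of it is added to the constant entry. -/
def rowBits (B : ℕ → ℕ → ℤ) (j k : ℕ) : ℤ :=
  (if k = 0 ∧ B j j % 2 = 0 then B j 0 + B j j / 2 else B j k) % 2

/-- A positive index below `j` with a nonzero bit, or zero if there is none. -/
def IsPivot (b : ℕ → ℤ) (j l : ℕ) : Prop :=
  (l = 0 ∧ ∀ k < j, k ≠ 0 → b k = 0) ∨ (l ≠ 0 ∧ l < j ∧ b l = 1)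

theorem rowBits_eq (B : ℕ → ℕ → ℤ) (j k : ℕ) : rowBits B j k = 0 ∨ rowBits B j k = 1 := by
  rw [rowBits]
  omega

/-- Writes the parities of the row `j` (register `30`) to array `2`; register `34` becomes a
positive index with an odd entry, if there is one. -/
def readBits (M : ℕ) : Prog := Prog.loop (reg 36) (Prog.block
  [Prog.assign 36 (sub (reg 36) (const 1)),
    Prog.store 2 (reg 36) (parity (cell M (reg 30) (reg 36))),
    Prog.ite (reg 36)
      (Prog.ite (get 2 (reg 36)) (Prog.assign 34 (reg 36)) Prog.skip) Prog.skip])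

/-- The scan runs downwards and the latest odd positive index found is kept. Index 0 is never a
pivot: it is the constant 1, which cannot be solved for. -/
theorem wp_readBits {N M W j : ℕ} {b : ℕ → ℤ} {σ : State} (hM : 3 < M) (hT : HasTable σ W)
    (hrow : ∀ k : ℕ, k < j → σ.arr M ((j : ℤ) * W + k) % 2 = b k) (hJ : σ.reg 30 = j)
    (hjW : j < W) (hN : W ≤ N) (h34 : σ.reg 34 = 0) (h36 : σ.reg 36 = j) :
    (readBits M).wp N (fun τ => (∀ k : ℕ, k < j → τ.arr 2 k = b k) ∧
      ∃ l : ℕ, τ.reg 34 = l ∧ IsPivot b j l) σ := by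
  refine Prog.wp_for j (by omega) (fun k σ => σ.reg 36 = k ∧
    (∀ i : ℕ, k ≤ i → i < j → σ.arr 2 i = b i) ∧
    ∃ l : ℕ, σ.reg 34 = l ∧ ((l = 0 ∧ ∀ i < j, k ≤ i → i ≠ 0 → b i = 0) ∨
      (l ≠ 0 ∧ l < j ∧ b l = 1))) ?_ (fun k σ h => h.1) ?_ ?_
  · exact ⟨h36, fun i h1 h2 => by omega, 0, h34, .inl ⟨rfl, fun i h1 h2 => by omega⟩⟩
  · rintro k τ hk hf ⟨hτ, hb, l, hl, hpiv⟩
    have hcell : τ.arr M (τ.arr 1 j + k) % 2 = b k := by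
      rw [hf.arr M (by simp [Prog.arrs, Prog.block]; omega),
        hf.arr 1 (by simp [Prog.arrs, Prog.block]), hT j hjW, hrow k hk]
    have h30 : τ.reg 30 = j := (hf.reg 30 (by simp [Prog.regs, Prog.block])).trans hJ
    have hk1 : τ.reg 36 - 1 = k := by rw [hτ]; push_cast; ring
    have hbit : b k = 0 ∨ b k = 1 := by rw [← hcell]; omega
    have hread : ∀ i : ℕ, k ≤ i → i < j → Function.update (τ.arr 2) (k : ℤ) (b k) i = b i := by
      intro i hi hij
      rw [Function.update_apply]
      split_ifs with h
      · rw [Nat.cast_inj.1 h]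
      · exact hb i (by omega) hij
    simp only [Prog.wp_cons, Prog.wp_nil, Prog.wp_assign, Prog.wp_store, Prog.wp_ite,
      Prog.wp_skip, eval_parity, cell, Expr.eval]
    simp [hk1, h30, hcell]
    refine ⟨fun hk0 => ⟨fun hb1 => ⟨hread, .inr ⟨by omega, hk, by omega⟩⟩,
      fun hb0 => ⟨hread, l, hl, ?_⟩⟩, fun hk0 => ⟨hread, l, hl, ?_⟩⟩
    all_goals
      refine hpiv.imp_left fun h => ⟨h.1, fun i hi hki hi0 => ?_⟩
      rcases Nat.eq_or_lt_of_le hki with rfl | h'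
      · omega
      · exact h.2 i hi h' hi0
  · rintro τ hf ⟨hτ, hb, l, hl, hpiv⟩
    refine ⟨fun k hk => hb k (Nat.zero_le _) hk, l, hl, ?_⟩
    rcases hpiv with ⟨h, h'⟩ | h
    · exact .inl ⟨h, fun k hk => h' k hk (Nat.zero_le _)⟩
    · exact .inr h

/-- Reads the row `j` (register `30`) of the matrix: its pivot is split into twice register `32`
plus register `33`, its bits go to array `2`, and register `34` becomes a positive index with a
nonzero bit, or zero if there is none. -/
def readRow (M : ℕ) : Prog := Prog.block
  [Prog.assign 31 (cell M (reg 30) (reg 30)),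
    Prog.assign 32 (half (reg 31)),
    Prog.assign 33 (parity (reg 31)),
    Prog.ite (reg 33) Prog.skip
      (setCell M (reg 30) (const 0) (add (cell M (reg 30) (const 0)) (reg 32))),
    Prog.assign 34 (const 0),
    Prog.assign 36 (reg 30),
    readBits M]

/-- For an even diagonal entry half of it is added in place to the constant entry of the row `j`.
This spoils that row only, and afterwards the matrix is needed just for indices below `j`. -/
theorem wp_readRow {N M W j : ℕ} {B : ℕ → ℕ → ℤ} {σ : State} (hM : 3 < M)
    (hT : HasTable σ W) (hB : HasMatrix σ M W (j + 1) B) (hJ : σ.reg 30 = j)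
    (hjW : j < W) (hN : W ≤ N) :
    (readRow M).wp N (fun τ => τ.reg 32 = B j j / 2 ∧ τ.reg 33 = B j j % 2 ∧
      HasMatrix τ M W j B ∧ (∀ k : ℕ, k < j → τ.arr 2 k = rowBits B j k) ∧
      ∃ l : ℕ, τ.reg 34 = l ∧ IsPivot (rowBits B j) j l) σ := by
  have hp : σ.arr M (σ.arr 1 j + j) = B j j := by
    rw [hT j hjW, hB j j (by omega) (by omega)]
  have hadd : ∀ k : ℕ, k < W → σ.arr 1 j + (k : ℤ) = (j : ℤ) * W + k := fun k _ => by
    rw [hT j hjW]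
  have h0 : σ.arr M (σ.arr 1 j) = B j 0 := by
    have := hB j 0 (by omega) (by omega)
    rwa [Nat.cast_zero, add_zero, ← hT j hjW] at this
  have h1M : M ≠ 1 := by omega
  have hM1 : 1 ≠ M := by omega
  simp only [readRow, setCell, Prog.wp_cons, Prog.wp_assign, Prog.wp_store,
    Prog.wp_ite, Prog.wp_skip, eval_parity, cell, Expr.eval]
  simp [hJ, hp, h0]
  refine ⟨fun hodd => ?_, fun heven => ?_⟩
  · refine Prog.wp_consequence (wp_readBits (W := W) (j := j) (b := rowBits B j) hM hT ?_ ?_ hjW hN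
      ?_ ?_) ?_
    · intro k hk
      have hk' := hB j k (by omega) (by omega)
      simp [rowBits, hk', show B j j % 2 ≠ 0 by omega]
    · simpa using hJ
    · simp
    · simp
    · rintro τ ⟨h1, h2⟩ hf
      refine ⟨?_, ?_, ?_, h1, h2⟩
      · rw [hf.reg 32 (by simp [readBits, Prog.regs, Prog.block])]
        simp
      · rw [hf.reg 33 (by simp [readBits, Prog.regs, Prog.block])]
        simp
      · intro i k hi hk
        rw [hf.arr M (by simp [readBits, Prog.arrs, Prog.block]; omega)]
        exact hB i k (by omega) (by omega)
  · refine Prog.wp_consequence (wp_readBits (W := W) (j := j) (b := rowBits B j) hM ?_ ?_ ?_ hjW hN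
      ?_ ?_) ?_
    · intro i hi
      simp [hM1, hT i hi]
    · intro k hk
      have hk' := hB j k (by omega) (by omega)
      simp only [Function.update_self, hT j hjW, Function.update_apply, rowBits]
      by_cases hk0 : k = 0
      · subst hk0
        simp [show B j j % 2 = 0 by omega]
      · simp [hk0, hk']
    · simpa using hJ
    · simp
    · simp
    · rintro τ ⟨h1, h2⟩ hf
      refine ⟨?_, ?_, ?_, h1, h2⟩
      · rw [hf.reg 32 (by simp [readBits, Prog.regs, Prog.block])]
        simp
      · rw [hf.reg 33 (by simp [readBits, Prog.regs, Prog.block])]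
        simp
      · intro i k hi hk
        rw [hf.arr M (by simp [readBits, Prog.arrs, Prog.block]; omega)]
        -- The cell written lies in the row `j`, beyond all rows `i` that are still needed.
        have hne : (i : ℤ) * W + k ≠ σ.arr 1 j := by
          rw [hT j hjW]
          intro h
          have := (address_inj (i' := j) (k' := 0) (by omega) (by omega)
            (by rw [h]; simp : (i : ℤ) * W + k = j * W + (0 : ℕ))).1
          omega
        simp only [Function.update_self, Function.update_of_ne hne]
        exact hB i k (by omega) (by omega)

/-- Copies the row whose index is in register `34` to array `3`, or zeros if that index is zero. -/
def copyRow (M : ℕ) : Prog := Prog.loop (reg 36) (Prog.block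
  [Prog.assign 36 (sub (reg 36) (const 1)),
    Prog.ite (reg 34) (Prog.store 3 (reg 36) (cell M (reg 34) (reg 36)))
      (Prog.store 3 (reg 36) (const 0))])

/-- The pivot row is copied beforehand because the update of the matrix takes place in situ and
overwrites it. Without a pivot row the vector is 0, as the other two cases of the elimination
require. -/
theorem wp_copyRow {N M W j l : ℕ} {B : ℕ → ℕ → ℤ} {σ : State} (hM : 3 < M) (hT : HasTable σ W)
    (hB : HasMatrix σ M W j B) (hj : j < W) (hN : W ≤ N) (h34 : σ.reg 34 = l) (hl : l ≠ 0 → l < j)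
    (h36 : σ.reg 36 = j) :
    (copyRow M).wp N (fun τ => ∀ k : ℕ, k < j → τ.arr 3 k = if l = 0 then 0 else B l k) σ := by
  refine Prog.wp_for j (by omega) (fun k σ => σ.reg 36 = k ∧
    ∀ i : ℕ, k ≤ i → i < j → σ.arr 3 i = if l = 0 then 0 else B l i) ?_ (fun k σ h => h.1) ?_ ?_
  · exact ⟨h36, fun i h1 h2 => by omega⟩
  · rintro k τ hk hf ⟨hτ, hb⟩
    have h34' : τ.reg 34 = l := (hf.reg 34 (by simp [Prog.regs, Prog.block])).trans h34
    have hcell : l ≠ 0 → τ.arr M (τ.arr 1 l + k) = B l k := by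
      intro h
      rw [hf.arr M (by simp [Prog.arrs, Prog.block]; omega),
        hf.arr 1 (by simp [Prog.arrs, Prog.block]), hT l (by have := hl h; omega),
        hB l k (hl h) hk]
    have hk1 : τ.reg 36 - 1 = k := by rw [hτ]; push_cast; ring
    have hread : ∀ z : ℤ, z = (if l = 0 then 0 else B l k) → ∀ i : ℕ, k ≤ i → i < j →
        Function.update (τ.arr 3) (k : ℤ) z i = if l = 0 then 0 else B l i := by
      intro z hz i hi hij
      rw [Function.update_apply]
      split_ifs with h h' h'
      · rw [hz, if_pos h']
      · rw [hz, if_neg h', Nat.cast_inj.1 h]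
      · rw [hb i (by omega) hij, if_pos h']
      · rw [hb i (by omega) hij, if_neg h']
    simp only [Prog.wp_cons, Prog.wp_nil, Prog.wp_assign, Prog.wp_store, Prog.wp_ite,
      cell, Expr.eval]
    simp [hk1, h34']
    exact ⟨fun h => hread _ (by rw [hcell (by omega), if_neg (by omega)]),
      fun h => hread _ (by rw [if_pos h])⟩
  · rintro τ hf ⟨hτ, hb⟩
    exact fun k hk => hb k (Nat.zero_le _) hk

/-- Adds the update to the row whose index is in register `37`. -/
def updateRow (M : ℕ) : Prog := Prog.loop (reg 36) (Prog.block
  [Prog.assign 36 (sub (reg 36) (const 1)),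
    Prog.assign 38 (cell M (reg 37) (reg 36)),
    Prog.ite (get 2 (reg 37)) (Prog.assign 38 (add (reg 38) (get 3 (reg 36)))) Prog.skip,
    Prog.ite (get 2 (reg 36)) (Prog.assign 38 (add (reg 38) (get 3 (reg 37)))) Prog.skip,
    Prog.ite (get 2 (reg 37)) (Prog.ite (get 2 (reg 36))
      (Prog.assign 38 (add (reg 38) (reg 35))) Prog.skip) Prog.skip,
    setCell M (reg 37) (reg 36) (reg 38)])

theorem wp_updateRow {N M W j i : ℕ} {B : ℕ → ℕ → ℤ} {b v : ℕ → ℤ} {e : ℤ} {σ : State}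
    (hM : 3 < M) (hT : HasTable σ W) (hB : HasMatrix σ M W j B) (hj : j < W) (hN : W ≤ N)
    (hb : ∀ k : ℕ, k < j → σ.arr 2 k = b k) (hv : ∀ k : ℕ, k < j → σ.arr 3 k = v k)
    (hbit : ∀ k, b k = 0 ∨ b k = 1) (he : σ.reg 35 = e) (hi : σ.reg 37 = i) (hij : i < j)
    (h36 : σ.reg 36 = j) :
    (updateRow M).wp N (fun τ => HasMatrix τ M W j
      fun i' k => if i' = i then rankUpdate B b v e i' k else B i' k) σ := by
  refine Prog.wp_for j (by omega) (fun k σ => σ.reg 36 = k ∧ HasMatrix σ M W j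
      fun i' k' => if i' = i ∧ k ≤ k' then rankUpdate B b v e i' k' else B i' k') ?_
    (fun k σ h => h.1) ?_ ?_
  · refine ⟨h36, fun i' k' hi' hk' => ?_⟩
    exact (hB i' k' hi' hk').trans (if_neg (by omega)).symm
  · rintro k τ hk hf ⟨hτ, hA⟩
    have h37 : τ.reg 37 = i :=
      (hf.reg 37 (by simp [Prog.regs, Prog.block, setCell])).trans hi
    have h35 : τ.reg 35 = e :=
      (hf.reg 35 (by simp [Prog.regs, Prog.block, setCell])).trans he
    have h1 : τ.arr 1 i = (i : ℤ) * W := by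
      rw [hf.arr 1 (by simp [Prog.arrs, Prog.block, setCell]; omega), hT i (by omega)]
    have h2 : ∀ k : ℕ, k < j → τ.arr 2 k = b k := by
      rw [hf.arr 2 (by simp [Prog.arrs, Prog.block, setCell]; omega)]
      exact hb
    have h3 : ∀ k : ℕ, k < j → τ.arr 3 k = v k := by
      rw [hf.arr 3 (by simp [Prog.arrs, Prog.block, setCell]; omega)]
      exact hv
    have hcell : τ.arr M ((i : ℤ) * W + k) = B i k :=
      (hA i k hij hk).trans (if_neg (by omega))
    have hk1 : τ.reg 36 - 1 = k := by rw [hτ]; push_cast; ring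
    have hread : ∀ z : ℤ, z = rankUpdate B b v e i k → ∀ i' k' : ℕ, i' < j → k' < j →
        Function.update (τ.arr M) ((i : ℤ) * W + k) z ((i' : ℤ) * W + k') =
          if i' = i ∧ k ≤ k' then rankUpdate B b v e i' k' else B i' k' := by
      intro z hz i' k' hi' hk'
      rw [Function.update_apply]
      split_ifs with h h' h'
      · obtain ⟨rfl, rfl⟩ := address_inj (by omega) (by omega) h
        exact hz
      · obtain ⟨rfl, rfl⟩ := address_inj (by omega) (by omega) h
        omega
      · have : k' ≠ k := by
          rintro rfl
          exact h (by rw [h'.1])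
        exact (hA i' k' hi' hk').trans (if_pos ⟨h'.1, by omega⟩)
      · exact (hA i' k' hi' hk').trans (if_neg (by omega))
    simp only [setCell, Prog.wp_cons, Prog.wp_nil, Prog.wp_assign, Prog.wp_store, Prog.wp_ite,
      Prog.wp_skip, cell, Expr.eval]
    -- The machine cannot multiply, but the factors `b i` and `b k` are bits, so every product in
    -- `rankUpdate` is a conditional addition.
    rcases hbit i with hbi | hbi <;> rcases hbit k with hbk | hbk <;>
    · simp [hk1, h37, h35, h1, h2 i hij, h2 k hk, h3 i hij, h3 k hk, hcell, HasMatrix, hbi, hbk]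
      exact hread _ (by simp [rankUpdate, hbi, hbk]; try ring)
  · rintro τ hf ⟨hτ, hA⟩ i' k' hi' hk'
    rw [hA i' k' hi' hk']
    simp

/-- Adds the update to all rows above the pivot. -/
def updateMatrix (M : ℕ) : Prog := Prog.loop (reg 37) (Prog.block
  [Prog.assign 37 (sub (reg 37) (const 1)), Prog.assign 36 (reg 30), updateRow M])

theorem wp_updateMatrix {N M W j : ℕ} {B : ℕ → ℕ → ℤ} {b v : ℕ → ℤ} {e : ℤ} {σ : State}
    (hM : 3 < M) (hT : HasTable σ W) (hB : HasMatrix σ M W j B) (hj : j < W) (hN : W ≤ N)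
    (hb : ∀ k : ℕ, k < j → σ.arr 2 k = b k) (hv : ∀ k : ℕ, k < j → σ.arr 3 k = v k)
    (hbit : ∀ k, b k = 0 ∨ b k = 1) (he : σ.reg 35 = e) (hJ : σ.reg 30 = j) (h37 : σ.reg 37 = j) :
    (updateMatrix M).wp N (fun τ => HasMatrix τ M W j (rankUpdate B b v e)) σ := by
  refine Prog.wp_for j (by omega) (fun i σ => σ.reg 37 = i ∧ HasMatrix σ M W j
      fun i' k => if i ≤ i' then rankUpdate B b v e i' k else B i' k) ?_ (fun k σ h => h.1) ?_ ?_
  · refine ⟨h37, fun i' k' hi' hk' => ?_⟩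
    exact (hB i' k' hi' hk').trans (if_neg (by omega)).symm
  · rintro i τ hi hf ⟨hτ, hA⟩
    have hk1 : τ.reg 37 - 1 = i := by rw [hτ]; push_cast; ring
    have h30 : τ.reg 30 = j :=
      (hf.reg 30 (by simp [Prog.regs, Prog.block, setCell, updateRow])).trans hJ
    simp only [Prog.wp_cons, Prog.wp_assign, Expr.eval]
    refine Prog.wp_consequence (wp_updateRow (i := i) (e := e) (v := v) hM ?_ hA hj hN ?_ ?_ hbit
      ?_ ?_ hi ?_) ?_
    · intro i' hi'
      exact (congrFun (hf.arr 1 (by simp [Prog.arrs, Prog.block, setCell, updateRow]; omega))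
        _).trans (hT i' hi')
    · intro k hk
      exact (congrFun (hf.arr 2 (by simp [Prog.arrs, Prog.block, setCell, updateRow]; omega))
        _).trans (hb k hk)
    · intro k hk
      exact (congrFun (hf.arr 3 (by simp [Prog.arrs, Prog.block, setCell, updateRow]; omega))
        _).trans (hv k hk)
    · simpa using (hf.reg 35 (by simp [Prog.regs, Prog.block, setCell, updateRow])).trans he
    · simp [hk1]
    · simp [h30]
    · intro υ hυ hf'
      refine ⟨?_, fun i' k hi' hk => ?_⟩
      · rw [hf'.reg 37 (by simp [Prog.regs, Prog.block, setCell, updateRow])]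
        simp [hk1]
      · rw [hυ i' k hi' hk]
        by_cases h : i' = i
        · subst h
          simp [rankUpdate]
        · by_cases h' : i + 1 ≤ i'
          · simp [h, h', show i ≤ i' by omega]
          · simp [h, h', show ¬ i ≤ i' by omega]
  · rintro τ hf ⟨hτ, hA⟩ i' k' hi' hk'
    rw [hA i' k' hi' hk']
    simp

/-- The scalar stored by the machine: zero if `z` is positive, else `√2 ^ a` times the `w`-th power
of the eighth root of unity. -/
noncomputable def scalar (z a w : ℤ) : ℂ := if 0 < z then 0 else (√2 : ℂ) ^ a * eighthRoot w

theorem scalar_mul_eighthRoot (z a w c : ℤ) :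
    scalar z a w * eighthRoot c = scalar z a (w + c) := by
  rw [scalar, scalar]
  split_ifs
  · rw [zero_mul]
  · rw [eighthRoot_add, mul_assoc]

theorem scalar_mul_inv_sqrt_two (z a w : ℤ) :
    scalar z a w * (√2 : ℂ)⁻¹ = scalar z (a - 1) w := by
  rw [scalar, scalar]
  split_ifs
  · rw [zero_mul]
  · rw [zpow_sub_one₀ sqrt_two_ne_zero_complex]
    ring

/-- The scalar in the registers `7`, `5` and `6`. -/
noncomputable def State.scalar (σ : State) : ℂ := RAM.scalar (σ.reg 7) (σ.reg 5) (σ.reg 6)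

/-- Multiplies the scalar by the factor that the variable of the current row contributes, and sets
the parameters of the update of the other rows. -/
def chooseUpdate (M : ℕ) : Prog :=
  Prog.ite (reg 33)
    (Prog.block [Prog.assign 34 (const 0),
      Prog.assign 35 (sub (add (parity (reg 32)) (parity (reg 32))) (const 1)),
      Prog.assign 5 (sub (reg 5) (const 1)),
      Prog.assign 6 (sub (reg 6) (reg 35))])
    (Prog.ite (reg 34)
      (Prog.block [Prog.assign 35 (cell M (reg 34) (reg 34)),
        Prog.assign 5 (sub (reg 5) (const 2))])
      (Prog.block [Prog.assign 35 (const 0),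
        Prog.assign 7 (add (reg 7) (get 2 (const 0)))]))

/-- The three branches are `gauss_odd`, `gauss_pivot` and `gauss_free`. Register 5 counts factors
`√2`, register 6 the eighth roots, and a positive register 7 means zero; it is kept nonnegative so
that adding an odd constant bit always makes it positive. -/
theorem wp_chooseUpdate {N M W j : ℕ} {B : ℕ → ℕ → ℤ} {σ : State}
    (hT : HasTable σ W) (hB : HasMatrix σ M W j B) (hsymm : ∀ i k, B i k = B k i)
    (hj0 : j ≠ 0) (hjW : j < W) (h32 : σ.reg 32 = B j j / 2) (h33 : σ.reg 33 = B j j % 2)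
    (hb : ∀ k : ℕ, k < j → σ.arr 2 k = rowBits B j k) (h7 : 0 ≤ σ.reg 7)
    (hpiv : ∃ l : ℕ, σ.reg 34 = l ∧ IsPivot (rowBits B j) j l) :
    (chooseUpdate M).wp N (fun τ => 0 ≤ τ.reg 7 ∧ ∃ l : ℕ, τ.reg 34 = l ∧ (l ≠ 0 → l < j) ∧
      σ.scalar * gauss W (j + 1) B = τ.scalar * gauss W j
        (rankUpdate B (rowBits B j) (fun k => if l = 0 then 0 else B l k) (τ.reg 35))) σ := by
  obtain ⟨l, h34, hl⟩ := hpiv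
  simp only [chooseUpdate, Prog.wp_cons, Prog.wp_nil, Prog.wp_assign, Prog.wp_ite, cell, eval_parity,
    Expr.eval]
  refine ⟨fun hodd => ?_, fun heven => ⟨fun hlpos => ?_, fun hlzero => ?_⟩⟩
  · refine ⟨by simpa using h7, 0, by simp, by simp, ?_⟩
    rw [h33] at hodd
    -- The sign congruent modulo 4 to the odd entry `B j j`; the program keeps its negative in
    -- register 35.
    have hc : (1 - 2 * (B j j / 2 % 2) : ℤ) = 1 ∨ (1 - 2 * (B j j / 2 % 2) : ℤ) = -1 := by omega
    rw [gauss_odd hsymm hj0 hjW hc (b := rowBits B j) (by omega)]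
    · simp only [State.scalar]
      rw [← mul_assoc, ← mul_assoc, scalar_mul_inv_sqrt_two, scalar_mul_eighthRoot]
      simp
      congr 3
      · rw [h32]
        ring
      · rw [h32]
        ring
    · intro k hk
      rw [rowBits, if_neg (by omega)]
      omega
  · rw [h34] at hlpos
    obtain ⟨hl0, hlj, hbl⟩ : l ≠ 0 ∧ l < j ∧ rowBits B j l = 1 := by
      rcases hl with hl | hl
      · omega
      · exact hl
    have hcell : σ.arr M (σ.arr 1 l + l) = B l l := by rw [hT l (by omega), hB l l hlj hlj]
    refine ⟨by simpa using h7, l, by simpa using h34, fun _ => hlj, ?_⟩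
    rw [h33] at heven
    rw [gauss_pivot hsymm hj0 hjW (h := B j j / 2) (b := rowBits B j) (by omega) ?_ ?_ hl0 hlj hbl]
    · simp only [State.scalar, h34, hcell]
      rw [← mul_assoc, ← mul_assoc, scalar_mul_inv_sqrt_two, scalar_mul_inv_sqrt_two]
      simp [hl0]
      left
      congr 1
      ring
    · rw [rowBits, if_pos ⟨rfl, by omega⟩]
      omega
    · intro k hk hk0
      rw [rowBits, if_neg (by omega)]
      omega
  · rw [h34] at hlzero
    obtain rfl : l = 0 := by omega
    have hz : ∀ k < j, k ≠ 0 → rowBits B j k = 0 := by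
      rcases hl with hl | hl
      · exact hl.2
      · exact absurd rfl hl.1
    have hb0 : σ.arr 2 0 = rowBits B j 0 := by exact_mod_cast hb 0 (by omega)
    have hbit := rowBits_eq B j 0
    refine ⟨by simp [hb0]; omega, 0, by simpa using h34, by simp, ?_⟩
    rw [h33] at heven
    rw [gauss_free hsymm hj0 hjW (h := B j j / 2) (b := rowBits B j) (by omega) ?_ ?_ hz]
    · have hup : rankUpdate B (rowBits B j) (fun _ => 0) 0 = B := by
        funext i k
        simp [rankUpdate]
      simp only [State.scalar]
      rcases hbit with h | h
      · simp [h, hb0, hup]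
      · have : 0 < σ.reg 7 + 1 := by omega
        simp [h, hb0, scalar, this]
    · rw [rowBits, if_pos ⟨rfl, by omega⟩]
      omega
    · intro k hk hk0
      rw [rowBits, if_neg (by omega)]
      omega

/-- One round of the elimination. -/
def eliminateRow (M : ℕ) : Prog := Prog.block
  [readRow M, chooseUpdate M, Prog.assign 36 (reg 30), copyRow M, Prog.assign 37 (reg 30),
    updateMatrix M, Prog.assign 30 (sub (reg 30) (const 1))]

/-- The invariant of the elimination is the product of the stored scalar and the average that
remains; symmetry of the matrix is maintained because every update is symmetric. -/
theorem wp_eliminateRow {N M W j : ℕ} {B : ℕ → ℕ → ℤ} {σ : State} (hM : 3 < M)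
    (hT : HasTable σ W) (hB : HasMatrix σ M W (j + 1) B) (hsymm : ∀ i k, B i k = B k i)
    (hJ : σ.reg 30 = j) (hj0 : j ≠ 0) (hjW : j < W) (hN : W ≤ N) (h7 : 0 ≤ σ.reg 7) :
    (eliminateRow M).wp N (fun τ => τ.reg 30 = (j : ℤ) - 1 ∧ 0 ≤ τ.reg 7 ∧
      ∃ B' : ℕ → ℕ → ℤ, (∀ i k, B' i k = B' k i) ∧ HasMatrix τ M W j B' ∧
        σ.scalar * gauss W (j + 1) B = τ.scalar * gauss W j B') σ := by
  rw [eliminateRow, Prog.wp_cons]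
  refine Prog.wp_consequence (wp_readRow hM hT hB hJ hjW hN) ?_
  rintro σ₁ ⟨h32, h33, hB₁, hb, hpiv⟩ hf₁
  have hr₁ : ∀ r, r ≤ 30 → σ₁.reg r = σ.reg r := fun r hr =>
    hf₁.reg r (by simp [readRow, readBits, setCell, Prog.regs, Prog.block]; omega)
  have hT₁ : σ₁.arr 1 = σ.arr 1 :=
    hf₁.arr 1 (by simp [readRow, readBits, setCell, Prog.arrs, Prog.block]; omega)
  have hTσ₁ : HasTable σ₁ W := fun i hi => by rw [hT₁, hT i hi]
  rw [Prog.wp_cons]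
  refine Prog.wp_consequence (wp_chooseUpdate hTσ₁ hB₁ hsymm hj0 hjW h32 h33 hb
    (by rw [hr₁ 7 (by omega)]; exact h7) hpiv) ?_
  rintro σ₂ ⟨h7₂, l, h34, hl, hval⟩ hf₂
  have ha₂ : σ₂.arr = σ₁.arr := by
    funext a
    exact hf₂.arr a (by simp [chooseUpdate, Prog.arrs, Prog.block])
  have h30₂ : σ₂.reg 30 = j :=
    ((hf₂.reg 30 (by simp [chooseUpdate, Prog.regs, Prog.block])).trans (hr₁ 30 le_rfl)).trans hJ
  have hval' : σ.scalar * gauss W (j + 1) B = σ₂.scalar * gauss W j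
      (rankUpdate B (rowBits B j) (fun k => if l = 0 then 0 else B l k) (σ₂.reg 35)) := by
    rw [← hval, State.scalar, State.scalar, hr₁ 7 (by omega), hr₁ 5 (by omega), hr₁ 6 (by omega)]
  rw [Prog.wp_cons, Prog.wp_assign, Prog.wp_cons]
  refine Prog.wp_consequence (wp_copyRow (B := B) (j := j) (W := W) (l := l) hM ?_ ?_ hjW hN ?_ hl
    ?_) ?_
  · intro i hi
    change σ₂.arr 1 i = _
    rw [ha₂, hTσ₁ i hi]
  · intro i k hi hk
    change σ₂.arr M _ = _
    rw [ha₂, hB₁ i k hi hk]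
  · simpa using h34
  · simpa [Expr.eval] using h30₂
  intro σ₃ hv hf₃
  have hr₃ : ∀ r, r ≠ 36 → σ₃.reg r = σ₂.reg r := fun r hr => by
    rw [hf₃.reg r (by simpa [copyRow, Prog.regs, Prog.block] using hr)]
    simp [hr]
  have ha₃ : ∀ a, a ≠ 3 → σ₃.arr a = σ₁.arr a := fun a ha => by
    rw [hf₃.arr a (by simpa [copyRow, Prog.arrs, Prog.block] using ha), ← ha₂]
  rw [Prog.wp_cons, Prog.wp_assign, Prog.wp_cons]
  refine Prog.wp_consequence (wp_updateMatrix (B := B) (j := j) (W := W) (b := rowBits B j)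
    (v := fun k => if l = 0 then 0 else B l k) (e := σ₂.reg 35) hM ?_ ?_ hjW hN ?_ hv
    (rowBits_eq B j) ?_ ?_ ?_) ?_
  · intro i hi
    change σ₃.arr 1 i = _
    rw [ha₃ 1 (by decide), hTσ₁ i hi]
  · intro i k hi hk
    change σ₃.arr M _ = _
    rw [ha₃ M (by omega), hB₁ i k hi hk]
  · intro k hk
    change σ₃.arr 2 _ = _
    rw [ha₃ 2 (by decide), hb k hk]
  · simpa using hr₃ 35 (by decide)
  · simpa using (hr₃ 30 (by decide)).trans h30₂
  · simpa [Expr.eval] using (hr₃ 30 (by decide)).trans h30₂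
  intro σ₄ hB₄ hf₄
  have hr₄ : ∀ r, r ≤ 30 → σ₄.reg r = σ₂.reg r := fun r hr => by
    rw [hf₄.reg r (by simp [updateMatrix, updateRow, setCell, Prog.regs, Prog.block]; omega)]
    rw [← hr₃ r (by omega)]
    simp [show r ≠ 37 by omega]
  simp only [Prog.wp_cons, Prog.wp_assign, Prog.wp_nil, Expr.eval]
  refine ⟨?_, ?_, _, rankUpdate_symm hsymm _ _ _, hB₄, ?_⟩
  · simp [hr₄ 30 le_rfl, h30₂]
  · simpa [hr₄ 7 (by omega)] using h7₂
  · rw [hval']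
    simp [State.scalar, hr₄ 7 (by omega), hr₄ 5 (by omega), hr₄ 6 (by omega)]

/-- Replaces the matrix by the scalar that is its normalized exponential sum. -/
def eliminate (M : ℕ) : Prog := Prog.block
  [Prog.assign 30 (sub (reg 1) (const 1)), Prog.loop (reg 30) (eliminateRow M),
    Prog.assign 6 (add (reg 6) (add (get M (const 0)) (get M (const 0))))]

/-- After `W - 1` rounds only the constant index 0 is left, and its average is i to the power of the
corner entry, so twice that entry is added to the exponent of the eighth root. -/
theorem wp_eliminate {N M W : ℕ} {B : ℕ → ℕ → ℤ} {σ : State} (hM : 3 < M)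
    (hT : HasTable σ W) (hB : HasMatrix σ M W W B) (hsymm : ∀ i k, B i k = B k i)
    (hW : σ.reg 1 = W) (hW0 : 0 < W) (hN : W ≤ N) (h7 : 0 ≤ σ.reg 7) :
    (eliminate M).wp N (fun τ => 0 ≤ τ.reg 7 ∧ τ.scalar = σ.scalar * gauss W W B) σ := by
  obtain ⟨j, rfl⟩ : ∃ j, W = j + 1 := ⟨W - 1, by omega⟩
  simp only [eliminate, Prog.wp_cons, Prog.wp_assign, Expr.eval]
  refine Prog.wp_for j (by omega) (fun k τ => τ.reg 30 = k ∧ 0 ≤ τ.reg 7 ∧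
    ∃ B' : ℕ → ℕ → ℤ, (∀ i k, B' i k = B' k i) ∧ HasMatrix τ M (j + 1) (k + 1) B' ∧
      σ.scalar * gauss (j + 1) (j + 1) B = τ.scalar * gauss (j + 1) (k + 1) B') ?_
    (fun k σ h => h.1) ?_ ?_
  · refine ⟨by simp [hW], by simpa using h7, B, hsymm, hB, ?_⟩
    simp [State.scalar]
  · rintro k τ hk hf ⟨h30, h7', B', hsymm', hB', hval⟩
    have hT' : HasTable τ (j + 1) := by
      intro i hi
      rw [hf.arr 1 ?_]
      · exact hT i hi
      · simp [eliminateRow, readRow, readBits, chooseUpdate, copyRow, updateMatrix, updateRow,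
          setCell, Prog.arrs, Prog.block]
        omega
    refine Prog.wp_mono ?_ (wp_eliminateRow hM hT' hB' hsymm' h30 (by omega) (by omega) hN h7')
    rintro υ ⟨h1, h2, B'', h3, h4, h5⟩
    exact ⟨by rw [h1]; push_cast; ring, h2, B'', h3, h4, hval.trans h5⟩
  · rintro τ hf ⟨-, h7', B', hsymm', hB', hval⟩
    have h0 : τ.arr M 0 = B' 0 0 := by simpa using hB' 0 0 (by omega) (by omega)
    refine ⟨by simpa using h7', ?_⟩
    rw [hval, zero_add, gauss_one, State.scalar, State.scalar, scalar_mul_eighthRoot]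
    simp [Expr.eval, h0, two_mul]

/-! ### Reading an expression on the machine -/

/-- A product of two unknowns with a coefficient. An unknown is given by its index, or it is a
summation variable: the machine gives it an index when it meets it. -/
structure Term (k : ℕ) where
  /-- the coefficient -/
  coeff : ℤ
  /-- the first unknown -/
  fst : ℕ ⊕ Fin k
  /-- the second unknown -/
  snd : ℕ ⊕ Fin k

section Parsing

variable {k : ℕ}

/-- The index of an unknown. -/
def index (κ : Fin k → ℕ) : ℕ ⊕ Fin k → ℕ := Sum.elim id κ

/-- The unknown of a factor of a monomial; the unknown with index `0` is `1`. -/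
def unknown : Option (Fin k) → ℕ ⊕ Fin k
  | none => .inl 0
  | some v => .inr v

/-- A summation variable has an index already. -/
def Indexed (κ : Fin k → ℕ) (u : ℕ ⊕ Fin k) : Prop := ∀ v, u = .inr v → κ v ≠ 0

/-- More variables have an index. -/
def Extends (κ κ' : Fin k → ℕ) : Prop := ∀ v, κ v ≠ 0 → κ' v = κ v

theorem Extends.trans {κ κ' κ'' : Fin k → ℕ} (h : Extends κ κ') (h' : Extends κ' κ'') :
    Extends κ κ'' := fun v hv => by rw [h' v (by rwa [h v hv]), h v hv]

theorem Indexed.index_eq {κ κ' : Fin k → ℕ} {u : ℕ ⊕ Fin k} (hu : Indexed κ u)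
    (h : Extends κ κ') : index κ' u = index κ u := by
  cases u with
  | inl i => rfl
  | inr v => exact h v (hu v rfl)

theorem Indexed.mono {κ κ' : Fin k → ℕ} {u : ℕ ⊕ Fin k} (hu : Indexed κ u)
    (h : Extends κ κ') : Indexed κ' u := fun v hv => by
  rw [h v (hu v hv)]
  exact hu v hv

/-- The value of a term. -/
def Term.value (κ : Fin k → ℕ) (x : ℕ → ℤ) (t : Term k) : ℤ :=
  t.coeff * (x (index κ t.fst) * x (index κ t.snd))

/-- The integers of the array `A` from address `p` on. -/
def StreamAt (A : ℤ → ℤ) (p : ℤ) (rest : List ℤ) : Prop := ∀ i : ℕ, A (p + i) = rest.getD i 0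

theorem StreamAt.head {A : ℤ → ℤ} {p z : ℤ} {rest : List ℤ} (h : StreamAt A p (z :: rest)) :
    A p = z := by simpa using h 0

theorem StreamAt.tail {A : ℤ → ℤ} {p z : ℤ} {rest : List ℤ} (h : StreamAt A p (z :: rest)) :
    StreamAt A (p + 1) rest := fun i => by
  have := h (i + 1)
  rw [List.getD_cons_succ] at this
  rw [← this]
  push_cast
  congr 1
  ring

/-- The state while an expression is read: `rest` is what is still to be read, `κ` are the indices
in the array `mp`, all at least `lo`, and `B` is the matrix in the array `M`. -/
structure Parse (mp M W lo : ℕ) (σ : State) (rest : List ℤ) (κ : Fin k → ℕ)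
    (B : ℕ → ℕ → ℤ) : Prop where
  table : HasTable σ W
  stream : StreamAt (σ.arr 0) (σ.reg 3) rest
  matrix : HasMatrix σ M W W B
  symm : ∀ i j, B i j = B j i
  map_zero : σ.arr mp 0 = 0
  map : ∀ v : Fin k, σ.arr mp ((v : ℤ) + 1) = κ v
  -- Each integer still to be read creates at most one new index, so the budget `nx + rest.length ≤
  -- W` keeps all indices below `W`.
  next : ∃ nx : ℕ, σ.reg 4 = nx ∧ lo ≤ nx ∧ nx + rest.length ≤ W ∧
    ∀ v, κ v ≠ 0 → lo ≤ κ v ∧ κ v < nx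
  inj : ∀ v w, κ v ≠ 0 → κ v = κ w → v = w

/-- The state after terms have been read. -/
def Parsed (mp M W lo : ℕ) (τ : State) (rest : List ℤ) (κ : Fin k → ℕ) (B : ℕ → ℕ → ℤ)
    (L : List (Term k)) : Prop :=
  ∃ (κ' : Fin k → ℕ) (B' : ℕ → ℕ → ℤ), Parse mp M W lo τ rest κ' B' ∧ Extends κ κ' ∧
    (∀ t ∈ L, Indexed κ' t.fst ∧ Indexed κ' t.snd) ∧
    ∀ x : ℕ → ℤ, x 0 = 1 → (∀ i, x i = 0 ∨ x i = 1) →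
      quadForm W B' x = quadForm W B x + (L.map (Term.value κ' x)).sum

variable {N mp M W lo : ℕ} {σ τ : State} {rest : List ℤ} {κ : Fin k → ℕ} {B : ℕ → ℕ → ℤ}

theorem Parse.of_eq (h : Parse mp M W lo σ rest κ B) (h3 : τ.reg 3 = σ.reg 3)
    (h4 : τ.reg 4 = σ.reg 4) (harr : τ.arr = σ.arr) : Parse mp M W lo τ rest κ B where
  table := by rw [HasTable, harr]; exact h.table
  stream := by rw [h3, harr]; exact h.stream
  matrix := by rw [HasMatrix, harr]; exact h.matrix
  symm := h.symm
  map_zero := by rw [harr]; exact h.map_zero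
  map := by rw [harr]; exact h.map
  next := by rw [h4]; exact h.next
  inj := h.inj

theorem Parsed.refl (h : Parse mp M W lo σ rest κ B) : Parsed mp M W lo σ rest κ B [] :=
  ⟨κ, B, h, fun _ _ => rfl, by simp, by simp⟩

/-- Variables in terms already read have their indices, and later extensions of the numbering do not
change these, so the values of earlier terms persist. -/
theorem Parsed.append {κ' : Fin k → ℕ} {B' : ℕ → ℕ → ℤ} {L L' : List (Term k)}
    (hκ : Extends κ κ') (hL : ∀ t ∈ L, Indexed κ' t.fst ∧ Indexed κ' t.snd)
    (hB : ∀ x : ℕ → ℤ, x 0 = 1 → (∀ i, x i = 0 ∨ x i = 1) →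
      quadForm W B' x = quadForm W B x + (L.map (Term.value κ' x)).sum)
    (h : Parsed mp M W lo τ rest κ' B' L') : Parsed mp M W lo τ rest κ B (L ++ L') := by
  obtain ⟨κ'', B'', hP, hκ', hL', hB'⟩ := h
  refine ⟨κ'', B'', hP, hκ.trans hκ', fun t ht => ?_, fun x h0 hx => ?_⟩
  · rcases List.mem_append.1 ht with ht | ht
    · exact ⟨(hL t ht).1.mono hκ', (hL t ht).2.mono hκ'⟩
    · exact hL' t ht
  · rw [hB' x h0 hx, hB x h0 hx, List.map_append, List.sum_append, add_assoc]
    congr 3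
    refine List.map_congr_left fun t ht => ?_
    rw [Term.value, Term.value, (hL t ht).1.index_eq hκ', (hL t ht).2.index_eq hκ']

theorem Parse.index_lt (h : Parse mp M W lo σ rest κ B) (hW : 0 < W) (a : Option (Fin k)) :
    index κ (unknown a) < W := by
  cases a with
  | none => exact hW
  | some v =>
    obtain ⟨nx, -, -, h1, h2⟩ := h.next
    by_cases hv : κ v = 0
    · exact lt_of_eq_of_lt hv hW
    · have := (h2 v hv).2
      change κ v < W
      omega

/-- Reads an integer into a register. -/
def fetch (r : ℕ) : Prog :=
  Prog.block [Prog.assign r (get 0 (reg 3)), Prog.assign 3 (add (reg 3) (const 1))]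

theorem wp_fetch {r : ℕ} {z : ℤ} (h3 : r ≠ 3) (h4 : r ≠ 4)
    (h : Parse mp M W lo σ (z :: rest) κ B) :
    (fetch r).wp N (fun τ => τ.reg r = z ∧ Parse mp M W lo τ rest κ B) σ := by
  simp only [fetch, Prog.wp_cons, Prog.wp_nil, Prog.wp_assign, Expr.eval]
  refine ⟨by simp [h3, h.stream.head], h.table, ?_, h.matrix, h.symm, h.map_zero, h.map, ?_, h.inj⟩
  · simpa [h3.symm] using h.stream.tail
  · obtain ⟨nx, h1, h2, h5, h6⟩ := h.next
    refine ⟨nx, by simpa [h4.symm] using h1, h2, ?_, h6⟩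
    simp only [List.length_cons] at h5
    omega

/-- Reads a factor of a monomial; its index goes to the register `r`. -/
def readFactor (mp r : ℕ) : Prog := Prog.block
  [fetch 23,
    Prog.ite (reg 23) (Prog.ite (get mp (reg 23)) Prog.skip
      (Prog.block [Prog.store mp (reg 23) (reg 4), Prog.assign 4 (add (reg 4) (const 1))]))
      Prog.skip,
    Prog.assign r (get mp (reg 23))]

/-- Indices are handed out in order of first occurrence, so their number is bounded by the input
length and not by the declared number of variables, which may be far larger. An entry 0 of the map
means that no index has been assigned; the entry for the constant is never written, which gives it
the index 0. -/
theorem wp_readFactor {r : ℕ} {a : Option (Fin k)} (h3 : r ≠ 3) (h4 : r ≠ 4) (hmp : 3 < mp)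
    (hM : M ≠ mp) (hlo : 0 < lo)
    (h : Parse mp M W lo σ (ClifExpr.factorCode a :: rest) κ B) :
    (readFactor mp r).wp N (fun τ => ∃ κ', Parse mp M W lo τ rest κ' B ∧ Extends κ κ' ∧
      Indexed κ' (unknown a) ∧ τ.reg r = index κ' (unknown a)) σ := by
  obtain ⟨nx, hnx, hlonx, hnxW, hκ⟩ := h.next
  rw [List.length_cons] at hnxW
  have hhead := h.stream.head
  have hnx0 : (0 : ℤ) < nx := by omega
  cases a with
  | none =>
    simp only [readFactor, fetch, Prog.wp_cons, Prog.wp_nil, Prog.wp_assign, Prog.wp_ite,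
      Prog.wp_skip, Expr.eval]
    simp only [ClifExpr.factorCode] at hhead
    simp [hhead]
    refine ⟨κ, ⟨h.table, ?_, h.matrix, h.symm, h.map_zero, h.map,
      ⟨nx, ?_, hlonx, by omega, hκ⟩, h.inj⟩, fun _ _ => rfl, (fun v hv => by cases hv), ?_⟩
    · simpa [h3.symm] using h.stream.tail
    · simpa [h4.symm] using hnx
    · simp [h.map_zero, index, unknown]
  | some v =>
    have hmap := h.map v
    have hpos : (0 : ℤ) < (v : ℤ) + 1 := by omega
    simp only [readFactor, fetch, Prog.wp_cons, Prog.wp_nil, Prog.wp_assign, Prog.wp_ite,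
      Prog.wp_store, Prog.wp_skip, Expr.eval]
    simp only [ClifExpr.factorCode] at hhead
    simp [hhead, hpos, hmap]
    refine ⟨fun hv => ?_, fun hv => ?_⟩
    · refine ⟨κ, ⟨h.table, ?_, h.matrix, h.symm, h.map_zero, h.map,
        ⟨nx, ?_, hlonx, by omega, hκ⟩, h.inj⟩, fun _ _ => rfl, ?_, ?_⟩
      · simpa [h3.symm] using h.stream.tail
      · simpa [h4.symm] using hnx
      · rintro v' hv'
        cases hv'
        omega
      · simp [index, unknown]
    · have hcode : ∀ v' : Fin k, v' ≠ v → (v' : ℤ) + 1 ≠ (v : ℤ) + 1 := fun v' hv' h => by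
        exact hv' (Fin.ext (by omega))
      -- All earlier indices are below the counter, so the numbering stays injective.
      have hfresh : ∀ v', v' ≠ v → κ v' ≠ nx := fun v' hv' h' => by
        have := hκ v' (by omega)
        omega
      have hmp0 : (0 : ℕ) ≠ mp := by omega
      have hmp1 : (1 : ℕ) ≠ mp := by omega
      refine ⟨Function.update κ v nx, ⟨?_, ?_, ?_, h.symm, ?_, ?_, ⟨nx + 1, ?_, by omega, by omega,
        ?_⟩, ?_⟩, ?_, ?_, ?_⟩
      · intro i hi
        simp [hmp1, h.table i hi]
      · simpa [h3.symm, hmp0] using h.stream.tail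
      · intro i j hi hj
        simp [hM, h.matrix i j hi hj]
      · simp [h.map_zero, show (0 : ℤ) ≠ (v : ℤ) + 1 by omega]
      · intro v'
        by_cases hv' : v' = v
        · subst hv'
          simp [hnx]
        · simp [hv', hcode v' hv', h.map v']
      · simp [h4.symm, hnx]
      · intro v' hv'
        by_cases hvv : v' = v
        · subst hvv
          simp
          omega
        · simp only [Function.update_of_ne hvv] at hv' ⊢
          have := hκ v' hv'
          omega
      · intro v₁ v₂ hne heq
        by_cases hv1 : v₁ = v
        · by_cases hv2 : v₂ = v
          · rw [hv1, hv2]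
          · rw [hv1, Function.update_self, Function.update_of_ne hv2] at heq
            exact absurd heq.symm (hfresh v₂ hv2)
        · by_cases hv2 : v₂ = v
          · rw [hv2, Function.update_self, Function.update_of_ne hv1] at heq
            exact absurd heq (hfresh v₁ hv1)
          · rw [Function.update_of_ne hv1] at hne
            rw [Function.update_of_ne hv1, Function.update_of_ne hv2] at heq
            exact h.inj v₁ v₂ hne heq
      · intro v' hv'
        refine Function.update_of_ne ?_ _ _
        rintro rfl
        exact hv' hv
      · rintro v' hv'
        cases hv'
        simp
        omega
      · simp [index, unknown, hnx]

/-- Addition to an entry of a matrix. -/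
def addAt (B : ℕ → ℕ → ℤ) (i j : ℕ) (c : ℤ) (i' j' : ℕ) : ℤ :=
  if i' = i ∧ j' = j then B i' j' + c else B i' j'

theorem quadForm_addAt {i j : ℕ} (hi : i < W) (hj : j < W) (B : ℕ → ℕ → ℤ) (c : ℤ) (x : ℕ → ℤ) :
    quadForm W (addAt B i j c) x = quadForm W B x + c * (x i * x j) := by
  have h : ∀ i' j' : ℕ, addAt B i j c i' j' * (x i' * x j') =
      B i' j' * (x i' * x j') + if i' = i then if j' = j then c * (x i * x j) else 0 else 0 := by
    intro i' j'
    rw [addAt]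
    by_cases h1 : i' = i
    · by_cases h2 : j' = j
      · subst h1 h2
        simp
        ring
      · simp [h2]
    · simp [h1]
  simp only [quadForm, h, Finset.sum_add_distrib]
  simp [hi, hj]

/-- Adds the value of an expression to an entry of a matrix. -/
def addEntry (M r r' : ℕ) (e : Expr) : Prog :=
  setCell M (reg r) (reg r') (add (cell M (reg r) (reg r')) e)

theorem HasMatrix.update {i j : ℕ} {c : ℤ} (h : HasMatrix σ M W W B) (hj : j < W) :
    HasMatrix ⟨σ.reg, Function.update σ.arr M (Function.update (σ.arr M) ((i : ℤ) * W + j)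
      (B i j + c))⟩ M W W (addAt B i j c) := by
  intro i' j' hi' hj'
  simp only [Function.update_self]
  rw [Function.update_apply, addAt]
  by_cases hij : i' = i ∧ j' = j
  · rw [hij.1, hij.2]
    simp
  · rw [h i' j' hi' hj', if_neg hij, if_neg fun he => hij (address_inj hj' hj he)]

/-- An expression or its negative. -/
def signed (neg : Bool) (e : Expr) : Expr := if neg then sub (const 0) e else e

/-- The sign as an integer. -/
def sign (neg : Bool) : ℤ := if neg then -1 else 1

theorem eval_signed (neg : Bool) (e : Expr) (σ : State) :
    (signed neg e).eval σ = sign neg * e.eval σ := by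
  cases neg <;> simp [signed, sign, Expr.eval]

theorem wp_addEntry_diag {r i : ℕ} {c : ℤ} {e : Expr} (hM : 3 < M) (hmp : M ≠ mp)
    (h : Parse mp M W lo σ rest κ B) (hr : σ.reg r = i) (hi : i < W)
    (he : e.eval σ = c) : (addEntry M r r e).wp N (fun τ =>
      Parse mp M W lo τ rest κ (addAt B i i c)) σ := by
  have h1 : σ.arr 1 i = (i : ℤ) * W := h.table i hi
  simp only [addEntry, setCell, cell, Prog.wp_store, Expr.eval, hr, h1, he, h.matrix i i hi hi]
  refine ⟨?_, ?_, h.matrix.update hi, ?_, ?_, ?_, h.next, h.inj⟩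
  · intro i' hi'
    simp [show 1 ≠ M by omega, h.table i' hi']
  · simpa [show 0 ≠ M by omega] using h.stream
  · intro i' j'
    rw [addAt, addAt, h.symm i' j']
    simp only [and_comm]
  · simpa [hmp.symm] using h.map_zero
  · simpa [hmp.symm] using h.map

/-- Adding `c` at both transposed positions adds 2c x_i x_j to the form, so no halving is needed.
For `i = j` both additions hit one cell; the second therefore evaluates in the memory left by the
first. -/
theorem wp_addEntry_symm {r r' i j : ℕ} {c : ℤ} {e : Expr} (hM : 3 < M) (hmp : M ≠ mp)
    (h : Parse mp M W lo σ rest κ B) (hr : σ.reg r = i) (hr' : σ.reg r' = j) (hi : i < W)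
    (hj : j < W) (he : ∀ σ' : State, σ'.reg = σ.reg → e.eval σ' = c) :
    (Prog.block [addEntry M r r' e, addEntry M r' r e]).wp N (fun τ =>
      Parse mp M W lo τ rest κ (addAt (addAt B i j c) j i c)) σ := by
  have h1 : ∀ i : ℕ, i < W → σ.arr 1 i = (i : ℤ) * W := h.table
  have hM1 : 1 ≠ M := by omega
  have hup := h.matrix.update (i := i) (c := c) hj
  have hup' := hup.update (i := j) (c := c) hi
  have hval := hup j i hj hi
  have he1 := he σ rfl
  have he2 := he ⟨σ.reg, Function.update σ.arr M (Function.update (σ.arr M) ((i : ℤ) * W + j)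
      (B i j + c))⟩ rfl
  simp only [Function.update_self] at hval hup'
  simp only [addEntry, setCell, cell, Prog.wp_cons, Prog.wp_nil, Prog.wp_store, Expr.eval, hr, hr',
    h1 i hi, he1, h.matrix i j hi hj]
  simp only [Function.update_self, Function.update_of_ne hM1, h1 j hj, hval, he2]
  refine ⟨?_, ?_, hup', ?_, ?_, ?_, h.next, h.inj⟩
  · intro i' hi'
    simp [hM1, h.table i' hi']
  · simpa [show 0 ≠ M by omega] using h.stream
  · intro i' j'
    have := h.symm i' j'
    grind [addAt]
  · simpa [hmp.symm] using h.map_zero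
  · simpa [hmp.symm] using h.map

end Parsing

/-! ### Reading lists of monomials into the matrix -/

section Lists

variable {k : ℕ} {N mp M W lo : ℕ} {σ τ : State} {rest : List ℤ} {κ : Fin k → ℕ} {B : ℕ → ℕ → ℤ}

/-- Repeats a program as often as the register `r` says. -/
def repeatProg (r : ℕ) (body : Prog) : Prog :=
  Prog.loop (reg r) (Prog.block [Prog.assign r (sub (reg r) (const 1)), body])

/-- The rule for reading a list of items, with a value in register `26` for each position. -/
theorem wp_repeatProg {ι : Type} {r : ℕ} {body : Prog} (h3 : r ≠ 3) (h4 : r ≠ 4) (h26 : r ≠ 26)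
    (hr : r ∉ body.regs) (item : ι → List ℤ) (terms : ι → List (Term k)) (f : ℕ → ℤ) (l : List ι)
    (hbody : ∀ (i : ℕ) (a : ι) (rest : List ℤ) (κ : Fin k → ℕ) (B : ℕ → ℕ → ℤ) (σ : State),
      l[i]? = some a → σ.reg 26 = f i → Parse mp M W lo σ (item a ++ rest) κ B →
      body.wp N (fun τ => τ.reg 26 = f (i + 1) ∧ Parsed mp M W lo τ rest κ B (terms a)) σ)
    (h : Parse mp M W lo σ (l.flatMap item ++ rest) κ B) (hf : σ.reg 26 = f 0)
    (hl : σ.reg r = l.length) (hN : l.length ≤ N) :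
    (repeatProg r body).wp N (fun τ => Parsed mp M W lo τ rest κ B (l.flatMap terms)) σ := by
  refine Prog.wp_for l.length hN (fun j σ => σ.reg r = j ∧ ∃ l₁ l₂ : List ι, l = l₁ ++ l₂ ∧
    l₂.length = j ∧ σ.reg 26 = f l₁.length ∧
    Parsed mp M W lo σ (l₂.flatMap item ++ rest) κ B (l₁.flatMap terms)) ?_ (fun j σ h => h.1) ?_ ?_
  · exact ⟨hl, [], l, rfl, rfl, hf, Parsed.refl h⟩
  · rintro j τ hj hF ⟨hτ, l₁, l₂, hll, hlen, h26', κ', B', hP, hκ, hL, hB⟩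
    obtain ⟨a, l₃, rfl⟩ : ∃ a l₃, l₂ = a :: l₃ := by
      cases l₂ with
      | nil => simp at hlen
      | cons a l₃ => exact ⟨a, l₃, rfl⟩
    rw [Prog.wp_cons, Prog.wp_assign, Prog.wp_cons]
    refine Prog.wp_consequence (hbody l₁.length a (l₃.flatMap item ++ rest) κ' B' _ ?_ ?_ ?_) ?_
    · simp [hll]
    · simpa [h26.symm] using h26'
    · rw [List.flatMap_cons, List.append_assoc] at hP
      exact hP.of_eq (by simp [h3.symm]) (by simp [h4.symm]) rfl
    · rintro υ ⟨h1, h2⟩ hf'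
      refine ⟨?_, l₁ ++ [a], l₃, by simp [hll], by simpa using hlen, by simpa using h1, ?_⟩
      · rw [hf'.reg r hr]
        simp [Expr.eval, hτ]
      · rw [List.flatMap_append, List.flatMap_singleton]
        exact Parsed.append hκ hL hB h2
  · rintro τ hF ⟨hτ, l₁, l₂, hll, hlen, h26', hP⟩
    obtain rfl := List.eq_nil_of_length_eq_zero hlen
    rw [List.append_nil] at hll
    rw [hll]
    simpa using hP

/-- Reads the monomials of `P⁽¹⁾`. -/
def readLinear (mp M : ℕ) (neg : Bool) : Prog := repeatProg 20 (Prog.block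
  [fetch 22, readFactor mp 24, addEntry M 24 24 (signed neg (reg 22))])

/-- The term of a monomial of `P⁽¹⁾`. -/
def linearTerm (neg : Bool) (x : ℤ × Option (Fin k)) : Term k :=
  ⟨sign neg * x.1, unknown x.2, unknown x.2⟩

/-- A linear monomial goes to the diagonal, since a² = a for bits and for the constant 1. -/
theorem wp_readLinear {neg : Bool} {l : List (ℤ × Option (Fin k))} (hM : 3 < M) (hmp : 3 < mp)
    (hne : M ≠ mp) (hlo : 0 < lo) (hW : W ≤ N)
    (h : Parse mp M W lo σ (l.flatMap (fun x => [x.1, ClifExpr.factorCode x.2]) ++ rest) κ B)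
    (hl : σ.reg 20 = l.length) :
    (readLinear mp M neg).wp N
      (fun τ => Parsed mp M W lo τ rest κ B (l.map (linearTerm neg))) σ := by
  have hlen : l.length ≤ N := by
    obtain ⟨nx, -, -, h1, -⟩ := h.next
    simp [List.length_flatMap] at h1
    omega
  rw [← List.flatMap_singleton' (l.map _), List.flatMap_map]
  refine wp_repeatProg (by decide) (by decide) (by decide)
    (by simp [fetch, readFactor, addEntry, setCell, Prog.regs, Prog.block]) _ _
    (fun _ => σ.reg 26) l ?_ h rfl hl hlen
  rintro i ⟨c, a⟩ rest κ B σ' - h26 h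
  rw [Prog.wp_cons]
  refine Prog.wp_consequence (wp_fetch (by decide) (by decide) h) ?_
  rintro σ₁ ⟨h22, h₁⟩ hf₁
  rw [Prog.wp_cons]
  refine Prog.wp_consequence (wp_readFactor (by decide) (by decide) hmp hne hlo h₁) ?_
  rintro σ₂ ⟨κ', h₂, hκ, hind, h24⟩ hf₂
  have hlt := h₂.index_lt (by obtain ⟨nx, h1, h2, h3, h4⟩ := h₂.next; omega) a
  have h22' : σ₂.reg 22 = c := by
    rw [hf₂.reg 22 (by simp [readFactor, fetch, Prog.regs, Prog.block]), h22]
  rw [Prog.wp_cons]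
  refine Prog.wp_consequence (wp_addEntry_diag (c := sign neg * c) hM hne h₂ h24 hlt
    (by rw [eval_signed, Expr.eval, h22'])) ?_
  intro σ₃ h₃ hf₃
  rw [Prog.wp_nil]
  refine ⟨?_, κ', _, h₃, hκ, ?_, fun x h0 hx => ?_⟩
  · rw [hf₃.reg 26 (by simp [addEntry, setCell, Prog.regs]),
      hf₂.reg 26 (by simp [readFactor, fetch, Prog.regs, Prog.block]),
      hf₁.reg 26 (by simp [fetch, Prog.regs, Prog.block]), h26]
  · simpa [linearTerm] using hind
  · rw [quadForm_addAt hlt hlt]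
    simp [linearTerm, Term.value]

/-- Reads the monomials of `P⁽²⁾`. -/
def readQuadratic (mp M : ℕ) (neg : Bool) : Prog := repeatProg 20 (Prog.block
  [fetch 22, readFactor mp 24, readFactor mp 25,
    Prog.block [addEntry M 24 25 (signed neg (reg 22)), addEntry M 25 24 (signed neg (reg 22))]])

/-- The term of a monomial of `P⁽²⁾`. -/
def quadraticTerm (neg : Bool) (x : ℤ × Option (Fin k) × Option (Fin k)) : Term k :=
  ⟨sign neg * (2 * x.1), unknown x.2.1, unknown x.2.2⟩

theorem wp_readQuadratic {neg : Bool} {l : List (ℤ × Option (Fin k) × Option (Fin k))}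
    (hM : 3 < M) (hmp : 3 < mp) (hne : M ≠ mp) (hlo : 0 < lo) (hW : W ≤ N)
    (h : Parse mp M W lo σ (l.flatMap (fun x =>
      [x.1, ClifExpr.factorCode x.2.1, ClifExpr.factorCode x.2.2]) ++ rest) κ B)
    (hl : σ.reg 20 = l.length) :
    (readQuadratic mp M neg).wp N
      (fun τ => Parsed mp M W lo τ rest κ B (l.map (quadraticTerm neg))) σ := by
  have hlen : l.length ≤ N := by
    obtain ⟨nx, -, -, h1, -⟩ := h.next
    simp [List.length_flatMap] at h1
    omega
  rw [← List.flatMap_singleton' (l.map _), List.flatMap_map]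
  refine wp_repeatProg (by decide) (by decide) (by decide)
    (by simp [fetch, readFactor, addEntry, setCell, Prog.regs, Prog.block]) _ _
    (fun _ => σ.reg 26) l ?_ h rfl hl hlen
  rintro i ⟨c, a, b⟩ rest κ B σ' - h26 h
  rw [Prog.wp_cons]
  refine Prog.wp_consequence (wp_fetch (by decide) (by decide) h) ?_
  rintro σ₁ ⟨h22, h₁⟩ hf₁
  rw [Prog.wp_cons]
  refine Prog.wp_consequence (wp_readFactor (by decide) (by decide) hmp hne hlo h₁) ?_
  rintro σ₂ ⟨κ', h₂, hκ, hind, h24⟩ hf₂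
  rw [Prog.wp_cons]
  refine Prog.wp_consequence (wp_readFactor (by decide) (by decide) hmp hne hlo h₂) ?_
  rintro σ₃ ⟨κ'', h₃, hκ', hind', h25⟩ hf₃
  have hW0 : 0 < W := by obtain ⟨nx, h1, h2, h3, h4⟩ := h₃.next; omega
  have hlt := h₃.index_lt hW0 a
  have hlt' := h₃.index_lt hW0 b
  have h22' : σ₃.reg 22 = c := by
    rw [hf₃.reg 22 (by simp [readFactor, fetch, Prog.regs, Prog.block]),
      hf₂.reg 22 (by simp [readFactor, fetch, Prog.regs, Prog.block]), h22]
  have h24' : σ₃.reg 24 = index κ'' (unknown a) := by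
    rw [hf₃.reg 24 (by simp [readFactor, fetch, Prog.regs, Prog.block]), h24, hind.index_eq hκ']
  rw [Prog.wp_cons]
  refine Prog.wp_consequence (wp_addEntry_symm (c := sign neg * c) hM hne h₃ h24' h25 hlt hlt'
    (fun σ' hσ' => by rw [eval_signed, Expr.eval, hσ', h22'])) ?_
  intro σ₄ h₄ hf₄
  rw [Prog.wp_nil]
  refine ⟨?_, κ'', _, h₄, hκ.trans hκ', ?_, fun x h0 hx => ?_⟩
  · rw [hf₄.reg 26 (by simp [addEntry, setCell, Prog.regs, Prog.block]),
      hf₃.reg 26 (by simp [readFactor, fetch, Prog.regs, Prog.block]),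
      hf₂.reg 26 (by simp [readFactor, fetch, Prog.regs, Prog.block]),
      hf₁.reg 26 (by simp [fetch, Prog.regs, Prog.block]), h26]
  · simpa [quadraticTerm] using ⟨hind.mono hκ', hind'⟩
  · rw [quadForm_addAt hlt' hlt, quadForm_addAt hlt hlt']
    simp [quadraticTerm, Term.value]
    ring

/-- Reads the monomials of a ket or bra polynomial. -/
def readMonomials (mp M : ℕ) (neg : Bool) : Prog := repeatProg 20 (Prog.block
  [readFactor mp 24,
    Prog.block [addEntry M 24 26 (signed neg (const 1)), addEntry M 26 24 (signed neg (const 1))]])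

/-- The term of a monomial of the ket or bra polynomial with multiplier `z`. -/
def rowTerm (neg : Bool) (z : ℕ) (a : Option (Fin k)) : Term k :=
  ⟨sign neg * 2, unknown a, .inl z⟩

theorem wp_readMonomials {neg : Bool} {l : List (Option (Fin k))} {z : ℕ} (hM : 3 < M)
    (hmp : 3 < mp) (hne : M ≠ mp) (hlo : 0 < lo) (hW : W ≤ N) (hz : z < lo)
    (h : Parse mp M W lo σ (l.map ClifExpr.factorCode ++ rest) κ B)
    (hl : σ.reg 20 = l.length) (h26 : σ.reg 26 = z) :
    (readMonomials mp M neg).wp N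
      (fun τ => Parsed mp M W lo τ rest κ B (l.map (rowTerm neg z))) σ := by
  have hlen : l.length ≤ N := by
    obtain ⟨nx, -, -, h1, -⟩ := h.next
    simp at h1
    omega
  rw [← List.flatMap_singleton' (l.map _), List.flatMap_map]
  rw [← List.flatMap_singleton' (l.map _), List.flatMap_map] at h
  refine wp_repeatProg (by decide) (by decide) (by decide)
    (by simp [fetch, readFactor, addEntry, setCell, Prog.regs, Prog.block]) _ _
    (fun _ => (z : ℤ)) l ?_ h h26 hl hlen
  rintro i a rest κ B σ' - h26 h
  rw [Prog.wp_cons]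
  refine Prog.wp_consequence (wp_readFactor (by decide) (by decide) hmp hne hlo h) ?_
  rintro σ₂ ⟨κ', h₂, hκ, hind, h24⟩ hf₂
  have hzW : z < W := by obtain ⟨nx, h1, h2, h3, h4⟩ := h₂.next; omega
  have hlt := h₂.index_lt (by omega) a
  have h26' : σ₂.reg 26 = z := by
    rw [hf₂.reg 26 (by simp [readFactor, fetch, Prog.regs, Prog.block]), h26]
  rw [Prog.wp_cons]
  refine Prog.wp_consequence (wp_addEntry_symm (c := sign neg) hM hne h₂ h24 h26' hlt hzW
    (fun σ' hσ' => by rw [eval_signed, Expr.eval, mul_one])) ?_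
  intro σ₃ h₃ hf₃
  rw [Prog.wp_nil]
  refine ⟨?_, κ', _, h₃, hκ, ?_, fun x h0 hx => ?_⟩
  · rw [hf₃.reg 26 (by simp [addEntry, setCell, Prog.regs, Prog.block]), h26']
  · have : Indexed κ' (Sum.inl z) := fun v hv => by cases hv
    simpa [rowTerm] using ⟨hind, this⟩
  · rw [quadForm_addAt hzW hlt, quadForm_addAt hlt hzW]
    simp [rowTerm, Term.value, index]
    ring

/-- Reads the ket and bra polynomials. -/
def readRows (mp M : ℕ) (neg : Bool) : Prog := repeatProg 21 (Prog.block
  [Prog.assign 26 (add (reg 26) (const 1)), fetch 20, readMonomials mp M neg])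

/-- Register 26 holds the index of the multiplier of the current row. It is incremented before the
row is read, so that the row `j` uses `j + 1`. -/
theorem wp_readRows {neg : Bool} {d : ℕ} {row : Fin d → List (Option (Fin k))} (hM : 3 < M)
    (hmp : 3 < mp) (hne : M ≠ mp) (hlo : d < lo) (hW : W ≤ N)
    (h : Parse mp M W lo σ ((List.finRange d).flatMap
      (fun j => ClifExpr.linearCode (row j)) ++ rest) κ B)
    (hl : σ.reg 21 = d) (h26 : σ.reg 26 = 0) :
    (readRows mp M neg).wp N (fun τ => Parsed mp M W lo τ rest κ B
      ((List.finRange d).flatMap fun j => (row j).map (rowTerm neg (j + 1)))) σ := by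
  have hlen : d ≤ N := by
    obtain ⟨nx, -, h1, h2, -⟩ := h.next
    omega
  refine wp_repeatProg (by decide) (by decide) (by decide)
    (by simp [readMonomials, repeatProg, fetch, readFactor, addEntry, setCell, Prog.regs,
      Prog.block]) _ _ (fun i => (i : ℤ)) (List.finRange d) ?_ h (by simpa using h26)
    (by simpa using hl) (by simpa using hlen)
  rintro i a rest κ B σ' hia h26 h
  obtain ⟨hi, rfl⟩ := List.getElem?_eq_some_iff.1 hia
  rw [List.length_finRange] at hi
  simp only [List.getElem_finRange, Fin.cast_mk] at h ⊢
  rw [Prog.wp_cons, Prog.wp_assign, Prog.wp_cons]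
  rw [ClifExpr.linearCode, List.cons_append] at h
  refine Prog.wp_consequence (wp_fetch (by decide) (by decide)
    (h.of_eq (by simp) (by simp) rfl)) ?_
  rintro σ₁ ⟨h20, h₁⟩ hf₁
  have h26₁ : σ₁.reg 26 = (i + 1 : ℕ) := by
    rw [hf₁.reg 26 (by simp [fetch, Prog.regs, Prog.block])]
    simp [Expr.eval, h26]
  rw [Prog.wp_cons]
  refine Prog.wp_consequence (wp_readMonomials hM hmp hne (by omega) hW (by omega) h₁ h20 h26₁) ?_
  intro σ₂ h₂ hf₂
  rw [Prog.wp_nil]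
  refine ⟨?_, h₂⟩
  rw [hf₂.reg 26 (by simp [readMonomials, repeatProg, fetch, readFactor, addEntry, setCell,
    Prog.regs, Prog.block]), h26₁]

end Lists

/-! ### Reading a whole expression -/

section Expressions

variable {n m : ℕ}

/-- The terms of an expression or of its negative. -/
def exprTerms (neg : Bool) (t : ClifExpr n m) : List (Term t.numVars) :=
  t.P₁.map (linearTerm neg) ++ (t.P₂.map (quadraticTerm neg) ++
    (List.finRange (m + n)).flatMap fun j => (t.row j).map (rowTerm neg (j + 1)))

theorem index_unknown {k : ℕ} (κ : Fin k → ℕ) {x : ℕ → ℤ} (h0 : x 0 = 1) (a : Option (Fin k)) :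
    x (index κ (unknown a)) = ClifExpr.factorVal (fun v => x (κ v)) a := by
  cases a with
  | none => exact h0
  | some v => rfl

theorem factorVal_mul_self {k : ℕ} {ρ : Fin k → ℤ} (h : ∀ v, ρ v = 0 ∨ ρ v = 1)
    (a : Option (Fin k)) :
    ClifExpr.factorVal ρ a * ClifExpr.factorVal ρ a = ClifExpr.factorVal ρ a := by
  cases a with
  | none => rfl
  | some v => rcases h v with h | h <;> simp [ClifExpr.factorVal, h]

/-- At assignments of bits the diagonal terms reduce to linear ones by idempotence, so the form
built by the machine takes the values of `ClifExpr.form`. -/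
theorem sum_exprTerms (neg : Bool) (t : ClifExpr n m) (κ : Fin t.numVars → ℕ) {x : ℕ → ℤ}
    (h0 : x 0 = 1) (hx : ∀ i, x i = 0 ∨ x i = 1) :
    ((exprTerms neg t).map (Term.value κ x)).sum = sign neg * t.form (fun v => x (κ v)) x := by
  have h1 : ((t.P₁.map (linearTerm neg)).map (Term.value κ x)).sum = sign neg *
      (t.P₁.map fun y => y.1 * ClifExpr.factorVal (fun v => x (κ v)) y.2).sum := by
    rw [List.map_map, ← List.sum_map_mul_left]
    congr 1
    refine List.map_congr_left fun y _ => ?_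
    simp only [Function.comp, Term.value, linearTerm, index_unknown κ h0]
    rw [factorVal_mul_self fun v => hx _, mul_assoc]
  have h2 : ((t.P₂.map (quadraticTerm neg)).map (Term.value κ x)).sum = sign neg * (2 *
      (t.P₂.map fun y => y.1 * (ClifExpr.factorVal (fun v => x (κ v)) y.2.1 *
        ClifExpr.factorVal (fun v => x (κ v)) y.2.2)).sum) := by
    rw [List.map_map, ← List.sum_map_mul_left, ← List.sum_map_mul_left]
    congr 1
    refine List.map_congr_left fun y _ => ?_
    simp only [Function.comp, Term.value, quadraticTerm, index_unknown κ h0]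
    ring
  have h3 : (((List.finRange (m + n)).flatMap fun j =>
      (t.row j).map (rowTerm neg (j + 1))).map (Term.value κ x)).sum = sign neg * (2 *
        ∑ j : Fin (m + n), x (j + 1) * ClifExpr.rowVal (fun v => x (κ v)) (t.row j)) := by
    rw [List.map_flatMap, List.flatMap, List.sum_flatten, List.map_map, Fin.sum_univ_def,
      ← List.sum_map_mul_left, ← List.sum_map_mul_left]
    congr 1
    refine List.map_congr_left fun j _ => ?_
    simp only [Function.comp, ClifExpr.rowVal, List.map_map]
    rw [← List.sum_map_mul_left, ← List.sum_map_mul_left, ← List.sum_map_mul_left]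
    congr 1
    refine List.map_congr_left fun a _ => ?_
    simp only [Function.comp, Term.value, rowTerm, index_unknown κ h0]
    simp only [index, Sum.elim_inl, id]
    ring
  rw [exprTerms, List.map_append, List.sum_append, List.map_append, List.sum_append, h1, h2, h3,
    ClifExpr.form, ClifExpr.phaseForm]
  ring

theorem seen_of_indexed {k : ℕ} {κ : Fin k → ℕ} {a : Option (Fin k)} (h : Indexed κ (unknown a)) :
    ClifExpr.Seen κ a := by
  rintro v rfl
  exact h v rfl

theorem allSeen_of_indexed {neg : Bool} {t : ClifExpr n m} {κ : Fin t.numVars → ℕ}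
    (h : ∀ y ∈ exprTerms neg t, Indexed κ y.fst ∧ Indexed κ y.snd) : t.AllSeen κ where
  linear y hy := seen_of_indexed (h (linearTerm neg y)
    (List.mem_append_left _ (List.mem_map_of_mem hy))).1
  quadratic y hy := by
    have := h (quadraticTerm neg y)
      (List.mem_append_right _ (List.mem_append_left _ (List.mem_map_of_mem hy)))
    exact ⟨seen_of_indexed this.1, seen_of_indexed this.2⟩
  row j a ha := seen_of_indexed (h (rowTerm neg (j + 1) a) (List.mem_append_right _
    (List.mem_append_right _ (List.mem_flatMap.2
      ⟨j, List.mem_finRange j, List.mem_map_of_mem ha⟩)))).1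

theorem code_append (t : ClifExpr n m) (rest : List ℤ) :
    t.code ++ rest = t.p :: (t.numVars : ℤ) :: t.P₀ :: (t.P₁.length : ℤ) ::
      (t.P₁.flatMap (fun x => [x.1, ClifExpr.factorCode x.2]) ++ (t.P₂.length : ℤ) ::
      (t.P₂.flatMap (fun x => [x.1, ClifExpr.factorCode x.2.1, ClifExpr.factorCode x.2.2]) ++
      ((List.finRange (m + n)).flatMap (fun j => ClifExpr.linearCode (t.row j)) ++ rest))) := by
  have h : (List.finRange (m + n)).flatMap (fun j => ClifExpr.linearCode (t.row j)) =
      (List.ofFn fun i => ClifExpr.linearCode (t.ket i)).flatten ++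
        (List.ofFn fun i => ClifExpr.linearCode (t.bra i)).flatten := by
    rw [← List.flatten_append, ← List.ofFn_fin_append, List.flatMap, ← List.ofFn_eq_map]
    congr 2
    funext j
    refine Fin.addCases (fun i => ?_) (fun i => ?_) j
    · simp [ClifExpr.row]
    · simp [ClifExpr.row]
  rw [h, ClifExpr.code]
  simp

/-- Reads an expression. -/
def readExpr (mp M : ℕ) (neg : Bool) : Prog := Prog.block
  [fetch 22, Prog.assign 5 (sub (reg 5) (reg 22)),
    fetch 22, Prog.assign 5 (add (reg 5) (add (reg 22) (reg 22))),
    fetch 22, Prog.assign 6 (add (reg 6) (signed neg (reg 22))),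
    fetch 20, readLinear mp M neg,
    fetch 20, readQuadratic mp M neg,
    Prog.assign 26 (const 0), Prog.assign 21 (reg 2), readRows mp M neg]

theorem regs_readExpr {mp M r : ℕ} {neg : Bool} (h : r < 3 ∨ (6 < r ∧ r < 20) ∨ 26 < r) :
    r ∉ (readExpr mp M neg).regs := by
  simp only [readExpr, readLinear, readQuadratic, readRows, readMonomials, repeatProg, fetch,
    readFactor, addEntry, setCell, Prog.regs, Prog.block, List.mem_append, List.mem_cons,
    List.not_mem_nil, or_false, false_or, not_or]
  omega

theorem arrs_readExpr {mp M a : ℕ} {neg : Bool} (h : a ≠ mp) (h' : a ≠ M) :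
    a ∉ (readExpr mp M neg).arrs := by
  simp only [readExpr, readLinear, readQuadratic, readRows, readMonomials, repeatProg, fetch,
    readFactor, addEntry, setCell, Prog.arrs, Prog.block, List.mem_append, List.mem_cons,
    List.not_mem_nil, or_false, false_or, not_or]
  tauto

/-- Register 5 collects the exponent of `√2`: -p from the scalar, and twice the number of variables,
because the elimination computes an average where the inner product is a sum. Declared variables
that never occur are thereby accounted for as well. -/
theorem wp_readExpr {N mp M W lo : ℕ} {σ : State} {rest : List ℤ} {neg : Bool} {t : ClifExpr n m}
    {κ : Fin t.numVars → ℕ} {B : ℕ → ℕ → ℤ} (hM : 3 < M) (hmp : 3 < mp) (hne : M ≠ mp)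
    (hlo : m + n < lo) (hW : W ≤ N) (h2 : σ.reg 2 = (m + n : ℕ))
    (h : Parse mp M W lo σ (t.code ++ rest) κ B) :
    (readExpr mp M neg).wp N (fun τ => Parsed mp M W lo τ rest κ B (exprTerms neg t) ∧
      τ.reg 5 = σ.reg 5 - t.p + 2 * t.numVars ∧ τ.reg 6 = σ.reg 6 + sign neg * t.P₀) σ := by
  rw [code_append] at h
  rw [readExpr, Prog.wp_cons]
  refine Prog.wp_consequence (wp_fetch (by decide) (by decide) h) ?_
  rintro σ₁ ⟨h22₁, h₁⟩ hf₁
  have hr₁ : ∀ r, r ≠ 22 → r ≠ 3 → σ₁.reg r = σ.reg r := fun r h h' =>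
    hf₁.reg r (by simp [fetch, Prog.regs, Prog.block, h, h'])
  rw [Prog.wp_cons, Prog.wp_assign, Prog.wp_cons]
  refine Prog.wp_consequence (wp_fetch (by decide) (by decide)
    (h₁.of_eq (by simp) (by simp) rfl)) ?_
  rintro σ₂ ⟨h22₂, h₂⟩ hf₂
  have hr₂ : ∀ r, r ≠ 22 → r ≠ 3 → r ≠ 5 → σ₂.reg r = σ₁.reg r := fun r h h' h'' => by
    rw [hf₂.reg r (by simp [fetch, Prog.regs, Prog.block, h, h'])]
    simp [h'']
  have h5₂ : σ₂.reg 5 = σ.reg 5 - t.p := by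
    rw [hf₂.reg 5 (by simp [fetch, Prog.regs, Prog.block]), ← h22₁, ← hr₁ 5 (by decide) (by decide)]
    simp [Expr.eval]
  rw [Prog.wp_cons, Prog.wp_assign, Prog.wp_cons]
  refine Prog.wp_consequence (wp_fetch (by decide) (by decide)
    (h₂.of_eq (by simp) (by simp) rfl)) ?_
  rintro σ₃ ⟨h22₃, h₃⟩ hf₃
  have hr₃ : ∀ r, r ≠ 22 → r ≠ 3 → r ≠ 5 → σ₃.reg r = σ₂.reg r := fun r h h' h'' => by
    rw [hf₃.reg r (by simp [fetch, Prog.regs, Prog.block, h, h'])]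
    simp [h'']
  have h5₃ : σ₃.reg 5 = σ.reg 5 - t.p + 2 * t.numVars := by
    rw [hf₃.reg 5 (by simp [fetch, Prog.regs, Prog.block]), ← h22₂, ← h5₂]
    simp [Expr.eval]
    ring
  rw [Prog.wp_cons, Prog.wp_assign, Prog.wp_cons]
  refine Prog.wp_consequence (wp_fetch (by decide) (by decide)
    (h₃.of_eq (by simp) (by simp) rfl)) ?_
  rintro σ₄ ⟨h20₄, h₄⟩ hf₄
  have hr₄ : ∀ r, r ≠ 20 → r ≠ 3 → r ≠ 6 → σ₄.reg r = σ₃.reg r := fun r h h' h'' => by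
    rw [hf₄.reg r (by simp [fetch, Prog.regs, Prog.block, h, h'])]
    simp [h'']
  have h6₄ : σ₄.reg 6 = σ.reg 6 + sign neg * t.P₀ := by
    rw [hf₄.reg 6 (by simp [fetch, Prog.regs, Prog.block]), ← h22₃,
      ← hr₁ 6 (by decide) (by decide), ← hr₂ 6 (by decide) (by decide) (by decide),
      ← hr₃ 6 (by decide) (by decide) (by decide)]
    simp [Expr.eval, eval_signed]
  rw [Prog.wp_cons]
  refine Prog.wp_consequence (wp_readLinear hM hmp hne (by omega) hW h₄ h20₄) ?_
  rintro σ₅ ⟨κ₅, B₅, h₅, hκ₅, hL₅, hB₅⟩ hf₅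
  rw [Prog.wp_cons]
  refine Prog.wp_consequence (wp_fetch (by decide) (by decide) h₅) ?_
  rintro σ₆ ⟨h20₆, h₆⟩ hf₆
  rw [Prog.wp_cons]
  refine Prog.wp_consequence (wp_readQuadratic hM hmp hne (by omega) hW h₆ h20₆) ?_
  rintro σ₇ ⟨κ₇, B₇, h₇, hκ₇, hL₇, hB₇⟩ hf₇
  have hr₇ : ∀ r, r = 2 ∨ r = 5 ∨ r = 6 → σ₇.reg r = σ₄.reg r := fun r hr => by
    rw [hf₇.reg r ?_, hf₆.reg r ?_, hf₅.reg r ?_] <;>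
    rcases hr with rfl | rfl | rfl <;>
    simp [readLinear, readQuadratic, repeatProg, fetch, readFactor, addEntry, setCell, Prog.regs,
      Prog.block]
  have h2₇ : σ₇.reg 2 = (m + n : ℕ) := by
    rw [hr₇ 2 (by decide), hr₄ 2 (by decide) (by decide) (by decide),
      hr₃ 2 (by decide) (by decide) (by decide), hr₂ 2 (by decide) (by decide) (by decide),
      hr₁ 2 (by decide) (by decide), h2]
  rw [Prog.wp_cons, Prog.wp_assign, Prog.wp_cons, Prog.wp_assign, Prog.wp_cons]
  refine Prog.wp_consequence (wp_readRows hM hmp hne hlo hW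
    (h₇.of_eq (by simp) (by simp) rfl) (by simp [Expr.eval, h2₇]) (by simp [Expr.eval])) ?_
  intro σ₈ h₈ hf₈
  have hr₈ : ∀ r, r = 5 ∨ r = 6 → σ₈.reg r = σ₄.reg r := fun r hr => by
    rw [hf₈.reg r ?_, ← hr₇ r (.inr hr)]
    · rcases hr with rfl | rfl <;> simp
    · rcases hr with rfl | rfl <;> simp [readRows, readMonomials, repeatProg, fetch, readFactor,
        addEntry, setCell, Prog.regs, Prog.block]
  rw [Prog.wp_nil]
  refine ⟨Parsed.append hκ₅ hL₅ hB₅ (Parsed.append hκ₇ hL₇ hB₇ h₈), ?_, ?_⟩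
  · rw [hr₈ 5 (by decide), hr₄ 5 (by decide) (by decide) (by decide), h5₃]
  · rw [hr₈ 6 (by decide), h6₄]

end Expressions

/-! ### The decision procedure -/

/-! ### Inner products on the machine -/

section Gram

variable {n m : ℕ}

/-- Cells beyond the stream are read as 0 by convention, so padding with zeros is harmless; it
serves to enlarge the budget of indices in `Parse`. -/
theorem streamAt_append_replicate {A : ℤ → ℤ} {p : ℤ} {l : List ℤ} {d : ℕ} :
    StreamAt A p (l ++ List.replicate d 0) ↔ StreamAt A p l := by
  refine forall_congr' fun i => ?_
  have h : (l ++ List.replicate d 0).getD i 0 = l.getD i 0 := by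
    rcases lt_or_ge i l.length with hi | hi
    · exact List.getD_append _ _ _ _ hi
    · rw [List.getD_append_right _ _ _ _ hi, List.getD_eq_default _ _ hi]
      simp [List.getD_eq_getElem?_getD, List.getElem?_replicate]
      split_ifs <;> rfl
  rw [h]

theorem scalar_zero (p p' : ℤ) (k k' : ℕ) (w : ℤ) :
    scalar 0 (0 - p + 2 * k - p' + 2 * k') w =
      (((1 / √2) ^ p * (1 / √2) ^ p' : ℝ) : ℂ) * 2 ^ (k + k') * eighthRoot w := by
  have h2 : (2 : ℂ) ^ (k + k') = (√2 : ℂ) ^ (2 * k + 2 * k' : ℤ) := by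
    rw [← sqrt_two_sq_complex, ← pow_two, ← pow_mul, ← zpow_natCast]
    congr 1
    push_cast
    ring
  rw [scalar, if_neg (lt_irrefl 0), h2]
  push_cast
  rw [one_div, inv_zpow', inv_zpow', ← zpow_add₀ sqrt_two_ne_zero_complex,
    ← zpow_add₀ sqrt_two_ne_zero_complex]
  congr 2
  ring

theorem parse_init {k mp M W lo : ℕ} {σ : State} {rest : List ℤ} {B : ℕ → ℕ → ℤ} (hT : HasTable σ W)
    (hs : StreamAt (σ.arr 0) (σ.reg 3) rest) (hB : HasMatrix σ M W W B)
    (hsymm : ∀ i j, B i j = B j i) (hmp : ∀ z, σ.arr mp z = 0) (h4 : σ.reg 4 = lo)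
    (hlo : lo + rest.length ≤ W) :
    Parse mp M W lo σ rest (fun _ : Fin k => 0) B where
  table := hT
  stream := hs
  matrix := hB
  symm := hsymm
  map_zero := hmp 0
  map _ := hmp _
  next := ⟨lo, h4, le_rfl, hlo, fun _ h => absurd rfl h⟩
  inj _ _ h := absurd rfl h

/-- The inner product of two expressions that start at the addresses `e` and `e'`: it goes to the
registers `o`, `o + 1` and `o + 2`. The address where the first one ends goes to register `9`. -/
def gram (mp mp' M o : ℕ) (e e' : Expr) : Prog := Prog.block
  [Prog.assign 5 (const 0), Prog.assign 6 (const 0), Prog.assign 7 (const 0),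
    Prog.assign 4 (add (reg 2) (const 1)), Prog.assign 3 e, readExpr mp M true,
    Prog.assign 9 (reg 3), Prog.assign 3 e', readExpr mp' M false, eliminate M,
    Prog.assign o (reg 7), Prog.assign (o + 1) (reg 5), Prog.assign (o + 2) (reg 6)]

theorem regs_eliminate {M r : ℕ} (h : r < 5 ∨ (7 < r ∧ r < 30) ∨ 38 < r) :
    r ∉ (eliminate M).regs := by
  simp only [eliminate, eliminateRow, readRow, readBits, chooseUpdate, copyRow, updateMatrix,
    updateRow, setCell, Prog.regs, Prog.block, List.mem_append, List.mem_cons,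
    List.not_mem_nil, or_false, false_or, not_or]
  omega

theorem arrs_eliminate {M a : ℕ} (h2 : a ≠ 2) (h3 : a ≠ 3) (hM : a ≠ M) :
    a ∉ (eliminate M).arrs := by
  simp only [eliminate, eliminateRow, readRow, readBits, chooseUpdate, copyRow, updateMatrix,
    updateRow, setCell, Prog.arrs, Prog.block, List.mem_append, List.mem_cons,
    List.not_mem_nil, or_false, false_or, not_or]
  tauto

theorem regs_gram {mp mp' M o r : ℕ} {e e' : Expr}
    (h : r < 3 ∨ r = 8 ∨ (9 < r ∧ r < 20) ∨ 38 < r) (ho : r < o ∨ o + 2 < r) :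
    r ∉ (gram mp mp' M o e e').regs := by
  have h1 := regs_readExpr (mp := mp) (M := M) (r := r) (neg := true) (by omega)
  have h2 := regs_readExpr (mp := mp') (M := M) (r := r) (neg := false) (by omega)
  have h3 := regs_eliminate (M := M) (r := r) (by omega)
  simp only [gram, Prog.regs, Prog.block, List.mem_append, List.mem_cons,
    List.not_mem_nil, or_false, not_or, h1, h2, h3, not_false_eq_true, true_and]
  omega

theorem arrs_gram {mp mp' M o a : ℕ} {e e' : Expr} (h2 : a ≠ 2) (h3 : a ≠ 3) (hmp : a ≠ mp)
    (hmp' : a ≠ mp') (hM : a ≠ M) : a ∉ (gram mp mp' M o e e').arrs := by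
  simp [gram, Prog.arrs, Prog.block, arrs_readExpr hmp hM, arrs_readExpr hmp' hM,
    arrs_eliminate h2 h3 hM]

/-- Both expressions are read into one matrix, the first with negative sign because it is
conjugated. The numbering of the second continues where that of the first stopped, and each has its
own map, so equal codes of variables in the two expressions are not confused. -/
theorem wp_gram {N mp mp' M o W : ℕ} {e e' : Expr} {σ : State} {s t : ClifExpr n m}
    {p p' : ℤ} {rest rest' : List ℤ} (hM : 3 < M) (hmp : 3 < mp) (hmp' : 3 < mp') (hne : M ≠ mp)
    (hne' : M ≠ mp') (hmm : mp ≠ mp') (ho : 9 < o) (hN : W ≤ N) (h1 : σ.reg 1 = W)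
    (h2 : σ.reg 2 = (m + n : ℕ)) (hT : HasTable σ W)
    (hzM : ∀ z, σ.arr M z = 0) (hz : ∀ z, σ.arr mp z = 0) (hz' : ∀ z, σ.arr mp' z = 0)
    (he : ∀ τ : State, τ.reg 8 = σ.reg 8 → e.eval τ = p)
    (he' : ∀ τ : State, τ.reg 8 = σ.reg 8 → e'.eval τ = p')
    (hs : StreamAt (σ.arr 0) p (s.code ++ rest)) (ht : StreamAt (σ.arr 0) p' (t.code ++ rest'))
    (hW : m + n + 1 + (s.code ++ rest).length + (t.code ++ rest').length ≤ W) :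
    (gram mp mp' M o e e').wp N (fun τ => 0 ≤ τ.reg o ∧
      scalar (τ.reg o) (τ.reg (o + 1)) (τ.reg (o + 2)) = ClifExpr.inner s t ∧
      StreamAt (τ.arr 0) (τ.reg 9) rest) σ := by
  set d := (t.code ++ rest').length with hd
  -- The padding reserves as many indices as the second expression can need while the first is being
  -- read.
  rw [← streamAt_append_replicate (d := d), List.append_assoc] at hs
  rw [gram]
  simp only [Prog.wp_cons, Prog.wp_assign, Expr.eval]
  rw [he _ (by simp)]
  refine Prog.wp_consequence (wp_readExpr (lo := m + n + 1) (W := W) (B := fun _ _ => 0)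
    (κ := fun _ => 0) (rest := rest ++ List.replicate d 0) (t := s) hM hmp hne (by omega) hN
    (by simpa using h2) (parse_init hT (by simpa using hs) (fun i j _ _ => hzM _) (fun _ _ => rfl) hz
      (by simp [h2]) (by simp at hW ⊢; omega))) ?_
  rintro σ₁ ⟨⟨κ, B, hP, -, hL, hB⟩, h5, h6⟩ hf₁
  have hr₁ : ∀ r, r < 3 ∨ (7 < r ∧ r < 20) → σ₁.reg r = σ.reg r := fun r hr => by
    rw [hf₁.reg r (regs_readExpr (by omega))]
    simp [show r ≠ 3 by omega, show r ≠ 4 by omega, show r ≠ 7 by omega, show r ≠ 6 by omega,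
      show r ≠ 5 by omega]
  have h7₁ : σ₁.reg 7 = 0 := by
    rw [hf₁.reg 7 (regs_readExpr (by omega))]
    simp
  have ha₁ : ∀ a, a ≠ mp → a ≠ M → σ₁.arr a = σ.arr a := fun a h h' =>
    hf₁.arr a (arrs_readExpr h h')
  have hs₁ := streamAt_append_replicate.1 hP.stream
  obtain ⟨l, h4, hl, hlW, hκ⟩ := hP.next
  have hinj := hP.inj
  rw [Prog.wp_cons, Prog.wp_assign, Prog.wp_cons, Prog.wp_assign, Prog.wp_cons,
    he' _ (by simpa using hr₁ 8 (by omega))]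
  refine Prog.wp_consequence (wp_readExpr (lo := l) (W := W) (B := B)
    (κ := fun _ => 0) (rest := rest') (t := t) hM hmp' hne' (by omega) hN
    (by simpa using (hr₁ 2 (by omega)).trans h2) (parse_init hP.table ?_ hP.matrix hP.symm ?_ ?_
      ?_)) ?_
  · simpa [ha₁ 0 (by omega) (by omega)] using ht
  · intro z
    change σ₁.arr mp' z = 0
    rw [ha₁ mp' hmm.symm hne'.symm, hz' z]
  · simpa using h4
  · rw [List.length_append, List.length_replicate] at hlW
    omega
  rintro σ₂ ⟨⟨κ', B', hP', -, hL', hB'⟩, h5', h6'⟩ hf₂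
  obtain ⟨l', -, hl', hlW', hκ'⟩ := hP'.next
  have hr₂ : ∀ r, r < 3 ∨ (9 < r ∧ r < 20) ∨ r = 7 → σ₂.reg r = σ₁.reg r := fun r hr => by
    rw [hf₂.reg r (regs_readExpr (by omega))]
    simp [show r ≠ 3 by omega, show r ≠ 9 by omega]
  have hs₂ : StreamAt (σ₂.arr 0) (σ₂.reg 9) rest := by
    rw [hf₂.arr 0 (arrs_readExpr (by omega) (by omega)), hf₂.reg 9 (regs_readExpr (by omega))]
    simpa [Expr.eval] using hs₁
  rw [Prog.wp_cons]
  refine Prog.wp_consequence (wp_eliminate hM hP'.table hP'.matrix hP'.symm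
    (by rw [hr₂ 1 (by omega), hr₁ 1 (by omega), h1]) (by omega) hN
    (by rw [hr₂ 7 (by omega), h7₁])) ?_
  rintro σ₃ ⟨h7₃, hval⟩ hf₃
  have hinner : σ₃.scalar = ClifExpr.inner s t := by
    rw [hval, ClifExpr.inner_eq_gauss s t κ κ' (W := W) (l := l) (allSeen_of_indexed hL)
      (allSeen_of_indexed hL') (fun v hv => ⟨(hκ v hv).1, (hκ v hv).2⟩)
      (fun v hv => ⟨(hκ' v hv).1, by have := (hκ' v hv).2; omega⟩) (by omega) (by omega) hinj
      hP'.inj B' ?_]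
    · congr 1
      rw [← scalar_zero, State.scalar, hr₂ 7 (by omega), h7₁, h5', h6']
      simp [h5, h6, sign]
      congr 1
      ring
    · intro x h0 hx
      rw [hB' x h0 hx, hB x h0 hx, sum_exprTerms _ _ _ h0 hx, sum_exprTerms _ _ _ h0 hx]
      simp [sign, quadForm]
      ring
  simp only [Prog.wp_cons, Prog.wp_nil, Prog.wp_assign, Expr.eval]
  refine ⟨?_, ?_, ?_⟩
  · simpa using h7₃
  · rw [← hinner, State.scalar]
    simp [show 5 ≠ o by omega, show 6 ≠ o by omega, show 6 ≠ o + 1 by omega]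
  · have h9 : σ₃.reg 9 = σ₂.reg 9 := hf₃.reg 9 (regs_eliminate (by omega))
    have h0 : σ₃.arr 0 = σ₂.arr 0 := hf₃.arr 0 (arrs_eliminate (by omega) (by omega) (by omega))
    simp [show 9 ≠ o by omega, show 9 ≠ o + 1 by omega, show 9 ≠ o + 2 by omega, h9, h0, hs₂]

end Gram

/-- Writes the addresses of the rows of the matrices to array `1`. -/
def makeTable : Prog := Prog.loop (reg 20) (Prog.block
  [Prog.assign 20 (sub (reg 20) (const 1)), Prog.store 1 (reg 22) (reg 24),
    Prog.assign 22 (add (reg 22) (const 1)), Prog.assign 24 (add (reg 24) (reg 1))])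

/-- The addresses are accumulated by repeated addition, as the machine cannot multiply; afterwards
any matrix entry is accessed with a single addition. -/
theorem wp_makeTable {N W : ℕ} {σ : State} (hN : W ≤ N) (h1 : σ.reg 1 = W) (h20 : σ.reg 20 = W)
    (h22 : σ.reg 22 = 0) (h24 : σ.reg 24 = 0) : makeTable.wp N (fun τ => HasTable τ W) σ := by
  refine Prog.wp_for W hN (fun k τ => τ.reg 20 = k ∧ k ≤ W ∧ τ.reg 22 = (W : ℤ) - k ∧
    τ.reg 24 = ((W : ℤ) - k) * W ∧ ∀ i : ℕ, i + k < W → τ.arr 1 i = (i : ℤ) * W) ?_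
    (fun k σ h => h.1) ?_ ?_
  · exact ⟨h20, le_rfl, by rw [h22, sub_self], by rw [h24, sub_self, zero_mul],
      fun i hi => by omega⟩
  · rintro k τ hk hf ⟨h20', hkW, h22', h24', hT⟩
    have h1' : τ.reg 1 = W := (hf.reg 1 (by decide)).trans h1
    simp only [Prog.wp_cons, Prog.wp_nil, Prog.wp_assign, Prog.wp_store, Expr.eval]
    simp [h20', h22', h24', h1']
    refine ⟨hk.le, by ring, by ring, fun i hi => ?_⟩
    rw [Function.update_apply]
    split_ifs with h
    · rw [h]
    · exact hT i (by omega)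
  · rintro τ hf ⟨-, -, -, -, hT⟩ i hi
    exact hT i (by omega)

/-- The norm of a nonzero scalar determines the exponent of `√2`, and the remaining phase determines
the exponent of the eighth root modulo 8. -/
theorem scalar_eq_iff {z a w z' a' w' : ℤ} :
    scalar z a w = scalar z' a' w' ↔
      (0 < z ∧ 0 < z') ∨ (¬ 0 < z ∧ ¬ 0 < z' ∧ a = a' ∧ (8 : ℤ) ∣ w - w') := by
  have hne : ∀ a w : ℤ, (√2 : ℂ) ^ a * eighthRoot w ≠ 0 := fun a w =>
    mul_ne_zero (zpow_ne_zero _ sqrt_two_ne_zero_complex) (eighthRoot_ne_zero w)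
  rw [scalar, scalar]
  by_cases hz : 0 < z <;> by_cases hz' : 0 < z' <;> simp only [hz, hz', if_true, if_false]
  · simp
  · simpa using (hne a' w').symm
  · simpa using hne a w
  · simp only [not_false_eq_true, true_and, false_and, false_or]
    constructor
    · intro h
      have hnorm := congrArg norm h
      simp only [norm_mul, norm_eighthRoot, mul_one, norm_zpow, Complex.norm_real,
        Real.norm_eq_abs, abs_of_nonneg (Real.sqrt_nonneg 2)] at hnorm
      have ha : a = a' := zpow_right_injective₀ (by positivity)
        (by rw [Ne, Real.sqrt_eq_one]; norm_num) hnorm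
      subst ha
      exact ⟨rfl, (eighthRoot_eq_iff w w').1
        (mul_left_cancel₀ (zpow_ne_zero _ sqrt_two_ne_zero_complex) h)⟩
    · rintro ⟨rfl, h⟩
      rw [(eighthRoot_eq_iff w w').2 h]

/-- Clears register `0` unless the scalars in the registers from `o` and from `o'` on are equal. -/
def compareScalars (o o' : ℕ) : Prog :=
  Prog.ite (reg o) (Prog.ite (reg o') Prog.skip (Prog.assign 0 (const 0)))
    (Prog.ite (reg o') (Prog.assign 0 (const 0)) (Prog.block
      [Prog.ite (sub (reg (o + 1)) (reg (o' + 1))) (Prog.assign 0 (const 0)) Prog.skip,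
        Prog.ite (sub (reg (o' + 1)) (reg (o + 1))) (Prog.assign 0 (const 0)) Prog.skip,
        Prog.assign 27 (sub (reg (o + 2)) (reg (o' + 2))),
        Prog.ite (parity (reg 27)) (Prog.assign 0 (const 0)) Prog.skip,
        Prog.assign 27 (half (reg 27)),
        Prog.ite (parity (reg 27)) (Prog.assign 0 (const 0)) Prog.skip,
        Prog.assign 27 (half (reg 27)),
        Prog.ite (parity (reg 27)) (Prog.assign 0 (const 0)) Prog.skip]))

/-- Divisibility of the difference of exponents by 8 is tested by three parities with halvings in
between. -/
theorem wp_compareScalars {N o o' : ℕ} {σ : State} (ho : 9 < o) (ho' : 9 < o') :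
    (compareScalars o o').wp N (fun τ =>
      (scalar (σ.reg o) (σ.reg (o + 1)) (σ.reg (o + 2)) =
        scalar (σ.reg o') (σ.reg (o' + 1)) (σ.reg (o' + 2)) → τ.reg 0 = σ.reg 0) ∧
      (¬ scalar (σ.reg o) (σ.reg (o + 1)) (σ.reg (o + 2)) =
        scalar (σ.reg o') (σ.reg (o' + 1)) (σ.reg (o' + 2)) → τ.reg 0 = 0)) σ := by
  rw [scalar_eq_iff]
  have e1 : o + 1 ≠ 0 := by omega
  have e2 : o' + 1 ≠ 0 := by omega
  have e3 : o + 2 ≠ 0 := by omega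
  have e4 : o' + 2 ≠ 0 := by omega
  simp only [compareScalars, Prog.wp_cons, Prog.wp_nil, Prog.wp_assign, Prog.wp_ite, Prog.wp_skip,
    eval_parity, Expr.eval]
  simp only [ne_eq, e1, e2, e3, e4, not_false_eq_true, Function.update_of_ne, Function.update_self,
    OfNat.ofNat_ne_zero, OfNat.zero_ne_ofNat]
  generalize σ.reg o = z
  generalize σ.reg o' = z'
  generalize σ.reg (o + 1) = a
  generalize σ.reg (o' + 1) = a'
  generalize σ.reg (o + 2) = w
  generalize σ.reg (o' + 2) = w'
  repeat' first | intro _ | apply And.intro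
  all_goals first | trivial | omega

/-- Decides the equality of two expressions by comparing their inner products. -/
def decideEqual : Prog := Prog.block
  [Prog.assign 2 (add (get 0 (const 0)) (get 0 (const 1))),
    Prog.assign 1 (add (add (reg 0) (reg 0)) (add (reg 0) (reg 0))),
    Prog.assign 20 (reg 1), makeTable,
    gram 4 5 6 10 (const 2) (const 2), Prog.assign 8 (reg 9),
    gram 7 8 9 13 (const 2) (reg 8), gram 10 11 12 16 (reg 8) (reg 8),
    Prog.assign 0 (const 1), compareScalars 10 13, compareScalars 13 16]

/-- The five extra integers are p, the number of variables, P⁽⁰⁾ and the two list lengths. The lower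
bound guarantees room for the multipliers, the upper one converts length into size. -/
theorem length_code {n m : ℕ} (t : ClifExpr n m) :
    m + n + 5 ≤ t.code.length ∧ t.code.length ≤ 5 * (t.phaseSize + t.ketBraSize) := by
  have h1 : (List.ofFn fun i => ClifExpr.linearCode (t.ket i)).flatten.length =
      ∑ i, (1 + (t.ket i).length) := by
    simp [List.length_flatten, List.map_ofFn, List.sum_ofFn, ClifExpr.linearCode, Function.comp_def,
      add_comm]
  have h2 : (List.ofFn fun i => ClifExpr.linearCode (t.bra i)).flatten.length =
      ∑ i, (1 + (t.bra i).length) := by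
    simp [List.length_flatten, List.map_ofFn, List.sum_ofFn, ClifExpr.linearCode, Function.comp_def,
      add_comm]
  have h3 : m ≤ ∑ i, (1 + (t.ket i).length) := by
    rw [Finset.sum_add_distrib]
    simp
  have h4 : n ≤ ∑ i, (1 + (t.bra i).length) := by
    rw [Finset.sum_add_distrib]
    simp
  rw [ClifExpr.code, List.length_append, List.length_append, h1, h2, ClifExpr.phaseSize,
    ClifExpr.ketBraSize]
  simp only [List.length_append, List.length_cons, List.length_nil, List.length_flatMap,
    List.map_const', List.sum_replicate, smul_eq_mul]
  omega

theorem streamAt_init (w : List ℤ) (i : ℕ) : StreamAt ((init w).arr 0) i (w.drop i) := by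
  intro j
  have h : (0 : ℤ) ≤ (i : ℤ) + j := by omega
  have h' : ((i : ℤ) + j).toNat = i + j := by omega
  simp only [init, h, and_self, if_true, h']
  simp [List.getD_eq_getElem?_getD]

/-- The matrices have side four times the length of the input, obtained by two doublings: this
covers the constant, the multipliers and both streams that an inner product reserves. -/
theorem wp_decideEqual {N : ℕ} (x : ClifPair) (hN : 4 * x.code.length ≤ N) :
    decideEqual.wp N (fun τ => (x.Equal → τ.reg 0 = 1) ∧ (¬ x.Equal → τ.reg 0 = 0))
      (init x.code) := by
  obtain ⟨n, m, s, t⟩ := x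
  set w := ClifPair.code ⟨n, m, s, t⟩ with hw
  set W := 4 * w.length with hW
  have hwcode : w = (n : ℤ) :: (m : ℤ) :: (s.code ++ t.code) := by
    simp [hw, ClifPair.code]
  have hlen : w.length = s.code.length + t.code.length + 2 := by
    rw [hwcode]
    simp
  have hs := (length_code s).1
  have ht := (length_code t).1
  have hin : StreamAt ((init w).arr 0) 2 (s.code ++ t.code) := by
    have := streamAt_init w 2
    rw [hwcode] at this ⊢
    exact_mod_cast this
  have ha : ∀ a, a ≠ 0 → ∀ z, (init w).arr a z = 0 := fun a h z => by simp [init, h]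
  have hn : (init w).arr 0 0 = n := by simp [init, hwcode]
  have hm : (init w).arr 0 1 = m := by simp [init, hwcode]
  have hr0 : (init w).reg 0 = w.length := by simp [init]
  have hr : ∀ r, r ≠ 0 → (init w).reg r = 0 := fun r h => by simp [init, h]
  rw [decideEqual]
  simp only [Prog.wp_cons, Prog.wp_assign, Expr.eval, hn, hm]
  refine Prog.wp_consequence (wp_makeTable (W := W) hN ?_ ?_ ?_ ?_) ?_
  · simp [hr0, hW]
    ring
  · simp [hr0, hW]
    ring
  · simp [hr]
  · simp [hr]
  intro σ₁ hT₁ hf₁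
  have h1₁ : σ₁.reg 1 = W := by
    rw [hf₁.reg 1 (by decide)]
    simp [hr0, hW]
    ring
  have h2₁ : σ₁.reg 2 = (m + n : ℕ) := by
    rw [hf₁.reg 2 (by decide)]
    simp
    ring
  have ha₁ : ∀ a, a ≠ 1 → σ₁.arr a = (init w).arr a := fun a h =>
    hf₁.arr a (by simpa [makeTable, Prog.arrs, Prog.block] using h)
  have hz₁ : ∀ a, 1 < a → ∀ z, σ₁.arr a z = 0 := fun a h z => by
    rw [ha₁ a (by omega), ha a (by omega)]
  have hs₁ : StreamAt (σ₁.arr 0) 2 (s.code ++ t.code) := by rwa [ha₁ 0 (by omega)]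
  -- Each of the three inner products works in arrays of its own, which are still zero when it
  -- starts; no clearing is needed.
  rw [Prog.wp_cons]
  refine Prog.wp_consequence (wp_gram (W := W) (s := s) (t := s) (p := 2) (p' := 2)
    (rest := t.code) (rest' := t.code) (by omega) (by omega) (by omega) (by omega) (by omega)
    (by omega) (by omega) hN h1₁ h2₁ hT₁ (hz₁ 6 (by omega)) (hz₁ 4 (by omega)) (hz₁ 5 (by omega))
    (fun _ _ => rfl) (fun _ _ => rfl) hs₁ hs₁ (by simp only [List.length_append]; omega)) ?_
  rintro σ₂ ⟨-, hv₂, hs₂⟩ hf₂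
  rw [Prog.wp_cons, Prog.wp_assign, Prog.wp_cons]
  set σ₂' : State := ⟨Function.update σ₂.reg 8 ((reg 9).eval σ₂), σ₂.arr⟩ with hσ₂'
  have hr₂ : ∀ r, r < 3 → σ₂'.reg r = σ₁.reg r := fun r h => by
    rw [← hf₂.reg r (regs_gram (by omega) (by omega))]
    simp [hσ₂', show r ≠ 8 by omega]
  have ha₂ : ∀ a, a < 2 ∨ 6 < a → σ₂'.arr a = σ₁.arr a := fun a h => by
    rw [← hf₂.arr a (arrs_gram (by omega) (by omega) (by omega) (by omega) (by omega))]
  have hs₂' : StreamAt (σ₂'.arr 0) (σ₂'.reg 8) (t.code ++ []) := by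
    simpa [hσ₂', Expr.eval] using hs₂
  have hv₂' : scalar (σ₂'.reg 10) (σ₂'.reg 11) (σ₂'.reg 12) = ClifExpr.inner s s := by
    simpa [hσ₂'] using hv₂
  have hT₂ : HasTable σ₂' W := by rwa [HasTable, ha₂ 1 (by omega)]
  have hz₂ : ∀ a, 6 < a → ∀ z, σ₂'.arr a z = 0 := fun a h z => by
    rw [ha₂ a (by omega), hz₁ a (by omega)]
  clear_value σ₂'
  refine Prog.wp_consequence (wp_gram (W := W) (s := s) (t := t) (p := 2) (p' := σ₂'.reg 8)
    (rest := t.code) (rest' := []) (by omega) (by omega) (by omega) (by omega) (by omega)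
    (by omega) (by omega) hN ((hr₂ 1 (by omega)).trans h1₁) ((hr₂ 2 (by omega)).trans h2₁) hT₂
    (hz₂ 9 (by omega)) (hz₂ 7 (by omega)) (hz₂ 8 (by omega))
    (fun _ _ => rfl) (fun _ h => h) (by rwa [ha₂ 0 (by omega)]) hs₂'
    (by simp only [List.length_append, List.length_nil]; omega)) ?_
  rintro σ₃ ⟨-, hv₃, -⟩ hf₃
  have hr₃ : ∀ r, r < 3 ∨ r = 8 ∨ (9 < r ∧ r < 13) → σ₃.reg r = σ₂'.reg r := fun r h =>
    hf₃.reg r (regs_gram (by omega) (by omega))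
  have ha₃ : ∀ a, a < 2 ∨ 9 < a → σ₃.arr a = σ₂'.arr a := fun a h =>
    hf₃.arr a (arrs_gram (by omega) (by omega) (by omega) (by omega) (by omega))
  have hs₃ : StreamAt (σ₃.arr 0) (σ₃.reg 8) (t.code ++ []) := by
    rwa [ha₃ 0 (by omega), hr₃ 8 (by omega)]
  have hT₃ : HasTable σ₃ W := by rwa [HasTable, ha₃ 1 (by omega)]
  have hz₃ : ∀ a, 9 < a → ∀ z, σ₃.arr a z = 0 := fun a h z => by
    rw [ha₃ a (by omega), hz₂ a (by omega)]
  rw [Prog.wp_cons]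
  refine Prog.wp_consequence (wp_gram (W := W) (s := t) (t := t) (p := σ₃.reg 8)
    (p' := σ₃.reg 8) (rest := []) (rest' := []) (by omega) (by omega) (by omega) (by omega)
    (by omega) (by omega) (by omega) hN ?_ ?_ hT₃
    (hz₃ 12 (by omega)) (hz₃ 10 (by omega)) (hz₃ 11 (by omega)) (fun _ h => h) (fun _ h => h)
    hs₃ hs₃ (by simp only [List.length_append, List.length_nil]; omega)) ?_
  · rw [hr₃ 1 (by omega), hr₂ 1 (by omega), h1₁]
  · rw [hr₃ 2 (by omega), hr₂ 2 (by omega), h2₁]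
  rintro σ₄ ⟨-, hv₄, -⟩ hf₄
  have hr₄ : ∀ r, 9 < r ∧ r < 16 → σ₄.reg r = σ₃.reg r := fun r h =>
    hf₄.reg r (regs_gram (by omega) (by omega))
  rw [Prog.wp_cons, Prog.wp_assign, Prog.wp_cons]
  refine Prog.wp_consequence (wp_compareScalars (by omega) (by omega)) ?_
  intro σ₅ h₅ hf₅
  have hr₅ : ∀ r, 9 < r ∧ r < 19 → σ₅.reg r = σ₄.reg r := fun r h => by
    rw [hf₅.reg r (by simp [compareScalars, Prog.regs, Prog.block]; omega)]
    simp [show r ≠ 0 by omega]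
  rw [Prog.wp_cons]
  refine Prog.wp_consequence (wp_compareScalars (by omega) (by omega)) ?_
  intro σ₆ h₆ hf₆
  rw [Prog.wp_nil]
  have hiff : ClifPair.Equal ⟨n, m, s, t⟩ ↔
      ClifExpr.inner s s = ClifExpr.inner s t ∧ ClifExpr.inner s t = ClifExpr.inner t t :=
    (ClifPair.equal_iff _).trans (ClifExpr.interp_eq_iff s t)
  rw [hiff, ← hv₂', ← hv₃, ← hv₄]
  simp [Expr.eval, hr₄, hr₃] at h₅
  simp [hr₅, hr₄] at h₆
  refine ⟨fun h => ?_, fun h => ?_⟩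
  · rw [h₆.1 h.2, h₅.1 h.1]
  · by_cases h' : scalar (σ₃.reg 13) (σ₃.reg 14) (σ₃.reg 15) =
        scalar (σ₄.reg 16) (σ₄.reg 17) (σ₄.reg 18)
    · rw [h₆.1 h', h₅.2 fun h'' => h ⟨h'', h'⟩]
    · exact h₆.2 h'

end RAM

theorem mainTheorem8 :
    RAM.DecidableInPolyTime ClifPair.code ClifPair.size ClifPair.Equal := by
  obtain ⟨q, hq⟩ := RAM.decideEqual.exists_polynomial_time
  -- The input has at most 5 integers per unit of size and two more for `n` and `m`; four times this
  -- is `20 * size + 8`.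
  refine ⟨RAM.decideEqual, q.comp (20 * Polynomial.X + 8), fun x => ?_⟩
  have hlen : 4 * x.code.length ≤ 20 * x.size + 8 := by
    have h1 := (RAM.length_code x.left).2
    have h2 := (RAM.length_code x.right).2
    simp only [ClifPair.code, ClifPair.size, List.length_append, List.length_cons, List.length_nil]
    omega
  obtain ⟨T, τ, hrun, hT, hτ⟩ := RAM.Prog.wp_sound (RAM.wp_decideEqual x hlen)
  refine ⟨T, τ, hrun, ?_, hτ⟩
  rw [hq] at hT
  simpa [Polynomial.eval_comp] using hT
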